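/- Let $\mathbb T=\mathbb R/2\pi\mathbb Z$, $\widehat u(n)=\frac1{2\pi}\int_0^{2\pi}e^{-inx}u(x)\,dx$, let $H^1(\mathbb T)$ be the Sobolev space with norm $\big(\sum_n(1+n^2)|\widehat u(n)|^2\big)^{1/2}$, and let $|D|:H^1(\mathbb T)\to L^2(\mathbb T)$ be the Fourier multiplier $\widehat{|D|u}(n)=|n|\,\widehat u(n)$. Let $\tfrac12<\beta\le 1$ and let $\chi:\mathbb T\to\mathbb R$ be Hölder continuous with exponent $\beta$ ($\chi\in C^{0,\beta}(\mathbb T)$), $\chi\ge 0$, $\chi\ne 0$. For $\tau\in\mathbb C$ put $$P(\tau)=|D|-i\tau\chi-\tau^2:\ H^1(\mathbb T)\to L^2(\mathbb T).$$ Then $P(\tau)^{-1}:L^2(\mathbb T)\to H^1(\mathbb T)$, $\tau\in\mathbb C$, is a meromorphic family of operators with poles of finite rank: for every $\tau_0\in\mathbb C$, $P(\tau)$ is invertible for all $\tau\neq\tau_0$ close to $\tau_0$, and there $P(\tau)^{-1}=B(\tau)+\sum_{j=1}^J(\tau-\tau_0)^{-j}A_j$ with $B$ holomorphic near $\tau_0$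 and $A_j$ bounded operators of finite rank. The set of its poles, called resonances, is denoted by $\mathscr R$. 1. There exists $C>0$ such that every $\tau\in\mathscr R$ with $|\operatorname{Re}\tau|>C$ satisfies $$\operatorname{Im}\tau<-C^{-1}|\operatorname{Re}\tau|^{-1}.$$ Moreover, suppose that $\chi\in C^\infty(\mathbb T)$ has finite degeneracy: $\chi$ has finitely many zeros $x_1,\dots,x_n$, and for each $x_k$ there is an integer $N_k>0$ with $\chi^{(\ell)}(x_k)=0$ for $0\le\ell\le 2N_k-1$ and $\chi^{(2N_k)}(x_k)>0$. Let $N=\max_k N_k$ (and $N=0$ if $\chi$ has no zeros). Then for every $\gamma''>0$ there exists $C>0$ such that every $\tau\in\mathscr R$ with $|\operatorname{Re}\tau|>C$ satisfies $$\operatorname{Im}\tau<-C^{-1}|\operatorname{Re}\tau|^{-\frac{2N}{2N+1}-\gamma''}.$$ 2. For $\nu>0$ let $\mathscr R(\nu)$ be the set of resonances for the damping $\nu\chi$, that is, the set of poles of the inverse of $P(\nu,\tau)=|D|-i\nu\tau\chi-\tau^2$. For every integer $k>0$ there exist $\nu_k>0$, an open neighborhood $U_k\subset\mathbb C$ of $\sqrt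 k$, and functions $\tau_{k,+},\tau_{k,-}\in C^\infty((0,\nu_k);U_k)$ such that for all $\nu\in(0,\nu_k)$ $$\mathscr R(\nu)\cap U_k=\{\tau_{k,+}(\nu),\tau_{k,-}(\nu)\}$$ (the two may coincide), and, as $\nu\to0^+$, $$\tau_{k,\pm}(\nu)=\sqrt k-\frac{\widehat\chi(0)\pm|\widehat\chi(2k)|}{2}\,i\nu+o(\nu).$$ -/

import Mathlib

open Asymptotics
open scoped ENNReal NNReal Topology ContDiff

noncomputable section

namespace DampedWave

instance instFactTwoPiPos : Fact (0 < 2 * Real.pi) := ⟨Real.two_pi_pos⟩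

/-- The circle `ℝ / 2πℤ`. -/
abbrev Circ : Type := AddCircle (2 * Real.pi)

/-- `L²` of the circle, for the normalized measure `dx / 2π`. -/
abbrev L2 : Type := MeasureTheory.Lp ℂ 2 (AddCircle.haarAddCircle (T := 2 * Real.pi))

/-- The Fourier coefficient `û(n) = (2π)⁻¹ ∫₀^{2π} e^{-inx} u(x) dx`. -/
def coeff (u : Circ → ℂ) (n : ℤ) : ℂ := fourierCoeff u n

lemma coeff_eq_integral (u : Circ → ℂ) (n : ℤ) :
    coeff u n = 1 / (2 * Real.pi : ℝ) *
      ∫ x in (0 : ℝ)..(2 * Real.pi), Complex.exp (-(Complex.I * n * x)) * u (x : Circ) := by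
  rw [coeff, fourierCoeff_eq_intervalIntegral u n 0, zero_add, Complex.real_smul]
  push_cast
  congr 1
  refine intervalIntegral.integral_congr fun x _ => ?_
  simp only [smul_eq_mul]
  congr 1
  rw [fourier_coe_apply]
  congr 1
  have : (Real.pi : ℂ) ≠ 0 := by exact_mod_cast Real.pi_ne_zero
  push_cast
  field_simp

lemma coeff_eq_repr (u : L2) (n : ℤ) : coeff u n = fourierBasis.repr u n :=
  (fourierBasis_repr u n).symm

/-- The Sobolev space `H¹` of the circle, realized as the graph of `|D|`: the pairs `(u, v)` of
`L²` functions with `v̂(n) = |n| û(n)` for all `n`. The second component is determined by the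
first one. The norm inherited from `L² ⊕ L²` is `(∑ (1 + n²) |û(n)|²)^{1/2}`. -/
def H1 : Submodule ℂ (WithLp 2 (L2 × L2)) where
  carrier := {w | ∀ n : ℤ, coeff w.snd n = ((|n| : ℤ) : ℂ) * coeff w.fst n}
  add_mem' := by
    intro a b ha hb n
    have h1 := ha n
    have h2 := hb n
    simp only [coeff_eq_repr] at h1 h2 ⊢
    simp [h1, h2, mul_add]
  zero_mem' := by
    intro n
    simp only [coeff_eq_repr]
    simp
  smul_mem' := by
    intro c a ha n
    have h1 := ha n
    simp only [coeff_eq_repr] at h1 ⊢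
    simp [h1]
    ring

/-- The inclusion `H¹ → L²`. -/
def incl : H1 →L[ℂ] L2 := (WithLp.fstL 2 ℂ L2 L2).comp H1.subtypeL

/-- The operator `|D| : H¹ → L²`. -/
def absD : H1 →L[ℂ] L2 := (WithLp.sndL 2 ℂ L2 L2).comp H1.subtypeL

/-- `|D|` is the Fourier multiplier `|n|`. -/
lemma coeff_absD (u : H1) (n : ℤ) :
    coeff (absD u) n = ((|n| : ℤ) : ℂ) * coeff (incl u) n := u.2 n

lemma hasSum_sq_coeff (u : L2) : HasSum (fun n : ℤ => ‖coeff u n‖ ^ 2) (‖u‖ ^ 2) := by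
  have h := lp.hasSum_norm (p := 2) (by simp) (fourierBasis.repr u)
  rw [LinearIsometryEquiv.norm_map] at h
  simpa [coeff_eq_repr] using h

/-- The norm of `H¹` is the usual Sobolev norm. -/
lemma H1_norm_sq (u : H1) :
    HasSum (fun n : ℤ => (1 + (n : ℝ) ^ 2) * ‖coeff (incl u) n‖ ^ 2) (‖u‖ ^ 2) := by
  have h : ‖u‖ ^ 2 = ‖incl u‖ ^ 2 + ‖absD u‖ ^ 2 := WithLp.prod_norm_sq_eq_of_L2 u.1
  rw [h]
  convert (hasSum_sq_coeff (incl u)).add (hasSum_sq_coeff (absD u)) using 2 with n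
  rw [coeff_absD, norm_mul, mul_pow, Complex.norm_intCast, ← Int.cast_abs, abs_abs, Int.cast_abs, sq_abs]
  ring

/-- A function in `L²` belongs to `H¹` exactly if `∑ (1 + n²) |û(n)|²` converges. -/
lemma mem_range_incl (u : L2) :
    (∃ w : H1, incl w = u) ↔ Summable fun n : ℤ => (1 + (n : ℝ) ^ 2) * ‖coeff u n‖ ^ 2 := by
  constructor
  · rintro ⟨w, rfl⟩
    exact (H1_norm_sq w).summable
  · intro h
    have hmem : Memℓp (fun n : ℤ => ((|n| : ℤ) : ℂ) * coeff u n) 2 := by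
      refine memℓp_gen (h.of_nonneg_of_le (fun n => by positivity) fun n => ?_)
      simp only [ENNReal.toReal_ofNat, Real.rpow_ofNat]
      rw [norm_mul, mul_pow, Complex.norm_intCast, ← Int.cast_abs, abs_abs, Int.cast_abs, sq_abs]
      gcongr
      simp
    let v : L2 := fourierBasis.repr.symm ⟨_, hmem⟩
    refine ⟨⟨WithLp.toLp 2 (u, v), fun n => ?_⟩, rfl⟩
    change coeff v n = _
    rw [coeff_eq_repr, LinearIsometryEquiv.apply_symm_apply]
    rfl

/-- Multiplication by the continuous real function `χ`, as an operator on `L²`. -/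
def mulOp (χ : C(Circ, ℝ)) : L2 →L[ℂ] L2 :=
  (ContinuousLinearMap.mul ℂ ℂ).holderL AddCircle.haarAddCircle ∞ 2 2
    (ContinuousMap.toLp ∞ AddCircle.haarAddCircle ℂ
      (⟨fun x => (χ x : ℂ), by fun_prop⟩ : C(Circ, ℂ)))

lemma coeFn_mulOp (χ : C(Circ, ℝ)) (u : L2) :
    mulOp χ u =ᵐ[AddCircle.haarAddCircle] fun x => (χ x : ℂ) * u x := by
  have h1 := (ContinuousLinearMap.mul ℂ ℂ).coeFn_holder (r := 2)
    (ContinuousMap.toLp ∞ AddCircle.haarAddCircle ℂ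
      (⟨fun x => (χ x : ℂ), by fun_prop⟩ : C(Circ, ℂ))) u
  have h2 := ContinuousMap.coeFn_toLp (p := ∞) (𝕜 := ℂ) AddCircle.haarAddCircle
    (⟨fun x => (χ x : ℂ), by fun_prop⟩ : C(Circ, ℂ))
  filter_upwards [h1, h2] with x hx1 hx2
  refine hx1.trans ?_
  rw [hx2]
  rfl

/-- The operator `P(τ) = |D| - iτχ - τ² : H¹ → L²`. -/
def P (χ : C(Circ, ℝ)) (τ : ℂ) : H1 →L[ℂ] L2 :=
  absD - (Complex.I * τ) • (mulOp χ).comp incl - τ ^ 2 • incl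

/-- The resolvent `P(τ)⁻¹ : L² → H¹`. At the points where `P(τ)` has no bounded inverse it has the
conventional value `0`. -/
def resolvent (χ : C(Circ, ℝ)) (τ : ℂ) : L2 →L[ℂ] H1 := (P χ τ).inverse

/-- The operator family `R`, defined in a punctured neighbourhood of `τ₀`, has there the form
`R(τ) = B(τ) + ∑_{j=1}^J (τ - τ₀)^{-j} A_j` with `B` holomorphic near `τ₀` and operators `A_j`
of finite rank. -/
def FiniteRankMeromorphicAt {E F : Type*} [NormedAddCommGroup E] [NormedSpace ℂ E]
    [NormedAddCommGroup F] [NormedSpace ℂ F] (R : ℂ → E →L[ℂ] F) (τ₀ : ℂ) : Prop :=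
  ∃ (J : ℕ) (A : ℕ → E →L[ℂ] F) (B : ℂ → E →L[ℂ] F),
    (∀ j, FiniteDimensional ℂ (LinearMap.range (A j : E →ₗ[ℂ] F))) ∧
    AnalyticAt ℂ B τ₀ ∧
    ∀ᶠ τ in 𝓝[≠] τ₀, R τ = B τ + ∑ j ∈ Finset.Icc 1 J, ((τ - τ₀) ^ j)⁻¹ • A j

/-- The resonances: the poles of the resolvent. -/
def resonances (χ : C(Circ, ℝ)) : Set ℂ := {τ | meromorphicOrderAt (resolvent χ) τ < 0}

/-- The periodic function on `ℝ` given by a function on the circle. -/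
def lift (χ : C(Circ, ℝ)) (x : ℝ) : ℝ := χ (x : Circ)

/-- At the point `x`, `χ^{(ℓ)}(x) = 0` for `0 ≤ ℓ ≤ 2N - 1` and `χ^{(2N)}(x) > 0`,
where `N > 0`. -/
def DegenerateZero (χ : C(Circ, ℝ)) (x : ℝ) (N : ℕ) : Prop :=
  0 < N ∧ (∀ ℓ < 2 * N, iteratedDeriv ℓ (lift χ) x = 0) ∧ 0 < iteratedDeriv (2 * N) (lift χ) x

/-- Finite degeneracy of a smooth function `χ ≥ 0`. -/
def FiniteDegeneracy (χ : C(Circ, ℝ)) : Prop :=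
  ContDiff ℝ ∞ (lift χ) ∧ (∀ x, 0 ≤ χ x) ∧ {x : Circ | χ x = 0}.Finite ∧
    ∀ x : ℝ, χ (x : Circ) = 0 → ∃ N, DegenerateZero χ x N

/-- `N` is the maximum of the numbers `N_k` attached to the zeros of `χ`
(with the convention that `N = 0` if there are no zeros). -/
def IsMaxDegeneracy (χ : C(Circ, ℝ)) (N : ℕ) : Prop :=
  IsLUB {M : ℕ | ∃ x : ℝ, DegenerateZero χ x M} N

end DampedWave

end

/-!
Everything rests on the fact that the resonances are the points `τ` where `P(τ)` has a kernel
(`mem_resonances_iff`). Since `|D| + 1 : H¹ → L²` is invertible with an inverse that is small on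
high frequencies, `P(τ)` is, locally uniformly in `τ`, a product of invertible analytic factors and
of a perturbation of the identity through a finite dimensional space (`exists_factorization`). As
`P(i) = |D| + χ + 1` is injective, the determinant of the finite dimensional block does not vanish
identically, and Cramer's rule gives the meromorphic inverse (`fredholm`).

*Resonance-free regions.* Let `P(τ) u = 0`, with `|Re τ| = a` large and `Im τ` close to `0`. The
imaginary part of `⟨P(τ) u, u⟩ = 0` says that `∫ χ |u|² = -2 Im τ ‖u‖²`, so that `χ u` is small
(`integral_eq_of_P_eq_zero`). Two consequences follow. First, the frequencies of `u` below `a² / 2`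
are `O(a⁻¹ ‖χ u‖)`, because there `|D| - τ²` is elliptic (`norm_low_le`). Second, write `u` as the
sum of its parts of nonnegative and of negative frequency. The multiplication by `χ` couples the
high frequencies of the two only over gaps of size `a²`, and by Jackson's approximation theorem
such a coupling has norm `O(a^{-2β})` (`exists_norm_proj_mulOp_le`). On functions with frequencies
of one sign `|D|` is `∓ i d/dx`, so that each of the two parts solves a first order differential
equation on the circle. Its homogeneous solutions change by the factor
`exp (∓ a ∫ (χ + 2 Im τ))`, up to a phase. As long as `a ∫ (χ + 2 Im τ)₋` stays bounded this gives
`‖u‖ ≤ C ‖P(τ) v‖` for each of the parts `v` (`norm_le_norm_P`), where `‖P(τ) v‖` is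
`O(a (a⁻¹ ‖χ u‖ + a^{-2β} ‖u‖))`. For `β > 1/2` this is `o(1) ‖u‖`, a contradiction
(`exists_no_resonance`). It remains to bound `a ∫ (χ + 2 Im τ)₋` in the two regions: for
`-Im τ ≲ a⁻¹` this is immediate, and for finitely degenerate `χ` the set where `χ < s` has measure
`O(s^{1/(2N)})`.

*Resonances near `√k`.* The space `V` of the modes `e^{±ikx}` is the eigenspace of `|D|` for the
eigenvalue `k`. The implicit function theorem gives operators `X(ν) : V → H¹` and `T(ν) : V → V`,
analytic in `ν`, with `|D| X - iν χ X T - X T² = 0`, and for `τ` near `√k` the number `τ` is a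
resonance exactly if it is an eigenvalue of the `2 × 2` matrix `T(ν)`
(`IsSpectralReduction.exists_reduction`). This matrix is `√k` at `ν = 0`, with the derivative
`-(i/2) (χ̂(n - m))` for `n, m = ± k`, whose eigenvalues are `-(i/2) (χ̂(0) ± |χ̂(2k)|)`. The
discriminant of `T(ν)` is `ν²` times an analytic function, which has a smooth square root for
`ν > 0` (`exists_contDiffAt_sq_eq`), so that the two eigenvalues are smooth functions of `ν > 0`
with the stated expansion (`exists_roots`).
-/

noncomputable section

namespace DampedWave

open MeasureTheory

/-- The normalized Haar measure `dx / 2π` of the circle. -/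
local notation "μ₀" => (AddCircle.haarAddCircle (T := 2 * Real.pi))

/-! ### Fourier coefficients and multipliers on `L²` and `H¹` -/

/-- The exponential `x ↦ e^{inx}` as an element of `L²`. -/
abbrev expL (n : ℤ) : L2 := fourierLp 2 n

/-- The `n`-th Fourier coefficient as a bounded functional on `L²`. -/
def coeffL (n : ℤ) : L2 →L[ℂ] ℂ := innerSL ℂ (expL n)

lemma coeffL_apply (n : ℤ) (u : L2) : coeffL n u = coeff u n := by
  rw [coeff_eq_repr, HilbertBasis.repr_apply_apply, coe_fourierBasis]
  rfl

lemma coeff_eq_inner (n : ℤ) (u : L2) : coeff u n = inner ℂ (expL n) u := (coeffL_apply n u).symm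

lemma coeff_expL (n m : ℤ) : coeff (expL n) m = if m = n then 1 else 0 := by
  rw [coeff_eq_inner, orthonormal_iff_ite.mp orthonormal_fourier]

@[simp] lemma coeff_add (u v : L2) (n : ℤ) : coeff (u + v : L2) n = coeff u n + coeff v n := by
  simp only [← coeffL_apply, map_add]

@[simp] lemma coeff_sub (u v : L2) (n : ℤ) : coeff (u - v : L2) n = coeff u n - coeff v n := by
  simp only [← coeffL_apply, map_sub]

@[simp] lemma coeff_smul (c : ℂ) (u : L2) (n : ℤ) : coeff (c • u : L2) n = c * coeff u n := by
  simp only [← coeffL_apply, map_smul, smul_eq_mul]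

@[simp] lemma coeff_zero (n : ℤ) : coeff (0 : L2) n = 0 := by
  simp only [← coeffL_apply, map_zero]

lemma ext_coeff {u v : L2} (h : ∀ n, coeff u n = coeff v n) : u = v := by
  apply fourierBasis.repr.injective
  ext n
  simpa only [coeff_eq_repr] using h n

lemma norm_le_of_coeff {u v : L2} {C : ℝ} (hC : 0 ≤ C)
    (h : ∀ n, ‖coeff u n‖ ≤ C * ‖coeff v n‖) : ‖u‖ ≤ C * ‖v‖ := by
  have h1 := hasSum_sq_coeff u
  have h2 := (hasSum_sq_coeff v).mul_left (C ^ 2)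
  have h3 := hasSum_le (fun n => ?_) h1 h2
  · rw [← mul_pow] at h3
    exact le_of_sq_le_sq h3 (by positivity)
  · rw [← mul_pow]
    exact pow_le_pow_left₀ (norm_nonneg _) (h n) 2
where
  le_of_sq_le_sq {a b : ℝ} (h : a ^ 2 ≤ b ^ 2) (hb : 0 ≤ b) : a ≤ b := abs_le_of_sq_le_sq' h hb |>.2

lemma exists_coeff {u : L2} {C : ℝ} {f : ℤ → ℂ} (h : ∀ n, ‖f n‖ ≤ C * ‖coeff u n‖) :
    ∃ v : L2, ∀ n, coeff v n = f n := by
  have hmem : Memℓp f 2 := by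
    refine memℓp_gen (((hasSum_sq_coeff u).summable.mul_left (C ^ 2)).of_nonneg_of_le
      (fun n => by positivity) fun n => ?_)
    simp only [ENNReal.toReal_ofNat, Real.rpow_ofNat]
    rw [← mul_pow]
    exact pow_le_pow_left₀ (norm_nonneg _) (h n) 2
  refine ⟨fourierBasis.repr.symm ⟨_, hmem⟩, fun n => ?_⟩
  rw [coeff_eq_repr, LinearIsometryEquiv.apply_symm_apply]

/-- The Fourier multiplier on `L²` with symbol `m`, where `|m(n)| ≤ C`. The value at `u` is chosen
as the function with the Fourier coefficients `m(n) û(n)`. -/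
def mult (m : ℤ → ℂ) (C : ℝ) (h : ∀ n, ‖m n‖ ≤ C) : L2 →L[ℂ] L2 :=
  have hex : ∀ u : L2, ∃ v : L2, ∀ n, coeff v n = m n * coeff u n := fun u =>
    exists_coeff (u := u) (C := C) fun n => by rw [norm_mul]; gcongr; exact h n
  LinearMap.mkContinuous
    { toFun := fun u => (hex u).choose
      map_add' := fun u v => ext_coeff fun n => by
        rw [coeff_add, (hex u).choose_spec, (hex v).choose_spec, (hex (u + v)).choose_spec,
          coeff_add, mul_add]
      map_smul' := fun c u => ext_coeff fun n => by
        rw [RingHom.id_apply, coeff_smul, (hex u).choose_spec, (hex (c • u)).choose_spec,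
          coeff_smul]
        ring } C fun u => by
      refine norm_le_of_coeff ((norm_nonneg _).trans (h 0)) fun n => ?_
      change ‖coeff ((hex u).choose) n‖ ≤ _
      rw [(hex u).choose_spec, norm_mul]
      gcongr
      exact h n

@[simp] lemma coeff_mult (m : ℤ → ℂ) (C : ℝ) (h : ∀ n, ‖m n‖ ≤ C) (u : L2) (n : ℤ) :
    coeff (mult m C h u) n = m n * coeff u n :=
  Exists.choose_spec (p := fun v : L2 => ∀ n, coeff v n = m n * coeff u n) _ n

lemma norm_mult_le (m : ℤ → ℂ) (C : ℝ) (h : ∀ n, ‖m n‖ ≤ C) : ‖mult m C h‖ ≤ C :=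
  ContinuousLinearMap.opNorm_le_bound _ ((norm_nonneg _).trans (h 0)) fun u =>
    norm_le_of_coeff ((norm_nonneg _).trans (h 0)) fun n => by
      rw [coeff_mult, norm_mul]
      gcongr
      exact h n

open Classical in
/-- The projection of `L²` onto the Fourier modes in the set `S`. -/
def proj (S : Set ℤ) : L2 →L[ℂ] L2 :=
  mult (fun n => if n ∈ S then 1 else 0) 1 fun n => by split_ifs <;> simp

open Classical in
@[simp] lemma coeff_proj (S : Set ℤ) (u : L2) (n : ℤ) :
    coeff (proj S u) n = if n ∈ S then coeff u n else 0 := by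
  rw [proj, coeff_mult]
  split_ifs <;> simp

lemma norm_proj_le (S : Set ℤ) (u : L2) : ‖proj S u‖ ≤ ‖u‖ := by
  classical
  refine (norm_le_of_coeff zero_le_one fun n => ?_).trans_eq (one_mul ‖u‖)
  rw [coeff_proj]
  split_ifs <;> simp

lemma proj_add_proj_compl (S : Set ℤ) (u : L2) : proj S u + proj Sᶜ u = u := by
  classical
  refine ext_coeff fun n => ?_
  rw [coeff_add, coeff_proj, coeff_proj]
  by_cases h : n ∈ S <;> simp [h]

/-- The Fourier multiplier `L² → H¹` with symbol `m`, where `m(n)` and `n m(n)` are bounded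
by `C`. -/
def multH (m : ℤ → ℂ) (C : ℝ) (h : ∀ n, ‖m n‖ ≤ C) (h' : ∀ n : ℤ, ‖((|n| : ℤ) : ℂ) * m n‖ ≤ C) :
    L2 →L[ℂ] H1 :=
  (((WithLp.prodContinuousLinearEquiv 2 ℂ L2 L2).symm : (L2 × L2) →L[ℂ] WithLp 2 (L2 × L2)).comp
    ((mult m C h).prod (mult (fun n => ((|n| : ℤ) : ℂ) * m n) C h'))).codRestrict H1
    (fun u n => by
      change coeff (mult _ C h' u) n = _ * coeff (mult m C h u) n
      rw [coeff_mult, coeff_mult, mul_assoc])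

@[simp] lemma incl_multH (m : ℤ → ℂ) (C : ℝ) (h h') (u : L2) :
    incl (multH m C h h' u) = mult m C h u := rfl

lemma incl_injective : Function.Injective incl := by
  intro u v h
  have h2 : absD u = absD v := ext_coeff fun n => by rw [coeff_absD, coeff_absD, h]
  have h1 : WithLp.ofLp u.1 = WithLp.ofLp v.1 := Prod.ext h h2
  exact Subtype.ext ((WithLp.equiv 2 _).injective h1)

lemma ext_coeffH {u v : H1} (h : ∀ n, coeff (incl u) n = coeff (incl v) n) : u = v :=
  incl_injective (ext_coeff h)

instance : CompleteSpace H1 := by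
  have : IsClosed (H1 : Set (WithLp 2 (L2 × L2))) := by
    have h : (H1 : Set (WithLp 2 (L2 × L2))) = ⋂ n : ℤ,
        {w | coeffL n (WithLp.sndL 2 ℂ L2 L2 w)
          = ((|n| : ℤ) : ℂ) * coeffL n (WithLp.fstL 2 ℂ L2 L2 w)} := by
      ext w
      simp only [Set.mem_iInter, Set.mem_ofPred_eq, coeffL_apply]
      rfl
    rw [h]
    exact isClosed_iInter fun n => isClosed_eq (by fun_prop) (by fun_prop)
  exact this.completeSpace_coe

/-- The exponential `x ↦ e^{inx}` as an element of `H¹`. -/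
def expH (n : ℤ) : H1 := ⟨WithLp.toLp 2 (expL n, ((|n| : ℤ) : ℂ) • expL n), fun k => by
  change coeff ((((|n| : ℤ) : ℂ) • expL n : L2)) k = _ * coeff (expL n) k
  rw [coeff_smul, coeff_expL]
  split_ifs with h
  · rw [h]
  · simp⟩

@[simp] lemma incl_expH (n : ℤ) : incl (expH n) = expL n := rfl

@[simp] lemma absD_expH (n : ℤ) : absD (expH n) = ((|n| : ℤ) : ℂ) • expL n := rfl

lemma hasSum_expL (u : L2) : HasSum (fun n => coeff u n • expL n) u := by
  simpa only [coeff_eq_repr, coe_fourierBasis] using fourierBasis.hasSum_repr u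

/-- The Fourier series of an element of `H¹` converges in `H¹`. -/
lemma hasSum_expH (w : H1) : HasSum (fun n => coeff (incl w) n • expH n) w := by
  have h : Topology.IsInducing (fun w : H1 => (incl w, absD w)) := by
    have h1 : Topology.IsInducing (Subtype.val : H1 → WithLp 2 (L2 × L2)) :=
      Topology.IsInducing.subtypeVal
    exact (WithLp.prodContinuousLinearEquiv 2 ℂ L2 L2).toHomeomorph.isInducing.comp h1
  let g : H1 →ₗ[ℂ] L2 × L2 := (incl.prod absD : H1 →L[ℂ] L2 × L2)
  refine (h.hasSum_iff (g := g) _ _).mp ?_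
  have h1 := hasSum_expL (incl w)
  have h2 := hasSum_expL (absD w)
  have h3 := h1.prodMk h2
  refine HasSum.congr_fun h3 fun n => ?_
  change (incl _, absD _) = _
  rw [map_smul, map_smul, incl_expH, absD_expH, coeff_absD, smul_smul, mul_comm (coeff (incl w) n)]

lemma norm_mulOp_apply_le (χ : C(Circ, ℝ)) (u : L2) : ‖mulOp χ u‖ ≤ ‖χ‖ * ‖u‖ := by
  refine Lp.norm_le_mul_norm_of_ae_le_mul ?_
  filter_upwards [coeFn_mulOp χ u] with x hx
  rw [hx, norm_mul, Complex.norm_real]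
  gcongr
  exact χ.norm_coe_le_norm x

lemma norm_mulOp_le (χ : C(Circ, ℝ)) : ‖mulOp χ‖ ≤ ‖χ‖ :=
  ContinuousLinearMap.opNorm_le_bound _ (norm_nonneg _) (norm_mulOp_apply_le χ)

lemma mulOp_sub (χ η : C(Circ, ℝ)) : mulOp (χ - η) = mulOp χ - mulOp η := by
  ext1 u
  refine Lp.ext ?_
  rw [sub_apply]
  filter_upwards [coeFn_mulOp χ u, coeFn_mulOp η u, coeFn_mulOp (χ - η) u,
    Lp.coeFn_sub (mulOp χ u) (mulOp η u)] with x h1 h2 h3 h4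
  rw [h4, h3, Pi.sub_apply, h1, h2]
  simp [sub_mul]

lemma mulOp_smul (c : ℝ) (χ : C(Circ, ℝ)) : mulOp (c • χ) = (c : ℂ) • mulOp χ := by
  ext1 u
  refine Lp.ext ?_
  rw [smul_apply]
  filter_upwards [coeFn_mulOp χ u, coeFn_mulOp (c • χ) u,
    Lp.coeFn_smul (c : ℂ) (mulOp χ u)] with x h1 h2 h3
  rw [h2, h3, Pi.smul_apply, h1]
  simp [mul_assoc]

lemma coeff_mulOp_expL (χ : C(Circ, ℝ)) (m n : ℤ) :
    coeff (mulOp χ (expL m)) n = coeff (fun x => (χ x : ℂ)) (n - m) := by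
  rw [coeff, coeff, fourierCoeff, fourierCoeff]
  refine integral_congr_ae ?_
  filter_upwards [coeFn_mulOp χ (expL m), coeFn_fourierLp (T := 2 * Real.pi) 2 m] with x h1 h2
  rw [h1, h2, show -(n - m) = -n + m by ring, fourier_add]
  simp only [smul_eq_mul]
  ring

/-- The Fourier coefficients of a product are a convolution. -/
lemma hasSum_coeff_mulOp (χ : C(Circ, ℝ)) (u : L2) (n : ℤ) :
    HasSum (fun m => coeff (fun x => (χ x : ℂ)) (n - m) * coeff u m) (coeff (mulOp χ u) n) := by
  have h := ((coeffL n).comp (mulOp χ)).hasSum (hasSum_expL u)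
  simp only [ContinuousLinearMap.comp_apply, coeffL_apply] at h
  convert h using 2 with m
  rw [← coeffL_apply n (mulOp χ _), map_smul, map_smul, coeffL_apply, smul_eq_mul,
    coeff_mulOp_expL, mul_comm]

lemma inner_self_mulOp (χ : C(Circ, ℝ)) (u : L2) :
    inner ℂ u (mulOp χ u) = ((∫ x, χ x * ‖u x‖ ^ 2 ∂μ₀ : ℝ) : ℂ) := by
  rw [L2.inner_def, ← integral_complex_ofReal]
  refine integral_congr_ae ?_
  filter_upwards [coeFn_mulOp χ u] with x h1
  rw [h1]
  simp only [RCLike.inner_apply]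
  push_cast
  rw [mul_assoc, Complex.mul_conj, Complex.normSq_eq_norm_sq]
  push_cast
  ring

lemma integrable_norm_sq (u : L2) : Integrable (fun x => ‖u x‖ ^ 2) μ₀ :=
  (memLp_two_iff_integrable_sq_norm (Lp.aestronglyMeasurable u)).mp (Lp.memLp u)

lemma norm_sq_eq_integral (u : L2) : ‖u‖ ^ 2 = ∫ x, ‖u x‖ ^ 2 ∂μ₀ := by
  have h := L2.inner_def (𝕜 := ℂ) u u
  rw [inner_self_eq_norm_sq_to_K] at h
  have h2 : ∀ x, (inner ℂ (u x) (u x) : ℂ) = ((‖u x‖ ^ 2 : ℝ) : ℂ) := fun x => by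
    rw [inner_self_eq_norm_sq_to_K]; norm_cast
  simp_rw [h2, integral_complex_ofReal] at h
  exact Complex.ofReal_injective ((Complex.ofReal_pow _ _).trans h)

lemma norm_mulOp_sq_le {χ : C(Circ, ℝ)} (hχ : ∀ x, 0 ≤ χ x) (u : L2) :
    ‖mulOp χ u‖ ^ 2 ≤ ‖χ‖ * ∫ x, χ x * ‖u x‖ ^ 2 ∂μ₀ := by
  rw [norm_sq_eq_integral, ← integral_const_mul]
  refine integral_mono_ae (integrable_norm_sq _) ?_ ?_
  · refine Integrable.const_mul ?_ _
    refine (integrable_norm_sq u).bdd_mul (c := ‖χ‖) χ.continuous.aestronglyMeasurable ?_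
    exact Filter.Eventually.of_forall fun x => χ.norm_coe_le_norm x
  · filter_upwards [coeFn_mulOp χ u] with x hx
    rw [hx, norm_mul, mul_pow, Complex.norm_real, Real.norm_of_nonneg (hχ x), sq, mul_assoc]
    have := (Real.norm_of_nonneg (hχ x)).symm.trans_le (χ.norm_coe_le_norm x)
    have h0 := hχ x
    gcongr

lemma P_apply (χ : C(Circ, ℝ)) (τ : ℂ) (u : H1) :
    P χ τ u = absD u - (Complex.I * τ) • mulOp χ (incl u) - τ ^ 2 • incl u := rfl

/-! ### Meromorphic families of operators -/

section Fredholm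

variable {E F G : Type*} [NormedAddCommGroup E] [NormedSpace ℂ E] [NormedAddCommGroup F]
  [NormedSpace ℂ F] [NormedAddCommGroup G] [NormedSpace ℂ G]

lemma analyticAt_clm_comp {f : ℂ → F →L[ℂ] G} {g : ℂ → E →L[ℂ] F} {z : ℂ}
    (hf : AnalyticAt ℂ f z) (hg : AnalyticAt ℂ g z) :
    AnalyticAt ℂ (fun w => (f w).comp (g w)) z :=
  AnalyticAt.comp₂ (h := fun p : (F →L[ℂ] G) × (E →L[ℂ] F) => p.1.comp p.2)
    ((ContinuousLinearMap.compL ℂ E F G).analyticAt_bilinear (f z, g z)) hf hg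

lemma analyticAt_dslope {f : ℂ → E} {z : ℂ} (hf : AnalyticAt ℂ f z) :
    AnalyticAt ℂ (dslope f z) z := by
  obtain ⟨p, hp⟩ := hf
  exact ⟨_, hp.has_fpower_series_dslope_fslope⟩

namespace FiniteRankMeromorphicAt

variable {R S : ℂ → E →L[ℂ] F} {τ₀ : ℂ}

lemma congr (h : FiniteRankMeromorphicAt R τ₀) (h' : ∀ᶠ τ in 𝓝[≠] τ₀, S τ = R τ) :
    FiniteRankMeromorphicAt S τ₀ := by
  obtain ⟨J, A, B, hA, hB, hR⟩ := h
  refine ⟨J, A, B, hA, hB, ?_⟩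
  filter_upwards [hR, h'] with τ h1 h2
  rw [h2, h1]

lemma of_analyticAt (h : AnalyticAt ℂ R τ₀) : FiniteRankMeromorphicAt R τ₀ :=
  ⟨0, 0, R, fun _ => by
    rw [Pi.zero_apply, ContinuousLinearMap.toLinearMap_zero, LinearMap.range_zero]
    infer_instance, h, by simp⟩

lemma of_pow (j : ℕ) (A : E →L[ℂ] F)
    (hA : FiniteDimensional ℂ (LinearMap.range (A : E →ₗ[ℂ] F))) :
    FiniteRankMeromorphicAt (fun τ => ((τ - τ₀) ^ j)⁻¹ • A) τ₀ := by
  rcases Nat.eq_zero_or_pos j with rfl | hj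
  · exact of_analyticAt (by simpa using analyticAt_const)
  · refine ⟨j, Pi.single j A, 0, fun i => ?_, analyticAt_const, Filter.Eventually.of_forall ?_⟩
    · by_cases h : i = j
      · subst h
        rwa [Pi.single_eq_same]
      · rw [Pi.single_eq_of_ne h, ContinuousLinearMap.toLinearMap_zero, LinearMap.range_zero]
        infer_instance
    · intro τ
      rw [Finset.sum_eq_single_of_mem j (Finset.mem_Icc.mpr ⟨hj, le_rfl⟩), Pi.single_eq_same]
      · simp
      · intro i _ h
        rw [Pi.single_eq_of_ne h, smul_zero]

lemma add (hR : FiniteRankMeromorphicAt R τ₀) (hS : FiniteRankMeromorphicAt S τ₀) :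
    FiniteRankMeromorphicAt (fun τ => R τ + S τ) τ₀ := by
  -- The coefficients beyond the order of the pole may be taken to be zero.
  have key : ∀ {R : ℂ → E →L[ℂ] F}, FiniteRankMeromorphicAt R τ₀ → ∃ J₀ : ℕ, ∀ J ≥ J₀,
      ∃ (A : ℕ → E →L[ℂ] F) (B : ℂ → E →L[ℂ] F),
      (∀ j, FiniteDimensional ℂ (LinearMap.range (A j : E →ₗ[ℂ] F))) ∧ AnalyticAt ℂ B τ₀ ∧
      ∀ᶠ τ in 𝓝[≠] τ₀, R τ = B τ + ∑ j ∈ Finset.Icc 1 J, ((τ - τ₀) ^ j)⁻¹ • A j := by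
    rintro R ⟨J, A, B, hA, hB, h⟩
    refine ⟨J, fun J' hJ => ⟨fun j => if j ≤ J then A j else 0, B, fun j => ?_, hB, ?_⟩⟩
    · have hT : ∀ T : E →L[ℂ] F, T = A j ∨ T = 0 →
          FiniteDimensional ℂ (LinearMap.range (T : E →ₗ[ℂ] F)) := by
        rintro _ (rfl | rfl)
        · exact hA j
        · rw [ContinuousLinearMap.toLinearMap_zero, LinearMap.range_zero]
          infer_instance
      refine hT _ ?_
      dsimp only
      split_ifs <;> simp
    · filter_upwards [h] with τ hτ
      rw [hτ]
      congr 1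
      rw [← Finset.sum_subset (Finset.Icc_subset_Icc_right hJ)]
      · refine Finset.sum_congr rfl fun j hj => ?_
        rw [if_pos (Finset.mem_Icc.mp hj).2]
      · intro j hj hj'
        rw [if_neg, smul_zero]
        simp only [Finset.mem_Icc] at hj hj'
        omega
  obtain ⟨J₁, h1⟩ := key hR
  obtain ⟨J₂, h2⟩ := key hS
  obtain ⟨A, B, hA, hB, h1⟩ := h1 (max J₁ J₂) (le_max_left _ _)
  obtain ⟨A', B', hA', hB', h2⟩ := h2 (max J₁ J₂) (le_max_right _ _)
  refine ⟨max J₁ J₂, A + A', B + B', fun j => ?_, hB.add hB', ?_⟩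
  · have := hA j
    have := hA' j
    refine Submodule.finiteDimensional_of_le
      (S₂ := LinearMap.range (A j : E →ₗ[ℂ] F) ⊔ LinearMap.range (A' j : E →ₗ[ℂ] F)) ?_
    rintro _ ⟨x, rfl⟩
    exact Submodule.add_mem_sup ⟨x, rfl⟩ ⟨x, rfl⟩
  · filter_upwards [h1, h2] with τ h1 h2
    rw [h1, h2]
    simp only [Pi.add_apply, smul_add, Finset.sum_add_distrib]
    abel

/-- An operator family that factors analytically through a finite dimensional space has, after
division by a power of `τ - τ₀`, a Laurent expansion with coefficients of finite rank. The induction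
on the power splits off the coefficient `X(τ₀) Y(τ₀)` of the leading term. -/
lemma of_factorization {V : Type*} [NormedAddCommGroup V] [NormedSpace ℂ V]
    [FiniteDimensional ℂ V] (J : ℕ) {X : ℂ → V →L[ℂ] F} {Y : ℂ → E →L[ℂ] V}
    (hX : AnalyticAt ℂ X τ₀) (hY : AnalyticAt ℂ Y τ₀) :
    FiniteRankMeromorphicAt (fun τ => ((τ - τ₀) ^ J)⁻¹ • (X τ).comp (Y τ)) τ₀ := by
  induction J generalizing X Y with
  | zero => exact of_analyticAt (by simpa using analyticAt_clm_comp hX hY)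
  | succ J ih =>
    have h1 := ih (analyticAt_dslope hX) hY
    have h2 := ih (analyticAt_const (v := X τ₀)) (analyticAt_dslope hY)
    have h3 : FiniteDimensional ℂ (LinearMap.range ((X τ₀).comp (Y τ₀) : E →ₗ[ℂ] F)) :=
      Submodule.finiteDimensional_of_le (S₂ := LinearMap.range (X τ₀ : V →ₗ[ℂ] F))
        (LinearMap.range_comp_le_range _ _)
    refine ((of_pow (J + 1) _ h3).add (h1.add h2)).congr ?_
    filter_upwards [self_mem_nhdsWithin] with τ hτ
    have hne : τ - τ₀ ≠ 0 := sub_ne_zero.mpr hτ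
    have e1 : X τ = X τ₀ + (τ - τ₀) • dslope X τ₀ τ := by rw [sub_smul_dslope]; abel
    have e2 : Y τ = Y τ₀ + (τ - τ₀) • dslope Y τ₀ τ := by rw [sub_smul_dslope]; abel
    have e3 : (X τ).comp (Y τ) = (X τ₀).comp (Y τ₀)
        + (τ - τ₀) • ((dslope X τ₀ τ).comp (Y τ) + (X τ₀).comp (dslope Y τ₀ τ)) := by
      conv_lhs => rw [e1, ContinuousLinearMap.add_comp, ContinuousLinearMap.smul_comp]
      nth_rewrite 1 [e2]
      rw [ContinuousLinearMap.comp_add, ContinuousLinearMap.comp_smul, smul_add]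
      abel
    rw [e3, smul_add, smul_smul, ← smul_add]
    congr 2
    rw [pow_succ]
    field_simp

lemma meromorphicAt (h : FiniteRankMeromorphicAt R τ₀) : MeromorphicAt R τ₀ := by
  obtain ⟨J, A, B, -, hB, h⟩ := h
  refine MeromorphicAt.congr (f := fun τ => B τ + ∑ j ∈ Finset.Icc 1 J, ((τ - τ₀) ^ j)⁻¹ • A j) ?_
    (h.mono fun _ h => h.symm)
  refine hB.meromorphicAt.add (MeromorphicAt.fun_sum fun j _ => ?_)
  exact MeromorphicAt.fun_smul (f := fun τ => ((τ - τ₀) ^ j)⁻¹) (by fun_prop)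
    (MeromorphicAt.const _ _)

end FiniteRankMeromorphicAt

/-- The inverse of an analytic family of operators on a finite dimensional space, invertible at
some point of a connected set, is meromorphic: it is `(τ - τ₀)^{-J} Y(τ)` with `Y` analytic. -/
lemma exists_inverse_of_finite {ι : Type*} [Fintype ι] {U : Set ℂ}
    (hU : IsPreconnected U) {D : ℂ → (ι → ℂ) →L[ℂ] (ι → ℂ)} (hD : AnalyticOnNhd ℂ D U)
    {τ₁ : ℂ} (h₁ : τ₁ ∈ U) (hi : Function.Injective (D τ₁)) {τ₀ : ℂ} (h₀ : τ₀ ∈ U) :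
    ∃ (J : ℕ) (Y : ℂ → (ι → ℂ) →L[ℂ] (ι → ℂ)), AnalyticAt ℂ Y τ₀ ∧ ∀ᶠ τ in 𝓝[≠] τ₀,
      (D τ).comp (((τ - τ₀) ^ J)⁻¹ • Y τ) = .id ℂ _ ∧
      (((τ - τ₀) ^ J)⁻¹ • Y τ).comp (D τ) = .id ℂ _ := by
  classical
  let m : ℂ → Matrix ι ι ℂ := fun τ => LinearMap.toMatrix' (D τ : (ι → ℂ) →ₗ[ℂ] (ι → ℂ))
  have hm : ∀ i j, AnalyticOnNhd ℂ (fun τ => m τ i j) U := by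
    intro i j
    let ev : ((ι → ℂ) →L[ℂ] (ι → ℂ)) →L[ℂ] ℂ :=
      (ContinuousLinearMap.proj (R := ℂ) (φ := fun _ : ι => ℂ) i).comp
        (ContinuousLinearMap.apply ℂ (ι → ℂ) (Pi.single j (1 : ℂ)))
    have : (fun τ => m τ i j) = fun τ => ev (D τ) := by
      ext τ
      simp [m, ev, LinearMap.toMatrix'_apply]
    rw [this]
    exact fun τ hτ => (ev.analyticAt _).comp (hD τ hτ)
  have hdet : ∀ (a : ℂ → Matrix ι ι ℂ) (τ : ℂ), (∀ i j, AnalyticAt ℂ (fun τ => a τ i j) τ) →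
      AnalyticAt ℂ (fun τ => (a τ).det) τ := by
    intro a τ ha
    simp only [Matrix.det_apply]
    refine Finset.analyticAt_fun_sum _ fun σ _ => ?_
    refine AnalyticAt.const_smul ?_
    exact Finset.analyticAt_fun_prod _ fun i _ => ha _ _
  let d : ℂ → ℂ := fun τ => (m τ).det
  have hd : AnalyticOnNhd ℂ d U := fun τ hτ => hdet m τ fun i j => hm i j τ hτ
  have hd1 : d τ₁ ≠ 0 := by
    have h2 : IsUnit (D τ₁ : (ι → ℂ) →ₗ[ℂ] (ι → ℂ)) :=
      (LinearMap.isUnit_iff_ker_eq_bot _).mpr (LinearMap.ker_eq_bot.mpr hi)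
    change (LinearMap.toMatrix' _).det ≠ 0
    rw [LinearMap.det_toMatrix']
    exact (h2.map LinearMap.det).ne_zero
  have hne : ¬ ∀ᶠ τ in 𝓝 τ₀, d τ = 0 := fun h =>
    hd1 (hd.eqOn_zero_of_preconnected_of_eventuallyEq_zero hU h₀ h h₁)
  obtain ⟨J, g, hg, hg0, hdg⟩ := (hd τ₀ h₀).exists_eventuallyEq_pow_smul_nonzero_iff.mpr hne
  -- the inverse is the adjugate divided by the determinant
  let toC : Matrix ι ι ℂ → (ι → ℂ) →L[ℂ] (ι → ℂ) := fun a =>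
    LinearMap.toContinuousLinearMap (Matrix.toLin' a)
  have htoC : ∀ (a : ℂ → Matrix ι ι ℂ) (τ : ℂ), (∀ i j, AnalyticAt ℂ (fun τ => a τ i j) τ) →
      AnalyticAt ℂ (fun τ => toC (a τ)) τ := by
    intro a τ ha
    have : (fun τ => toC (a τ)) = fun τ => ∑ i, ∑ j, a τ i j • toC (Matrix.single i j 1) := by
      ext1 τ
      conv_lhs => rw [Matrix.matrix_eq_sum_single (a τ)]
      simp only [toC, map_sum]
      refine Finset.sum_congr rfl fun i _ => Finset.sum_congr rfl fun j _ => ?_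
      rw [← map_smul, ← map_smul, Matrix.smul_single, smul_eq_mul, mul_one]
    rw [this]
    exact Finset.analyticAt_fun_sum _ fun i _ => Finset.analyticAt_fun_sum _ fun j _ =>
      (ha i j).smul analyticAt_const
  have hmul : ∀ a b, toC (a * b) = (toC a).comp (toC b) := fun a b => by
    ext1 v
    simp [toC]
  have hone : toC 1 = .id ℂ _ := by
    ext1 v
    simp [toC]
  have hDm : ∀ τ, D τ = toC (m τ) := fun τ => by
    ext1 v
    simp [toC, m]
  have hsm : ∀ (c : ℂ) a, toC (c • a) = c • toC a := fun c a => by simp [toC]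
  refine ⟨J, fun τ => (g τ)⁻¹ • toC (m τ).adjugate, ?_, ?_⟩
  · refine (hg.inv hg0).smul (htoC _ τ₀ fun i j => ?_)
    simp only [Matrix.adjugate_apply]
    refine hdet _ τ₀ fun i' j' => ?_
    simp only [Matrix.updateRow_apply]
    split_ifs
    · exact analyticAt_const
    · exact hm _ _ τ₀ h₀
  · filter_upwards [self_mem_nhdsWithin, nhdsWithin_le_nhds hdg,
      nhdsWithin_le_nhds (hg.continuousAt.eventually_ne hg0)] with τ hτ h1 h2
    have hne : (τ - τ₀) ^ J ≠ 0 := pow_ne_zero _ (sub_ne_zero.mpr hτ)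
    have h3 : ((τ - τ₀) ^ J)⁻¹ • ((g τ)⁻¹ • (m τ).det) = 1 := by
      change _ • (_ • d τ) = _
      rw [h1]
      simp only [smul_eq_mul]
      field_simp
    rw [hDm τ]
    constructor
    · rw [ContinuousLinearMap.comp_smul, ContinuousLinearMap.comp_smul, ← hmul,
        Matrix.mul_adjugate, hsm, hone, smul_smul, smul_smul, mul_assoc]
      simp only [smul_eq_mul] at h3
      rw [h3, one_smul]
    · rw [ContinuousLinearMap.smul_comp, ContinuousLinearMap.smul_comp, ← hmul,
        Matrix.adjugate_mul, hsm, hone, smul_smul, smul_smul, mul_assoc]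
      simp only [smul_eq_mul] at h3
      rw [h3, one_smul]

end Fredholm

/-! ### Fredholm theory of `P(τ)` -/

lemma norm_one_add_abs (n : ℤ) : ‖((1 + |n| : ℤ) : ℂ)‖ = 1 + |(n : ℝ)| := by
  rw [Complex.norm_intCast]
  push_cast
  exact abs_of_nonneg (by positivity)

/-- The operator `(|D| + 1)⁻¹ : L² → H¹`. -/
def lamInv : L2 →L[ℂ] H1 :=
  multH (fun n => ((1 + |n| : ℤ) : ℂ)⁻¹) 1
    (fun n => by
      rw [norm_inv, norm_one_add_abs]
      exact inv_le_one_of_one_le₀ (le_add_of_nonneg_right (abs_nonneg _)))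
    (fun n => by
      rw [norm_mul, norm_inv, norm_one_add_abs, Complex.norm_intCast, ← div_eq_mul_inv,
        Int.cast_abs, abs_abs]
      exact div_le_one_of_le₀ (le_add_of_nonneg_left zero_le_one) (by positivity))

lemma coeff_incl_lamInv (u : L2) (n : ℤ) :
    coeff (incl (lamInv u)) n = ((1 + |n| : ℤ) : ℂ)⁻¹ * coeff u n := by
  rw [lamInv, incl_multH, coeff_mult]

lemma one_add_abs_ne_zero (n : ℤ) : ((1 + |n| : ℤ) : ℂ) ≠ 0 :=
  Int.cast_ne_zero.mpr (by positivity)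

/-- The isomorphism `|D| + 1 : H¹ → L²`. -/
def lam : H1 ≃L[ℂ] L2 :=
  ContinuousLinearEquiv.equivOfInverse (absD + incl) lamInv
    (fun w => ext_coeffH fun n => by
      rw [coeff_incl_lamInv, add_apply, coeff_add, coeff_absD, ← add_one_mul,
        ← mul_assoc, show ((|n| : ℤ) : ℂ) + 1 = ((1 + |n| : ℤ) : ℂ) by push_cast; ring,
        inv_mul_cancel₀ (one_add_abs_ne_zero n), one_mul])
    (fun u => ext_coeff fun n => by
      rw [add_apply, coeff_add, coeff_absD, ← add_one_mul, coeff_incl_lamInv,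
        ← mul_assoc, show ((|n| : ℤ) : ℂ) + 1 = ((1 + |n| : ℤ) : ℂ) by push_cast; ring,
        mul_inv_cancel₀ (one_add_abs_ne_zero n), one_mul])

lemma lam_apply (w : H1) : lam w = absD w + incl w := rfl

lemma lam_symm_apply (u : L2) : lam.symm u = lamInv u := rfl

/-- The quadratic form of `|D|` is real and nonnegative. -/
lemma inner_incl_absD (u : H1) : ∃ q : ℝ, 0 ≤ q ∧ inner ℂ (incl u) (absD u) = (q : ℂ) := by
  have h := fourierBasis.hasSum_inner_mul_inner (incl u) (absD u)
  have h2 : (fun n : ℤ => inner ℂ (incl u) (fourierBasis n) * inner ℂ (fourierBasis n) (absD u))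
      = fun n : ℤ => ((((|n| : ℤ) : ℝ) * ‖coeff (incl u) n‖ ^ 2 : ℝ) : ℂ) := by
    ext n
    rw [coe_fourierBasis, ← coeff_eq_inner, ← inner_conj_symm, ← coeff_eq_inner, coeff_absD,
      mul_left_comm, Complex.conj_mul', Complex.ofReal_mul, Complex.ofReal_intCast,
      Complex.ofReal_pow]
  rw [h2] at h
  refine ⟨(inner ℂ (incl u) (absD u) : ℂ).re, ?_, ?_⟩
  · refine hasSum_le (fun n => ?_) hasSum_zero (Complex.hasSum_re h)
    rw [Complex.ofReal_re]
    positivity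
  · have h3 := Complex.hasSum_im h
    simp only [Complex.ofReal_im] at h3
    exact Complex.ext rfl (by rw [Complex.ofReal_im]; exact h3.unique hasSum_zero)

lemma integral_mul_norm_sq_nonneg {χ : C(Circ, ℝ)} (hχ : ∀ x, 0 ≤ χ x) (u : L2) :
    0 ≤ ∫ x, χ x * ‖u x‖ ^ 2 ∂AddCircle.haarAddCircle :=
  MeasureTheory.integral_nonneg fun x => mul_nonneg (hχ x) (by positivity)

/-- `P(i) = |D| + χ + 1` is bounded below by the identity. -/
lemma P_I_injective {χ : C(Circ, ℝ)} (hχ : ∀ x, 0 ≤ χ x) :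
    Function.Injective (P χ Complex.I) := by
  refine (injective_iff_map_eq_zero _).mpr fun u hu => ?_
  rw [P_apply, Complex.I_mul_I, Complex.I_sq, neg_one_smul, neg_one_smul, sub_neg_eq_add,
    sub_neg_eq_add] at hu
  have h := congrArg (inner ℂ (incl u)) hu
  obtain ⟨q, hq, hq'⟩ := inner_incl_absD u
  rw [inner_add_right, inner_add_right, hq', inner_self_mulOp, inner_zero_right,
    inner_self_eq_norm_sq_to_K] at h
  have h0 := integral_mul_norm_sq_nonneg hχ (incl u)
  set J := ∫ x, χ x * ‖(incl u : L2) x‖ ^ 2 ∂AddCircle.haarAddCircle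
  have h1 : q + J + ‖incl u‖ ^ 2 = 0 := by
    refine Complex.ofReal_injective ?_
    push_cast
    exact h
  have h2 : ‖incl u‖ ^ 2 = 0 := by nlinarith [sq_nonneg ‖incl u‖]
  exact incl_injective (by rw [map_zero]; simpa using h2)

/-- The lower order part `1 + τ² + iτχ` of `|D| + 1 - P(τ)`. -/
def pert (χ : C(Circ, ℝ)) (τ : ℂ) : L2 →L[ℂ] L2 :=
  (1 + τ ^ 2) • ContinuousLinearMap.id ℂ L2 + (Complex.I * τ) • mulOp χ

lemma P_eq_lam_sub (χ : C(Circ, ℝ)) (τ : ℂ) (w : H1) :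
    P χ τ w = lam w - pert χ τ (incl w) := by
  rw [P_apply, lam_apply, pert]
  simp only [add_apply, smul_apply, ContinuousLinearMap.id_apply, add_smul, one_smul]
  abel

lemma analyticAt_pert (χ : C(Circ, ℝ)) (τ : ℂ) : AnalyticAt ℂ (pert χ) τ := by
  unfold pert
  exact AnalyticAt.add
    (AnalyticAt.fun_smul (f := fun τ => 1 + τ ^ 2) (by fun_prop) analyticAt_const)
    (AnalyticAt.fun_smul (f := fun τ => Complex.I * τ) (by fun_prop) analyticAt_const)

lemma norm_pert_le (χ : C(Circ, ℝ)) {τ : ℂ} {r : ℝ} (h : ‖τ‖ ≤ r) :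
    ‖pert χ τ‖ ≤ 1 + r ^ 2 + r * ‖χ‖ := by
  have hr : 0 ≤ r := (norm_nonneg _).trans h
  refine (norm_add_le _ _).trans (add_le_add ?_ ?_)
  · rw [norm_smul]
    refine (mul_le_of_le_one_right (norm_nonneg _) ContinuousLinearMap.norm_id_le).trans ?_
    refine (norm_add_le _ _).trans ?_
    rw [norm_one, norm_pow]
    gcongr
  · rw [norm_smul, norm_mul, Complex.norm_I, one_mul]
    gcongr
    exact norm_mulOp_le χ

/-- The Fourier coefficients with index in a finite set. -/
def coords (s : Finset ℤ) : L2 →L[ℂ] (s → ℂ) := ContinuousLinearMap.pi fun n => coeffL n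

/-- The trigonometric polynomial with given coefficients. -/
def synth (s : Finset ℤ) : (s → ℂ) →L[ℂ] L2 :=
  ∑ n, (ContinuousLinearMap.proj (R := ℂ) (φ := fun _ : s => ℂ) n).smulRight (expL n)

lemma coeff_synth_coords (s : Finset ℤ) (u : L2) (n : ℤ) :
    coeff (synth s (coords s u)) n = if n ∈ s then coeff u n else 0 := by
  have : synth s (coords s u) = ∑ m ∈ s, coeff u m • expL m := by
    rw [← Finset.sum_coe_sort s fun m => coeff u m • expL m]
    simp [synth, coords, coeffL_apply]
  rw [this, ← coeffL_apply, map_sum]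
  simp only [map_smul, coeffL_apply, coeff_expL, smul_eq_mul, mul_ite, mul_one, mul_zero]
  rw [Finset.sum_ite_eq s n]

/-- On any disc, `P(τ)` is a product of invertible factors and of a perturbation of the identity by
an operator that factors through a finite dimensional space: the part of `(|D| + 1)⁻¹` on the
frequencies `|n| ≥ M` has norm at most `M⁻¹` and is absorbed by a Neumann series. -/
lemma exists_factorization (χ : C(Circ, ℝ)) (r : ℝ) :
    ∃ (s : Finset ℤ) (Q Qi : ℂ → L2 →L[ℂ] L2) (A : ℂ → (s → ℂ) →L[ℂ] L2) (π : L2 →L[ℂ] (s → ℂ)),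
      AnalyticOnNhd ℂ Qi (Metric.ball 0 r) ∧ AnalyticOnNhd ℂ A (Metric.ball 0 r) ∧
      (∀ τ ∈ Metric.ball 0 r, ∀ u, Q τ (Qi τ u) = u) ∧
      (∀ τ ∈ Metric.ball 0 r, ∀ u, Qi τ (Q τ u) = u) ∧
      ∀ τ ∈ Metric.ball 0 r, ∀ w, P χ τ w = Q τ (lam w - A τ (π (lam w))) := by
  rcases le_or_gt r 0 with hr | hr
  · rw [Metric.ball_eq_empty.mpr hr]
    exact ⟨∅, 0, 0, 0, 0, by simp [AnalyticOnNhd], by simp [AnalyticOnNhd], by simp, by simp,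
      by simp⟩
  set K := 1 + r ^ 2 + r * ‖χ‖ with hK
  have hK0 : 0 < K := by positivity
  obtain ⟨M, hM⟩ := exists_nat_gt K
  have hM0 : (0 : ℝ) < M := hK0.trans hM
  let s : Finset ℤ := Finset.Ioo (-(M : ℤ)) M
  have hs : ∀ n : ℤ, n ∈ s ↔ |n| < M := fun n => by rw [Finset.mem_Ioo, abs_lt]
  let Rh : L2 →L[ℂ] L2 := mult (fun n => if n ∈ s then 0 else ((1 + |n| : ℤ) : ℂ)⁻¹) (M : ℝ)⁻¹
    fun n => by
      split_ifs with h
      · simp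
      · rw [norm_inv, Complex.norm_intCast]
        refine inv_anti₀ hM0 ?_
        rw [hs, not_lt] at h
        rw [abs_of_nonneg (by positivity)]
        exact_mod_cast h.trans (le_add_of_nonneg_left zero_le_one)
  let A₀ : (s → ℂ) →L[ℂ] L2 := (incl.comp lamInv).comp (synth s)
  have hdec : ∀ u, incl (lamInv u) = Rh u + A₀ (coords s u) := by
    intro u
    refine ext_coeff fun n => ?_
    rw [coeff_add, coeff_mult, coeff_incl_lamInv]
    change _ = _ + coeff (incl (lamInv (synth s (coords s u)))) n
    rw [coeff_incl_lamInv, coeff_synth_coords]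
    split_ifs <;> simp
  let Q : ℂ → L2 →L[ℂ] L2 := fun τ => 1 - (pert χ τ).comp Rh
  have hQa : ∀ τ, AnalyticAt ℂ Q τ := fun τ =>
    analyticAt_const.sub (analyticAt_clm_comp (analyticAt_pert χ τ) analyticAt_const)
  have hQu : ∀ τ ∈ Metric.ball (0 : ℂ) r, IsUnit (Q τ) := by
    intro τ hτ
    rw [mem_ball_zero_iff] at hτ
    refine isUnit_one_sub_of_norm_lt_one ?_
    calc ‖(pert χ τ).comp Rh‖ ≤ ‖pert χ τ‖ * ‖Rh‖ := ContinuousLinearMap.opNorm_comp_le _ _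
      _ ≤ K * (M : ℝ)⁻¹ := by
        gcongr
        · exact norm_pert_le χ hτ.le
        · exact norm_mult_le _ _ _
      _ < 1 := by rwa [← div_eq_mul_inv, div_lt_one hM0]
  have hQi : ∀ τ ∈ Metric.ball (0 : ℂ) r, AnalyticAt ℂ (fun τ => Ring.inverse (Q τ)) τ := by
    intro τ hτ
    obtain ⟨x, hx⟩ := hQu τ hτ
    refine AnalyticAt.comp (g := Ring.inverse) ?_ (hQa τ)
    rw [← hx]
    exact analyticAt_inverse x
  have h1 : ∀ τ ∈ Metric.ball (0 : ℂ) r, ∀ u, Q τ (Ring.inverse (Q τ) u) = u := fun τ hτ u =>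
    DFunLike.congr_fun (Ring.mul_inverse_cancel _ (hQu τ hτ)) u
  refine ⟨s, Q, fun τ => Ring.inverse (Q τ), fun τ => (Ring.inverse (Q τ)).comp
    ((pert χ τ).comp A₀), coords s, hQi, fun τ hτ => ?_, h1, ?_, ?_⟩
  · exact analyticAt_clm_comp (hQi τ hτ) (analyticAt_clm_comp (analyticAt_pert χ τ)
      analyticAt_const)
  · exact fun τ hτ u => DFunLike.congr_fun (Ring.inverse_mul_cancel _ (hQu τ hτ)) u
  · intro τ hτ w
    rw [map_sub, ContinuousLinearMap.comp_apply, h1 τ hτ, P_eq_lam_sub]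
    have h2 : incl w = Rh (lam w) + A₀ (coords s (lam w)) := by
      rw [← hdec, ← lam_symm_apply, ContinuousLinearEquiv.symm_apply_apply]
    rw [h2, map_add]
    change _ = lam w - pert χ τ (Rh (lam w)) - pert χ τ _
    abel

/-- The resolvent is a meromorphic family of operators with poles of finite rank, and `P(τ)` is
invertible as soon as it is injective. -/
theorem fredholm {χ : C(Circ, ℝ)} (hχ : ∀ x, 0 ≤ χ x) (τ₀ : ℂ) :
    (∀ᶠ τ in 𝓝[≠] τ₀, (P χ τ).IsInvertible) ∧ FiniteRankMeromorphicAt (resolvent χ) τ₀ ∧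
      (Function.Injective (P χ τ₀) → (P χ τ₀).IsInvertible) := by
  obtain ⟨s, Q, Qi, A, π, hQi, hA, hQ1, hQ2, hP⟩ := exists_factorization χ (‖τ₀‖ + 2)
  set U := Metric.ball (0 : ℂ) (‖τ₀‖ + 2)
  have h₀ : τ₀ ∈ U := by rw [mem_ball_zero_iff]; linarith
  have hI : Complex.I ∈ U := by
    rw [mem_ball_zero_iff, Complex.norm_I]; linarith [norm_nonneg τ₀]
  let D : ℂ → (s → ℂ) →L[ℂ] (s → ℂ) := fun τ => .id ℂ _ - π.comp (A τ)
  have hD : AnalyticOnNhd ℂ D U := fun τ hτ =>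
    analyticAt_const.sub (analyticAt_clm_comp analyticAt_const (hA τ hτ))
  have hinj : ∀ τ ∈ U, Function.Injective (P χ τ) → Function.Injective (D τ) := by
    intro τ hτ h
    refine (injective_iff_map_eq_zero _).mpr fun c hc => ?_
    have hc' : π (A τ c) = c := (sub_eq_zero.mp hc).symm
    have h2 : P χ τ (lam.symm (A τ c)) = 0 := by
      rw [hP τ hτ, ContinuousLinearEquiv.apply_symm_apply, hc', sub_self, map_zero]
    have h3 := (injective_iff_map_eq_zero _).mp h _ h2
    rw [map_eq_zero_iff _ lam.symm.injective] at h3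
    rw [← hc', h3, map_zero]
  -- a formula for the inverse in terms of the inverse of the finite dimensional block
  have hinv : ∀ τ ∈ U, ∀ Y : (s → ℂ) →L[ℂ] (s → ℂ), (D τ).comp Y = .id ℂ _ →
      Y.comp (D τ) = .id ℂ _ → (P χ τ).IsInvertible ∧ resolvent χ τ =
        (lam.symm : L2 →L[ℂ] H1).comp (Qi τ) +
          ((lam.symm : L2 →L[ℂ] H1).comp (A τ)).comp (Y.comp (π.comp (Qi τ))) := by
    intro τ hτ Y hY1 hY2
    have e1 : ∀ c, Y c - π (A τ (Y c)) = c := fun c => DFunLike.congr_fun hY1 c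
    have e2 : ∀ c, Y (c - π (A τ c)) = c := fun c => DFunLike.congr_fun hY2 c
    have k1 : (P χ τ).comp ((lam.symm : L2 →L[ℂ] H1).comp (Qi τ) +
          ((lam.symm : L2 →L[ℂ] H1).comp (A τ)).comp (Y.comp (π.comp (Qi τ)))) = .id ℂ _ := by
      ext1 u
      simp only [ContinuousLinearMap.comp_apply, add_apply, ContinuousLinearEquiv.coe_coe,
        ContinuousLinearMap.id_apply]
      rw [hP τ hτ, map_add, ContinuousLinearEquiv.apply_symm_apply,
        ContinuousLinearEquiv.apply_symm_apply]
      have e3 := e1 (π (Qi τ u))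
      rw [sub_eq_iff_eq_add] at e3
      rw [map_add, ← e3, add_sub_cancel_right, hQ1 τ hτ]
    have k2 : ((lam.symm : L2 →L[ℂ] H1).comp (Qi τ) +
          ((lam.symm : L2 →L[ℂ] H1).comp (A τ)).comp (Y.comp (π.comp (Qi τ)))).comp (P χ τ)
          = .id ℂ _ := by
      ext1 w
      simp only [ContinuousLinearMap.comp_apply, add_apply, ContinuousLinearEquiv.coe_coe,
        ContinuousLinearMap.id_apply]
      rw [hP τ hτ, hQ2 τ hτ, map_sub π, e2, ← map_add, sub_add_cancel,
        ContinuousLinearEquiv.symm_apply_apply]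
    exact ⟨.of_inverse k1 k2, ContinuousLinearMap.inverse_eq k1 k2⟩
  obtain ⟨J, Y, hY, hYinv⟩ := exists_inverse_of_finite (Metric.isPreconnected_ball) hD hI
    (hinj _ hI (P_I_injective hχ)) h₀
  have hU : ∀ᶠ τ in 𝓝[≠] τ₀, τ ∈ U := nhdsWithin_le_nhds (Metric.isOpen_ball.mem_nhds h₀)
  refine ⟨?_, ?_, ?_⟩
  · filter_upwards [hU, hYinv] with τ h1 h2
    exact (hinv τ h1 _ h2.1 h2.2).1
  · refine ((FiniteRankMeromorphicAt.of_analyticAt (analyticAt_clm_comp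
      (analyticAt_const (v := (lam.symm : L2 →L[ℂ] H1))) (hQi τ₀ h₀))).add
      (FiniteRankMeromorphicAt.of_factorization J
      (analyticAt_clm_comp (analyticAt_const (v := (lam.symm : L2 →L[ℂ] H1))) (hA τ₀ h₀))
      (analyticAt_clm_comp hY
        (analyticAt_clm_comp (analyticAt_const (v := π)) (hQi τ₀ h₀))))).congr ?_
    · filter_upwards [hU, hYinv] with τ h1 h2
      rw [(hinv τ h1 _ h2.1 h2.2).2, ContinuousLinearMap.smul_comp,
        ContinuousLinearMap.comp_smul]
  · intro h
    have h2 := hinj τ₀ h₀ h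
    let e : (s → ℂ) ≃L[ℂ] (s → ℂ) :=
      (LinearEquiv.ofInjectiveEndo (D τ₀ : (s → ℂ) →ₗ[ℂ] (s → ℂ)) h2).toContinuousLinearEquiv
    have he : ∀ c, e c = D τ₀ c := fun c => rfl
    refine (hinv τ₀ h₀ e.symm ?_ ?_).1
    · ext1 c
      exact (he _).symm.trans (e.apply_symm_apply c)
    · ext1 c
      exact (congrArg e.symm (he c).symm).trans (e.symm_apply_apply c)

/-- The resonances are the points where `P(τ)` has a kernel. -/
theorem mem_resonances_iff {χ : C(Circ, ℝ)} (hχ : ∀ x, 0 ≤ χ x) (τ₀ : ℂ) :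
    τ₀ ∈ resonances χ ↔ ∃ u : H1, u ≠ 0 ∧ P χ τ₀ u = 0 := by
  obtain ⟨hev, hmer, hinj⟩ := fredholm hχ τ₀
  have hPc : ContinuousAt (P χ) τ₀ := by
    unfold P
    fun_prop
  constructor
  · intro h
    by_contra! hcon
    have hi : (P χ τ₀).IsInvertible := hinj ((injective_iff_map_eq_zero _).mpr fun u hu => by
      by_contra hne
      exact hcon u hne hu)
    obtain ⟨e, he⟩ := hi
    have hc : ContinuousAt (resolvent χ) τ₀ := by
      have h2 : ContinuousAt ContinuousLinearMap.inverse (P χ τ₀) := by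
        rw [← he]
        exact (contDiffAt_map_inverse (𝕜 := ℂ) (n := 0) e).continuousAt
      exact ContinuousAt.comp (f := P χ) h2 hPc
    refine not_lt.mpr ?_ (show meromorphicOrderAt (resolvent χ) τ₀ < 0 from h)
    exact (tendsto_nhds_iff_meromorphicOrderAt_nonneg hmer.meromorphicAt).mp
      ⟨_, hc.tendsto.mono_left nhdsWithin_le_nhds⟩
  · rintro ⟨u, hu, hPu⟩
    by_contra h
    obtain ⟨B, hB⟩ := (tendsto_nhds_iff_meromorphicOrderAt_nonneg hmer.meromorphicAt).mpr
      (not_lt.mp h)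
    have h1 : Filter.Tendsto (fun τ => resolvent χ τ (P χ τ u)) (𝓝[≠] τ₀) (𝓝 (B (P χ τ₀ u))) :=
      (isBoundedBilinearMap_apply.continuous.tendsto (B, P χ τ₀ u)).comp (hB.prodMk_nhds
        ((isBoundedBilinearMap_apply.continuous.tendsto (P χ τ₀, u)).comp
          ((hPc.tendsto.mono_left nhdsWithin_le_nhds).prodMk_nhds tendsto_const_nhds)))
    have h2 : Filter.Tendsto (fun τ => resolvent χ τ (P χ τ u)) (𝓝[≠] τ₀) (𝓝 u) := by
      refine tendsto_const_nhds.congr' ?_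
      filter_upwards [hev] with τ hτ
      exact (hτ.inverse_apply_self u).symm
    have h3 := tendsto_nhds_unique h1 h2
    rw [hPu, map_zero] at h3
    exact hu h3.symm

/-! ### The Jackson kernel -/

lemma integral_fourier (n : ℤ) : ∫ x : Circ, fourier n x ∂μ₀ = if n = 0 then 1 else 0 := by
  have h := congrFun (fourierCoeff_fourier (T := 2 * Real.pi) n) 0
  rw [fourierCoeff] at h
  simp only [neg_zero, fourier_zero, one_smul] at h
  rw [h, Pi.single_apply]
  simp only [eq_comm]

lemma integrable_of_continuous {E : Type*} [NormedAddCommGroup E] {f : Circ → E}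
    (hf : Continuous f) : Integrable f μ₀ :=
  hf.integrable_of_hasCompactSupport (HasCompactSupport.of_compactSpace f)

/-- The Dirichlet kernel `∑_{0 ≤ j < m} e^{ijx}`. -/
def dirichlet (m : ℕ) (x : Circ) : ℂ := ∑ j ∈ Finset.range m, fourier (j : ℤ) x

@[fun_prop]
lemma continuous_dirichlet (m : ℕ) : Continuous (dirichlet m) := by
  unfold dirichlet
  fun_prop

lemma norm_sq_dirichlet (m : ℕ) (x : Circ) : ((‖dirichlet m x‖ ^ 2 : ℝ) : ℂ)
    = ∑ t ∈ Finset.range m ×ˢ Finset.range m, fourier ((t.1 : ℤ) - t.2) x := by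
  rw [Complex.ofReal_pow, ← Complex.mul_conj', dirichlet, map_sum, Finset.sum_mul_sum,
    Finset.sum_product]
  refine Finset.sum_congr rfl fun i _ => Finset.sum_congr rfl fun j _ => ?_
  rw [sub_eq_add_neg, fourier_add, fourier_neg]

/-- The index set of the expansion of the fourth power of the absolute value of the Dirichlet
kernel into exponentials. -/
def freqPairs (m : ℕ) : Finset ((ℕ × ℕ) × (ℕ × ℕ)) :=
  (Finset.range m ×ˢ Finset.range m) ×ˢ (Finset.range m ×ˢ Finset.range m)

/-- The frequency of the term with index `t` in the expansion of `norm_pow_four_dirichlet`. -/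
def freq (t : (ℕ × ℕ) × (ℕ × ℕ)) : ℤ := ((t.1.1 : ℤ) - t.1.2) + ((t.2.1 : ℤ) - t.2.2)

lemma norm_pow_four_dirichlet (m : ℕ) (x : Circ) :
    ((‖dirichlet m x‖ ^ 4 : ℝ) : ℂ) = ∑ t ∈ freqPairs m, fourier (freq t) x := by
  rw [show ‖dirichlet m x‖ ^ 4 = ‖dirichlet m x‖ ^ 2 * ‖dirichlet m x‖ ^ 2 by ring,
    Complex.ofReal_mul, norm_sq_dirichlet, Finset.sum_mul_sum, ← Finset.sum_product']
  refine Finset.sum_congr rfl fun t _ => ?_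
  rw [freq, fourier_add]

lemma abs_freq_lt {m : ℕ} {t} (ht : t ∈ freqPairs m) : |freq t| < 2 * m := by
  simp only [freqPairs, Finset.mem_product, Finset.mem_range] at ht
  rw [freq, abs_lt]
  omega

lemma integral_norm_sq_dirichlet (m : ℕ) : ∫ x, ‖dirichlet m x‖ ^ 2 ∂μ₀ = m := by
  refine Complex.ofReal_injective ?_
  rw [← integral_complex_ofReal]
  simp_rw [norm_sq_dirichlet]
  rw [integral_finsetSum _ fun t _ => integrable_of_continuous (by fun_prop)]
  simp_rw [integral_fourier, Finset.sum_product, sub_eq_zero, Nat.cast_inj, Finset.sum_ite_eq]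
  rw [Finset.sum_ite_mem]
  simp

/-- The total mass of the Jackson kernel `|B|⁴`, where `B` is the Dirichlet kernel. -/
def mass (m : ℕ) : ℝ := ∫ x, ‖dirichlet m x‖ ^ 4 ∂μ₀

/-- By the Cauchy-Schwarz inequality against `∑_{k < 2m} e_k`, the mass is at least `m³ / 2`. -/
lemma le_mass (m : ℕ) : (m : ℝ) ^ 3 / 2 ≤ mass m := by
  have hre : ∫ x, (dirichlet m x ^ 2 * (starRingEnd ℂ) (dirichlet (2 * m) x)).re ∂μ₀
      = (m : ℝ) ^ 2 := by
    have h1 : ∀ x, dirichlet m x ^ 2 * (starRingEnd ℂ) (dirichlet (2 * m) x)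
        = ∑ t ∈ Finset.range m ×ˢ Finset.range m, ∑ k ∈ Finset.range (2 * m),
          fourier (((t.1 : ℤ) + t.2) - k) x := by
      intro x
      rw [sq, dirichlet, dirichlet, map_sum, Finset.sum_mul_sum, ← Finset.sum_product',
        Finset.sum_mul_sum]
      refine Finset.sum_congr rfl fun i _ => Finset.sum_congr rfl fun j _ => ?_
      rw [sub_eq_add_neg, fourier_add, fourier_add, fourier_neg]
    have h2 : ∫ x, dirichlet m x ^ 2 * (starRingEnd ℂ) (dirichlet (2 * m) x) ∂μ₀
        = ((m : ℝ) ^ 2 : ℝ) := by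
      simp_rw [h1]
      rw [integral_finsetSum _ fun t _ => integrable_of_continuous (by fun_prop)]
      have h3 : ∀ t ∈ Finset.range m ×ˢ Finset.range m,
          ∫ x, ∑ k ∈ Finset.range (2 * m), fourier (((t.1 : ℤ) + t.2) - k) x ∂μ₀ = 1 := by
        intro t ht
        rw [integral_finsetSum _ fun t _ => integrable_of_continuous (by fun_prop)]
        simp only [Finset.mem_product, Finset.mem_range] at ht
        rw [Finset.sum_eq_single_of_mem (t.1 + t.2) (Finset.mem_range.mpr (by omega))]
        · rw [integral_fourier, if_pos (by push_cast; ring)]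
        · intro k _ hk
          rw [integral_fourier, if_neg]
          omega
      rw [Finset.sum_congr rfl h3]
      simp [sq]
    have h3 := integral_re (𝕜 := ℂ) (μ := μ₀)
      (f := fun x => dirichlet m x ^ 2 * (starRingEnd ℂ) (dirichlet (2 * m) x))
      (integrable_of_continuous (by fun_prop))
    rw [h2] at h3
    exact h3.trans (Complex.ofReal_re _)
  -- the factor `m / 2` makes the resulting lower bound optimal
  have h4 : 0 ≤ ∫ x, ‖dirichlet m x ^ 2 - ((m / 2 : ℝ) : ℂ) * dirichlet (2 * m) x‖ ^ 2 ∂μ₀ :=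
    integral_nonneg fun x => by positivity
  have h5 : ∀ x, ‖dirichlet m x ^ 2 - ((m / 2 : ℝ) : ℂ) * dirichlet (2 * m) x‖ ^ 2
      = ‖dirichlet m x‖ ^ 4
        - m * (dirichlet m x ^ 2 * (starRingEnd ℂ) (dirichlet (2 * m) x)).re
        + (m / 2) ^ 2 * ‖dirichlet (2 * m) x‖ ^ 2 := by
    intro x
    rw [← Complex.normSq_eq_norm_sq, Complex.normSq_sub, Complex.normSq_mul, Complex.normSq_ofReal,
      map_pow, Complex.normSq_eq_norm_sq, Complex.normSq_eq_norm_sq, map_mul, Complex.conj_ofReal,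
      mul_left_comm, Complex.re_ofReal_mul]
    ring
  simp_rw [h5] at h4
  rw [integral_add (integrable_of_continuous (by fun_prop))
      (integrable_of_continuous (by fun_prop)),
    integral_sub (integrable_of_continuous (by fun_prop)) (integrable_of_continuous (by fun_prop)),
    integral_const_mul, integral_const_mul, hre, integral_norm_sq_dirichlet] at h4
  push_cast at h4
  change 0 ≤ mass m - _ + _ at h4
  linarith

lemma norm_fourier_one_sub_one_mul (m : ℕ) (x : Circ) :
    ‖fourier 1 x - 1‖ ^ 2 * ‖dirichlet m x‖ ^ 2 ≤ 4 := by
  have h : (fourier 1 x - 1) * dirichlet m x = fourier m x - 1 := by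
    have h1 : ∀ j : ℕ, fourier (j : ℤ) x = fourier 1 x ^ j := by
      intro j
      induction j with
      | zero => simp
      | succ j ih => rw [Nat.cast_succ, fourier_add, ih, pow_succ]
    rw [dirichlet, h1 m, mul_comm, ← geom_sum_mul]
    simp_rw [h1]
  rw [← mul_pow, ← norm_mul, h]
  have h2 : ‖fourier (m : ℤ) x - 1‖ ≤ 2 := by
    refine (norm_sub_le _ _).trans ?_
    rw [norm_one, fourier_apply, Circle.norm_coe]
    norm_num
  nlinarith [norm_nonneg (fourier (m : ℤ) x - 1)]

/-- The distance of `x` to `0` on the circle is bounded by that of `e^{ix}` to `1`. -/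
lemma norm_le_norm_fourier_one_sub_one (x : Circ) :
    ‖x‖ ≤ Real.pi / 2 * ‖fourier 1 x - 1‖ := by
  have hpi := Real.pi_pos
  obtain ⟨y, rfl, hy⟩ : ∃ y : ℝ, (y : Circ) = x ∧ |y| ≤ Real.pi := by
    have hp := Real.two_pi_pos
    refine ⟨toIocMod hp (-Real.pi) (Quotient.out x), ?_, ?_⟩
    · have : ((toIocMod hp (-Real.pi) (Quotient.out x) : ℝ) : Circ) = (Quotient.out x : ℝ) := by
        rw [toIocMod, AddCircle.coe_sub, AddCircle.coe_zsmul, AddCircle.coe_period, smul_zero,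
          sub_zero]
      rw [this]
      exact Quotient.out_eq x
    · have h := toIocMod_mem_Ioc hp (-Real.pi) (Quotient.out x)
      rw [abs_le]
      exact ⟨h.1.le, by linarith [h.2]⟩
  have h1 : ‖(y : Circ)‖ ≤ |y| := by
    rw [AddCircle.norm_eq]
    have := round_le ((2 * Real.pi)⁻¹ * y) 0
    have h2 : |y - round ((2 * Real.pi)⁻¹ * y) * (2 * Real.pi)|
        = 2 * Real.pi * |(2 * Real.pi)⁻¹ * y - round ((2 * Real.pi)⁻¹ * y)| := by
      rw [← abs_of_pos Real.two_pi_pos, ← abs_mul, abs_of_pos Real.two_pi_pos]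
      congr 1
      field_simp
    rw [h2]
    refine (mul_le_mul_of_nonneg_left this Real.two_pi_pos.le).trans_eq ?_
    rw [Int.cast_zero, sub_zero, abs_mul, abs_of_pos (by positivity : 0 < (2 * Real.pi)⁻¹)]
    field_simp
  have h2 : (fourier 1 (y : Circ) : ℂ) = Complex.exp (Complex.I * y) := by
    rw [fourier_coe_apply]
    congr 1
    have : (Real.pi : ℂ) ≠ 0 := by exact_mod_cast hpi.ne'
    push_cast
    field_simp
  rw [h2, Complex.norm_exp_I_mul_ofReal_sub_one]
  refine h1.trans ?_
  have h3 := Real.mul_abs_le_abs_sin (x := y / 2) (by rw [abs_div, abs_two]; linarith)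
  rw [abs_div, abs_two] at h3
  rw [Real.norm_eq_abs, abs_mul, abs_two]
  calc |y| = Real.pi / 2 * (2 * (2 / Real.pi * (|y| / 2))) := by field_simp
    _ ≤ _ := by gcongr

/-! ### Approximation of Hölder continuous functions, and frequency gaps -/

lemma mass_pos {m : ℕ} (hm : 0 < m) : 0 < mass m :=
  lt_of_lt_of_le (by positivity) (le_mass m)

/-- The convolution of `χ` with the normalized Jackson kernel, defined through its expansion into
exponentials. -/
def jackson (χ : C(Circ, ℝ)) (m : ℕ) : C(Circ, ℝ) where
  toFun x := ((mass m : ℂ)⁻¹ *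
    ∑ t ∈ freqPairs m, coeff (fun y => (χ y : ℂ)) (freq t) * fourier (freq t) x).re
  continuous_toFun := by fun_prop

lemma integral_mul_kernel (χ : C(Circ, ℝ)) (m : ℕ) (x : Circ) :
    ((∫ y, χ y * ‖dirichlet m (x - y)‖ ^ 4 ∂μ₀ : ℝ) : ℂ)
      = ∑ t ∈ freqPairs m, coeff (fun y => (χ y : ℂ)) (freq t) * fourier (freq t) x := by
  rw [← integral_complex_ofReal]
  simp_rw [Complex.ofReal_mul, norm_pow_four_dirichlet, Finset.mul_sum]
  rw [integral_finsetSum _ fun t _ => integrable_of_continuous (by fun_prop)]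
  refine Finset.sum_congr rfl fun t _ => ?_
  rw [coeff, fourierCoeff, ← integral_mul_const]
  refine integral_congr_ae (Filter.Eventually.of_forall fun y => ?_)
  have h : (fourier (freq t) (x - y) : ℂ) = fourier (-freq t) y * fourier (freq t) x := by
    rw [fourier_apply, fourier_apply, fourier_apply, smul_sub, neg_smul, sub_eq_add_neg,
      AddCircle.toCircle_add, Circle.coe_mul, mul_comm]
  dsimp only
  rw [h, smul_eq_mul]
  ring

lemma jackson_apply (χ : C(Circ, ℝ)) (m : ℕ) (x : Circ) :
    jackson χ m x = (mass m)⁻¹ * ∫ y, χ y * ‖dirichlet m (x - y)‖ ^ 4 ∂μ₀ := by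
  refine Complex.ofReal_injective ?_
  change (((_ : ℂ).re : ℝ) : ℂ) = _
  rw [← integral_mul_kernel, ← Complex.ofReal_inv, ← Complex.ofReal_mul, Complex.ofReal_re]

lemma ofReal_jackson (χ : C(Circ, ℝ)) (m : ℕ) (x : Circ) : (jackson χ m x : ℂ)
    = (mass m : ℂ)⁻¹ *
      ∑ t ∈ freqPairs m, coeff (fun y => (χ y : ℂ)) (freq t) * fourier (freq t) x := by
  rw [jackson_apply, ← integral_mul_kernel]
  push_cast
  rfl

lemma coeff_jackson (χ : C(Circ, ℝ)) (m : ℕ) {k : ℤ} (hk : 2 * m ≤ |k|) :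
    coeff (fun x => (jackson χ m x : ℂ)) k = 0 := by
  simp_rw [coeff, fourierCoeff, ofReal_jackson, smul_eq_mul, Finset.mul_sum]
  rw [integral_finsetSum _ fun t _ => integrable_of_continuous (by fun_prop)]
  refine Finset.sum_eq_zero fun t ht => ?_
  have h : ∀ x : Circ, fourier (-k) x * ((mass m : ℂ)⁻¹ *
      (coeff (fun y => (χ y : ℂ)) (freq t) * fourier (freq t) x))
      = ((mass m : ℂ)⁻¹ * coeff (fun y => (χ y : ℂ)) (freq t)) * fourier (-k + freq t) x := by
    intro x
    rw [fourier_add]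
    ring
  simp_rw [h]
  rw [integral_const_mul, integral_fourier, if_neg, mul_zero]
  intro h0
  have := abs_freq_lt ht
  rw [show freq t = k by omega] at this
  omega

/-- The moment of order `β` of the Jackson kernel. It is controlled by the moments of order `0` and
`2`, and for the latter `|x|² |B(x)|⁴ ≤ π² |B(x)|²`, where `B` is the Dirichlet kernel. -/
lemma integral_holder_kernel_le {m : ℕ} (hm : 0 < m) {β : ℝ} (hβ0 : 0 < β) (hβ1 : β ≤ 1) :
    ∫ h : Circ, ‖h‖ ^ β * ‖dirichlet m h‖ ^ 4 ∂μ₀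
      ≤ (m : ℝ) ^ (-β) * ((1 + 2 * Real.pi ^ 2) * mass m) := by
  have hm' : (0 : ℝ) < m := by exact_mod_cast hm
  have hcont : Continuous fun h : Circ => ‖h‖ ^ β * ‖dirichlet m h‖ ^ 4 :=
    (continuous_norm.rpow_const fun _ => Or.inr hβ0.le).mul (by fun_prop)
  have hpt : ∀ h : Circ, ‖h‖ ^ β * ‖dirichlet m h‖ ^ 4 ≤ (m : ℝ) ^ (-β) *
      (‖dirichlet m h‖ ^ 4 + m ^ 2 * Real.pi ^ 2 * ‖dirichlet m h‖ ^ 2) := by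
    intro h
    have e1 : ‖h‖ ^ β ≤ (m : ℝ) ^ (-β) * (1 + (m * ‖h‖) ^ 2) := by
      have e2 : ‖h‖ ^ β = (m : ℝ) ^ (-β) * (m * ‖h‖) ^ β := by
        rw [Real.mul_rpow hm'.le (norm_nonneg _), ← mul_assoc, ← Real.rpow_add hm', neg_add_cancel,
          Real.rpow_zero, one_mul]
      rw [e2]
      refine mul_le_mul_of_nonneg_left ?_ (by positivity)
      have h0 : 0 ≤ m * ‖h‖ := by positivity
      rcases le_total (m * ‖h‖) 1 with h1 | h1
      · exact (Real.rpow_le_one h0 h1 hβ0.le).trans (le_add_of_nonneg_right (sq_nonneg _))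
      · calc (m * ‖h‖) ^ β ≤ (m * ‖h‖) ^ (1 : ℝ) := Real.rpow_le_rpow_of_exponent_le h1 hβ1
          _ ≤ _ := by rw [Real.rpow_one]; nlinarith
    have e3 : ‖h‖ ^ 2 * ‖dirichlet m h‖ ^ 4 ≤ Real.pi ^ 2 * ‖dirichlet m h‖ ^ 2 := by
      calc ‖h‖ ^ 2 * ‖dirichlet m h‖ ^ 4
          ≤ (Real.pi / 2 * ‖fourier 1 h - 1‖) ^ 2 * ‖dirichlet m h‖ ^ 4 := by
            gcongr
            exact norm_le_norm_fourier_one_sub_one h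
        _ = Real.pi ^ 2 / 4 * (‖fourier 1 h - 1‖ ^ 2 * ‖dirichlet m h‖ ^ 2)
            * ‖dirichlet m h‖ ^ 2 := by ring
        _ ≤ Real.pi ^ 2 / 4 * 4 * ‖dirichlet m h‖ ^ 2 := by
            gcongr
            exact norm_fourier_one_sub_one_mul m h
        _ = _ := by ring
    calc ‖h‖ ^ β * ‖dirichlet m h‖ ^ 4
        ≤ (m : ℝ) ^ (-β) * (1 + (m * ‖h‖) ^ 2) * ‖dirichlet m h‖ ^ 4 := by gcongr
      _ = (m : ℝ) ^ (-β) *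
          (‖dirichlet m h‖ ^ 4 + m ^ 2 * (‖h‖ ^ 2 * ‖dirichlet m h‖ ^ 4)) := by ring
      _ ≤ _ := by
        rw [mul_assoc ((m : ℝ) ^ 2)]
        gcongr
  calc ∫ h : Circ, ‖h‖ ^ β * ‖dirichlet m h‖ ^ 4 ∂μ₀
      ≤ ∫ h : Circ, (m : ℝ) ^ (-β) *
      (‖dirichlet m h‖ ^ 4 + m ^ 2 * Real.pi ^ 2 * ‖dirichlet m h‖ ^ 2) ∂μ₀ :=
        integral_mono (integrable_of_continuous hcont)
          (integrable_of_continuous (by fun_prop)) hpt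
    _ = (m : ℝ) ^ (-β) * (mass m + m ^ 2 * Real.pi ^ 2 * m) := by
        rw [integral_const_mul, integral_add (integrable_of_continuous (by fun_prop))
          (integrable_of_continuous (by fun_prop)), integral_const_mul,
          integral_norm_sq_dirichlet, mass]
    _ ≤ _ := by
        gcongr
        have := le_mass m
        nlinarith [sq_nonneg Real.pi]

/-- Jackson's theorem for Hölder continuous functions. -/
lemma exists_norm_sub_jackson_le {β : ℝ≥0} (hβ0 : 0 < β) (hβ1 : β ≤ 1) {χ : C(Circ, ℝ)}
    (hχ : MemHolder β χ) :
    ∃ K : ℝ, 0 ≤ K ∧ ∀ m : ℕ, 0 < m → ‖χ - jackson χ m‖ ≤ K * (m : ℝ) ^ (-(β : ℝ)) := by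
  obtain ⟨H, hH⟩ := hχ
  refine ⟨H * (1 + 2 * Real.pi ^ 2), by positivity, fun m hm => ?_⟩
  rw [ContinuousMap.norm_le _ (by positivity)]
  intro x
  have hM := mass_pos hm
  have h1 : ∀ f : Circ → ℝ, ∫ y, f (x - y) ∂μ₀ = ∫ y, f y ∂μ₀ := fun f =>
    integral_sub_left_eq_self f μ₀ x
  have h2 : χ x = (mass m)⁻¹ * ∫ y, χ x * ‖dirichlet m (x - y)‖ ^ 4 ∂μ₀ := by
    rw [integral_const_mul, h1 fun y => ‖dirichlet m y‖ ^ 4]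
    change _ = _ * (_ * mass m)
    field_simp
  rw [ContinuousMap.sub_apply, jackson_apply]
  nth_rewrite 1 [h2]
  rw [← mul_sub, ← integral_sub (integrable_of_continuous (by fun_prop))
    (integrable_of_continuous (by fun_prop)), norm_mul, norm_inv, Real.norm_of_nonneg hM.le]
  have hβ' : (0 : ℝ) < β := hβ0
  have h3 : ‖∫ y, χ x * ‖dirichlet m (x - y)‖ ^ 4 - χ y * ‖dirichlet m (x - y)‖ ^ 4 ∂μ₀‖
      ≤ ∫ y, H * (‖x - y‖ ^ (β : ℝ) * ‖dirichlet m (x - y)‖ ^ 4) ∂μ₀ := by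
    refine norm_integral_le_of_norm_le ?_ (Filter.Eventually.of_forall fun y => ?_)
    · refine integrable_of_continuous (continuous_const.mul (Continuous.mul ?_ (by fun_prop)))
      exact Continuous.rpow_const (by fun_prop) fun _ => Or.inr hβ'.le
    · rw [← sub_mul, norm_mul, ← mul_assoc, Real.norm_of_nonneg (by positivity : 0 ≤
        ‖dirichlet m (x - y)‖ ^ 4)]
      gcongr
      have := hH.dist_le x y
      rwa [dist_eq_norm, dist_eq_norm] at this
  rw [integral_const_mul, h1 fun y => ‖y‖ ^ (β : ℝ) * ‖dirichlet m y‖ ^ 4] at h3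
  calc _ ≤ (mass m)⁻¹ * (H * ((m : ℝ) ^ (-(β : ℝ)) * ((1 + 2 * Real.pi ^ 2) * mass m))) := by
        gcongr
        exact h3.trans (mul_le_mul_of_nonneg_left
          (integral_holder_kernel_le hm hβ' (by exact_mod_cast hβ1)) H.2)
    _ = _ := by field_simp

/-- Multiplication by a Hölder continuous function is almost diagonal in frequency: transitions
over a frequency gap of size `2 m` have norm `O(m^{-β})`. -/
lemma exists_norm_proj_mulOp_le {β : ℝ≥0} (hβ0 : 0 < β) (hβ1 : β ≤ 1) {χ : C(Circ, ℝ)}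
    (hχ : MemHolder β χ) :
    ∃ K : ℝ, 0 ≤ K ∧ ∀ m : ℕ, 0 < m → ∀ (S : Set ℤ) (w : L2),
      (∀ n ∈ S, ∀ j, coeff w j ≠ 0 → 2 * (m : ℤ) ≤ |n - j|) →
      ‖proj S (mulOp χ w)‖ ≤ K * (m : ℝ) ^ (-(β : ℝ)) * ‖w‖ := by
  classical
  obtain ⟨K, hK, h⟩ := exists_norm_sub_jackson_le hβ0 hβ1 hχ
  refine ⟨K, hK, fun m hm S w hw => ?_⟩
  have h0 : proj S (mulOp (jackson χ m) w) = 0 := by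
    refine ext_coeff fun n => ?_
    rw [coeff_proj, coeff_zero]
    split_ifs with hn
    · refine (hasSum_coeff_mulOp _ w n).unique ?_
      convert hasSum_zero (α := ℂ) (β := ℤ) using 2 with j
      by_cases hj : coeff w j = 0
      · rw [hj, mul_zero]
      · rw [coeff_jackson χ m (hw n hn j hj), zero_mul]
    · rfl
  have h1 : mulOp χ w = mulOp (χ - jackson χ m) w + mulOp (jackson χ m) w := by
    rw [mulOp_sub, sub_apply, sub_add_cancel]
  rw [h1, map_add, h0, add_zero]
  exact (norm_proj_le _ _).trans ((norm_mulOp_apply_le _ _).trans (by gcongr; exact h m hm))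

/-! ### An a priori estimate on functions with frequencies of one sign -/

/-- A periodic solution of `W' = c W + f`, where the growth of the homogeneous equation is at most
`e^K` over any part of a period and at most `e^{-1}` over a full period. -/
lemma norm_le_of_ode {T K : ℝ} (hT : 0 < T) {W W' c : ℝ → ℂ} {q : ℝ → ℝ}
    (hW : ∀ x, HasDerivAt W (W' x) x) (hW' : Continuous W') (hc : Continuous c)
    (hcq : ∀ x, (c x).re = -q x) (hper : W.Periodic T) (hqper : q.Periodic T)
    (hK : ∀ x y, y ≤ x → x ≤ y + T → -K ≤ ∫ t in y..x, q t) (h1 : 1 ≤ ∫ t in (0 : ℝ)..T, q t)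
    (x : ℝ) : ‖W x‖ ≤ 2 * Real.exp K * ∫ t in (x - T)..x, ‖W' t - c t * W t‖ := by
  have hWc : Continuous W := continuous_iff_continuousAt.mpr fun x => (hW x).continuousAt
  let Φ : ℝ → ℂ := fun x => ∫ t in (0 : ℝ)..x, c t
  have hΦ : ∀ x, HasDerivAt Φ (c x) x := fun x => hc.integral_hasStrictDerivAt 0 x |>.hasDerivAt
  have hΦc : Continuous Φ := continuous_iff_continuousAt.mpr fun x => (hΦ x).continuousAt
  have hre : ∀ x y, (Φ x - Φ y).re = - ∫ t in y..x, q t := by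
    intro x y
    have e1 : Φ x - Φ y = ∫ t in y..x, c t := by
      simp only [Φ]
      rw [intervalIntegral.integral_interval_sub_left] <;> exact hc.intervalIntegrable _ _
    rw [e1, ← Complex.reCLM_apply, ← Complex.reCLM.intervalIntegral_comp_comm
      (hc.intervalIntegrable _ _), ← intervalIntegral.integral_neg]
    exact intervalIntegral.integral_congr fun t _ => hcq t
  have hper1 : ∫ t in (x - T)..x, q t = ∫ t in (0 : ℝ)..T, q t := by
    have := hqper.intervalIntegral_add_eq (x - T) 0
    rwa [sub_add_cancel, zero_add] at this
  have hg : ∀ y, HasDerivAt (fun y => Complex.exp (Φ x - Φ y) * W y)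
      (Complex.exp (Φ x - Φ y) * (W' y - c y * W y)) y := by
    intro y
    exact ((((hΦ y).const_sub (Φ x)).cexp).fun_mul (hW y)).congr_deriv (by ring)
  have hint : W x - Complex.exp (Φ x - Φ (x - T)) * W x
      = ∫ y in (x - T)..x, Complex.exp (Φ x - Φ y) * (W' y - c y * W y) := by
    rw [intervalIntegral.integral_eq_sub_of_hasDerivAt (fun y _ => hg y)
      (Continuous.intervalIntegrable (by fun_prop) _ _), sub_self, Complex.exp_zero, one_mul,
      hper.sub_eq]
  have hsmall : ‖Complex.exp (Φ x - Φ (x - T))‖ ≤ 1 / 2 := by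
    rw [Complex.norm_exp, hre, hper1, Real.exp_neg, one_div]
    refine inv_anti₀ two_pos ?_
    linarith [Real.add_one_le_exp (∫ t in (0 : ℝ)..T, q t)]
  have hlow : ‖W x‖ ≤ 2 * ‖W x - Complex.exp (Φ x - Φ (x - T)) * W x‖ := by
    have e2 := norm_sub_norm_le (W x) (Complex.exp (Φ x - Φ (x - T)) * W x)
    rw [norm_mul] at e2
    nlinarith [norm_nonneg (W x)]
  refine hlow.trans ?_
  rw [hint, mul_assoc]
  refine mul_le_mul_of_nonneg_left ?_ two_pos.le
  rw [← intervalIntegral.integral_const_mul]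
  refine intervalIntegral.norm_integral_le_of_norm_le (by linarith)
    (Filter.Eventually.of_forall fun y hy => ?_) (Continuous.intervalIntegrable (by fun_prop) _ _)
  rw [norm_mul, Complex.norm_exp, hre]
  gcongr
  have := hK x y hy.2 (by linarith [hy.1])
  linarith

/-- The estimate of `norm_le_of_ode` for either sign of the real part of the coefficient. -/
lemma norm_le_of_ode_signed {T K : ℝ} (hT : 0 < T) {W W' c : ℝ → ℂ} {q : ℝ → ℝ}
    (hW : ∀ x, HasDerivAt W (W' x) x) (hW' : Continuous W') (hc : Continuous c)
    (hcq : (∀ x, (c x).re = -q x) ∨ ∀ x, (c x).re = q x)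
    (hper : W.Periodic T) (hqper : q.Periodic T)
    (hfper : (fun t => ‖W' t - c t * W t‖).Periodic T)
    (hK : ∀ x y, y ≤ x → x ≤ y + T → -K ≤ ∫ t in y..x, q t) (h1 : 1 ≤ ∫ t in (0 : ℝ)..T, q t)
    (x : ℝ) : ‖W x‖ ≤ 2 * Real.exp K * ∫ t in (0 : ℝ)..T, ‖W' t - c t * W t‖ := by
  have key : ∀ y, ∫ t in (y - T)..y, ‖W' t - c t * W t‖
      = ∫ t in (0 : ℝ)..T, ‖W' t - c t * W t‖ := by
    intro y
    have := hfper.intervalIntegral_add_eq (y - T) 0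
    rwa [sub_add_cancel, zero_add] at this
  rcases hcq with hcq | hcq
  · rw [← key x]
    exact norm_le_of_ode hT hW hW' hc hcq hper hqper hK h1 x
  · have hqint : ∀ x y, ∫ t in y..x, q (-t) = ∫ t in (-x)..(-y), q t := fun x y =>
      intervalIntegral.integral_comp_neg q
    have h := norm_le_of_ode (W := fun t => W (-t)) (W' := fun t => -W' (-t))
      (c := fun t => -c (-t)) (q := fun t => q (-t)) (K := K) hT
      (fun x => ((hW (-x)).scomp x (hasDerivAt_neg x)).congr_deriv (by simp)) (by fun_prop)
      (by fun_prop)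
      (fun x => by rw [Complex.neg_re, hcq])
      (fun t => by change W (-(t + T)) = W (-t); rw [neg_add, ← sub_eq_add_neg, hper.sub_eq])
      (fun t => by change q (-(t + T)) = q (-t); rw [neg_add, ← sub_eq_add_neg, hqper.sub_eq])
      (fun x y h1 h2 => by rw [hqint]; exact hK _ _ (by linarith) (by linarith))
      (by
        rw [hqint]
        have := hqper.intervalIntegral_add_eq (-T) 0
        rw [neg_add_cancel, zero_add] at this
        rwa [neg_zero, this]) (-x)
    simp only [neg_neg] at h
    refine h.trans_eq ?_
    congr 1
    have e1 : ∀ t, ‖-W' (-t) - -c (-t) * W (-t)‖ = ‖W' (-t) - c (-t) * W (-t)‖ := fun t => by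
      rw [neg_mul, ← neg_sub', norm_neg]
    simp_rw [e1]
    rw [intervalIntegral.integral_comp_neg (fun t => ‖W' t - c t * W t‖), ← key (x + T)]
    congr 1 <;> ring

/-- A continuous function as an element of `L²`. -/
abbrev toL2 : C(Circ, ℂ) →L[ℂ] L2 := ContinuousMap.toLp 2 μ₀ ℂ

lemma norm_sq_toL2 (g : C(Circ, ℂ)) : ‖toL2 g‖ ^ 2 = ∫ x, ‖g x‖ ^ 2 ∂μ₀ := by
  rw [norm_sq_eq_integral]
  refine integral_congr_ae ?_
  filter_upwards [ContinuousMap.coeFn_toLp (p := 2) (𝕜 := ℂ) μ₀ g] with x hx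
  rw [hx]

lemma norm_toL2_le (g : C(Circ, ℂ)) {C : ℝ} (hC : 0 ≤ C) (h : ∀ x, ‖g x‖ ≤ C) :
    ‖toL2 g‖ ≤ C := by
  refine abs_le_of_sq_le_sq' ?_ hC |>.2
  rw [norm_sq_toL2]
  calc ∫ x, ‖g x‖ ^ 2 ∂μ₀ ≤ ∫ _, C ^ 2 ∂μ₀ :=
        integral_mono (integrable_of_continuous (by fun_prop)) (integrable_const _) fun x =>
          pow_le_pow_left₀ (norm_nonneg _) (h x) 2
    _ = C ^ 2 := by simp

lemma integral_norm_le_norm_toL2 (g : C(Circ, ℂ)) : ∫ x, ‖g x‖ ∂μ₀ ≤ ‖toL2 g‖ := by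
  refine abs_le_of_sq_le_sq' ?_ (norm_nonneg _) |>.2
  rw [norm_sq_toL2]
  set a := ∫ x, ‖g x‖ ∂μ₀ with ha
  have h : 0 ≤ ∫ x, (‖g x‖ - a) ^ 2 ∂μ₀ := integral_nonneg fun x => sq_nonneg _
  have h2 : ∀ x, (‖g x‖ - a) ^ 2 = ‖g x‖ ^ 2 - 2 * a * ‖g x‖ + a ^ 2 := fun x => by ring
  simp_rw [h2] at h
  rw [integral_add (integrable_of_continuous (by fun_prop)) (integrable_const _),
    integral_sub (integrable_of_continuous (by fun_prop)) (integrable_of_continuous (by fun_prop)),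
    integral_const_mul, ← ha, integral_const] at h
  simp only [probReal_univ, one_smul] at h
  linarith

lemma mulOp_toL2 (χ : C(Circ, ℝ)) (g : C(Circ, ℂ)) :
    mulOp χ (toL2 g) = toL2 (⟨fun x => (χ x : ℂ) * g x, by fun_prop⟩ : C(Circ, ℂ)) := by
  refine Lp.ext ?_
  filter_upwards [coeFn_mulOp χ (toL2 g), ContinuousMap.coeFn_toLp (p := 2) (𝕜 := ℂ) μ₀ g,
    ContinuousMap.coeFn_toLp (p := 2) (𝕜 := ℂ) μ₀
      (⟨fun x => (χ x : ℂ) * g x, by fun_prop⟩ : C(Circ, ℂ))] with x h1 h2 h3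
  rw [h1, h2, h3]
  rfl

lemma integral_period_eq (g : C(Circ, ℂ)) :
    ∫ t in (0 : ℝ)..(2 * Real.pi), ‖g (t : Circ)‖ = 2 * Real.pi * ∫ x, ‖g x‖ ∂μ₀ := by
  have h := AddCircle.intervalIntegral_preimage (2 * Real.pi) 0 fun x : Circ => ‖g x‖
  rw [zero_add] at h
  rw [h, AddCircle.integral_haarAddCircle, smul_eq_mul, ← mul_assoc,
    mul_inv_cancel₀ Real.two_pi_pos.ne', one_mul]

/-- The a priori estimate for trigonometric polynomials whose frequencies have the sign `η`. On
such functions `|D| = -iη d/dx`. -/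
lemma norm_le_norm_P_of_finset {χ : C(Circ, ℝ)} {τ : ℂ} {K : ℝ}
    (hK : |τ.re| * ∫ t in (0 : ℝ)..(2 * Real.pi), max (-(lift χ t + 2 * τ.im)) 0 ≤ K)
    (h1 : 1 ≤ |τ.re| * ∫ t in (0 : ℝ)..(2 * Real.pi), (lift χ t + 2 * τ.im))
    {η : ℤ} (hη : η = 1 ∨ η = -1) {d : ℤ → ℂ} (hd : ∀ n, d n ≠ 0 → |n| = η * n) (s : Finset ℤ) :
    ‖incl (∑ n ∈ s, d n • expH n)‖
      ≤ 4 * Real.pi * Real.exp K * ‖P χ τ (∑ n ∈ s, d n • expH n)‖ := by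
  have hη2 : (η : ℂ) * η = 1 := by rcases hη with rfl | rfl <;> norm_num
  let g : C(Circ, ℂ) := ∑ n ∈ s, d n • fourier n
  let Dg : C(Circ, ℂ) := ∑ n ∈ s, (d n * ((|n| : ℤ) : ℂ)) • fourier n
  let F : C(Circ, ℂ) := Dg
    - (Complex.I * τ) • (⟨fun x => (χ x : ℂ) * g x, by fun_prop⟩ : C(Circ, ℂ)) - τ ^ 2 • g
  have e1 : incl (∑ n ∈ s, d n • expH n) = toL2 g := by
    simp only [g, map_sum, map_smul, incl_expH]
  have e2 : P χ τ (∑ n ∈ s, d n • expH n) = toL2 F := by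
    rw [P_apply, e1, mulOp_toL2]
    have : absD (∑ n ∈ s, d n • expH n) = toL2 Dg := by
      simp only [Dg, map_sum, map_smul, absD_expH, smul_smul]
    rw [this]
    simp only [F, map_sub, map_smul]
  rw [e1, e2]
  -- the differential equation
  let W : ℝ → ℂ := fun x => g (x : Circ)
  let c : ℝ → ℂ := fun x => Complex.I * η * (τ ^ 2 + Complex.I * τ * lift χ x)
  let W' : ℝ → ℂ := fun x => Complex.I * η * Dg (x : Circ)
  have hlift : Continuous (lift χ) := χ.continuous.comp (AddCircle.continuous_mk' _)
  have hmk : Continuous fun x : ℝ => (x : Circ) := AddCircle.continuous_mk' _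
  have hW : ∀ x, HasDerivAt W (W' x) x := by
    intro x
    have h2 : ∀ n ∈ s, HasDerivAt (fun x : ℝ => d n * fourier n (x : Circ))
        (d n * (2 * Real.pi * Complex.I * n / (2 * Real.pi : ℝ) * fourier n (x : Circ))) x :=
      fun n _ => (hasDerivAt_fourier (2 * Real.pi) n x).const_mul (d n)
    have h3 := HasDerivAt.fun_sum h2
    have hpi : (Real.pi : ℂ) ≠ 0 := by exact_mod_cast Real.pi_ne_zero
    have hWe : W = fun x : ℝ => ∑ n ∈ s, d n * fourier n (x : Circ) := by
      ext1 x
      simp [W, g]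
    rw [hWe]
    refine h3.congr_deriv ?_
    simp only [W', Dg, ContinuousMap.coe_sum, Finset.sum_apply, ContinuousMap.coe_smul,
      Pi.smul_apply, smul_eq_mul, Finset.mul_sum]
    refine Finset.sum_congr rfl fun n _ => ?_
    by_cases hn : d n = 0
    · simp [hn]
    · rw [hd n hn]
      push_cast
      field_simp
      linear_combination -(n : ℂ) * hη2
  have hf : ∀ x : ℝ, W' x - c x * W x = Complex.I * η * F (x : Circ) := by
    intro x
    simp only [W', c, W, F, lift, ContinuousMap.sub_apply, ContinuousMap.smul_apply, smul_eq_mul,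
      ContinuousMap.coe_mk]
    ring
  have hnf : ∀ x : ℝ, ‖W' x - c x * W x‖ = ‖F (x : Circ)‖ := by
    intro x
    rw [hf, norm_mul, norm_mul, Complex.norm_I]
    rcases hη with rfl | rfl <;> simp
  let q : ℝ → ℝ := fun x => |τ.re| * (lift χ x + 2 * τ.im)
  have hcre : ∀ x, (c x).re = -(η * τ.re * (lift χ x + 2 * τ.im)) := by
    intro x
    simp only [c, sq, Complex.mul_re, Complex.mul_im, Complex.add_re, Complex.add_im,
      Complex.I_re, Complex.I_im, Complex.intCast_re, Complex.intCast_im, Complex.ofReal_re,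
      Complex.ofReal_im]
    ring
  have hcq : (∀ x, (c x).re = -q x) ∨ ∀ x, (c x).re = q x := by
    rcases abs_choice τ.re with h | h <;> rcases hη with rfl | rfl
    · left; intro x; rw [hcre]; simp [q, h]
    · right; intro x; rw [hcre]; simp [q, h]
    · right; intro x; rw [hcre]; simp [q, h]
    · left; intro x; rw [hcre]; simp [q, h]
  have hlper : (lift χ).Periodic (2 * Real.pi) := fun x => by
    simp only [lift, AddCircle.coe_add_period]
  have hqc : Continuous q := by fun_prop
  have hqper : q.Periodic (2 * Real.pi) := fun x => by
    simp only [q, hlper x]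
  let p : ℝ → ℝ := fun t => |τ.re| * max (-(lift χ t + 2 * τ.im)) 0
  have hpc : Continuous p := by fun_prop
  have hpper : p.Periodic (2 * Real.pi) := fun x => by
    simp only [p, hlper x]
  have hp0 : ∀ t, 0 ≤ p t := fun t => mul_nonneg (abs_nonneg _) (le_max_right _ _)
  have hqp : ∀ t, -p t ≤ q t := fun t => by
    simp only [p, q]
    rw [← mul_neg]
    refine mul_le_mul_of_nonneg_left ?_ (abs_nonneg _)
    linarith [le_max_left (-(lift χ t + 2 * τ.im)) 0]
  have hKq : ∀ x y, y ≤ x → x ≤ y + 2 * Real.pi → -K ≤ ∫ t in y..x, q t := by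
    intro x y hyx hxy
    have i1 : ∫ t in y..x, -p t ≤ ∫ t in y..x, q t :=
      intervalIntegral.integral_mono_on hyx (hpc.neg.intervalIntegrable _ _)
        (hqc.intervalIntegrable _ _) fun t _ => hqp t
    have i2 : ∫ t in y..x, p t ≤ ∫ t in y..(y + 2 * Real.pi), p t :=
      intervalIntegral.integral_mono_interval le_rfl hyx hxy
        (Filter.Eventually.of_forall hp0) (hpc.intervalIntegrable _ _)
    have i3 : ∫ t in (0 : ℝ)..(2 * Real.pi), p t ≤ K := by
      rwa [intervalIntegral.integral_const_mul]
    rw [hpper.intervalIntegral_add_eq y 0, zero_add] at i2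
    rw [intervalIntegral.integral_neg] at i1
    linarith
  have hmain := norm_le_of_ode_signed (K := K) Real.two_pi_pos hW (by fun_prop) (by fun_prop)
    hcq (fun x => by simp only [W, AddCircle.coe_add_period]) hqper
    (fun x => by simp only [hnf, AddCircle.coe_add_period]) hKq
    (by rwa [intervalIntegral.integral_const_mul])
  simp_rw [hnf] at hmain
  rw [integral_period_eq] at hmain
  refine (norm_toL2_le g (C := 2 * Real.exp K * (2 * Real.pi * ∫ x, ‖F x‖ ∂μ₀))
    ?_ fun x => ?_).trans ?_
  · have := integral_nonneg (μ := μ₀) (f := fun x => ‖F x‖) fun x => norm_nonneg (F x)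
    positivity
  · obtain ⟨y, rfl⟩ := QuotientAddGroup.mk_surjective x
    exact hmain y
  · calc _ = 4 * Real.pi * Real.exp K * ∫ x, ‖F x‖ ∂μ₀ := by ring
      _ ≤ _ := by
        gcongr
        exact integral_norm_le_norm_toL2 F

/-- The a priori estimate for functions whose frequencies have the sign `η`. -/
lemma norm_le_norm_P {χ : C(Circ, ℝ)} {τ : ℂ} {K : ℝ}
    (hK : |τ.re| * ∫ t in (0 : ℝ)..(2 * Real.pi), max (-(lift χ t + 2 * τ.im)) 0 ≤ K)
    (h1 : 1 ≤ |τ.re| * ∫ t in (0 : ℝ)..(2 * Real.pi), (lift χ t + 2 * τ.im))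
    {η : ℤ} (hη : η = 1 ∨ η = -1) {w : H1} (hw : ∀ n, coeff (incl w) n ≠ 0 → |n| = η * n) :
    ‖incl w‖ ≤ 4 * Real.pi * Real.exp K * ‖P χ τ w‖ := by
  have h := hasSum_expH w
  refine le_of_tendsto_of_tendsto ((incl.continuous.norm.tendsto w).comp h)
    (((P χ τ).continuous.norm.tendsto w).const_mul _ |>.comp h)
    (Filter.Eventually.of_forall fun s => norm_le_norm_P_of_finset hK h1 hη hw s)

/-! ### Absence of resonances with small imaginary part -/

lemma continuous_lift (χ : C(Circ, ℝ)) : Continuous (lift χ) :=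
  χ.continuous.comp (AddCircle.continuous_mk' _)

lemma exists_mem_Icc_coe_eq (x : Circ) : ∃ t ∈ Set.Icc 0 (2 * Real.pi), (t : Circ) = x := by
  have h : x ∈ (QuotientAddGroup.mk '' Set.Icc (0 : ℝ) (0 + 2 * Real.pi) : Set Circ) := by
    rw [AddCircle.coe_image_Icc_eq]
    trivial
  rw [zero_add] at h
  exact h

lemma integral_lift_pos {χ : C(Circ, ℝ)} (hχ : ∀ x, 0 ≤ χ x) (hχ0 : χ ≠ 0) :
    0 < ∫ t in (0 : ℝ)..(2 * Real.pi), lift χ t := by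
  obtain ⟨x, hx⟩ : ∃ x, χ x ≠ 0 := by
    by_contra! h
    exact hχ0 (ContinuousMap.ext h)
  obtain ⟨t, ht, rfl⟩ := exists_mem_Icc_coe_eq x
  exact intervalIntegral.integral_pos Real.two_pi_pos (continuous_lift χ).continuousOn
    (fun t _ => hχ _) ⟨t, ht, (hχ _).lt_of_ne' hx⟩

lemma coeff_P (χ : C(Circ, ℝ)) (τ : ℂ) (u : H1) (n : ℤ) :
    coeff (P χ τ u) n = (((|n| : ℤ) : ℂ) - τ ^ 2) * coeff (incl u) n
      - Complex.I * τ * coeff (mulOp χ (incl u)) n := by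
  rw [P_apply, coeff_sub, coeff_sub, coeff_smul, coeff_smul, coeff_absD]
  ring

open Classical in
lemma exists_proj_H1 (S : Set ℤ) (u : H1) : ∃ v : H1, ∀ n,
    coeff (incl v) n = if n ∈ S then coeff (incl u) n else 0 := by
  refine ⟨lamInv (proj S (lam u)), fun n => ?_⟩
  rw [coeff_incl_lamInv, coeff_proj, lam_apply]
  split_ifs
  · rw [coeff_add, coeff_absD, ← add_one_mul, ← mul_assoc,
      show ((|n| : ℤ) : ℂ) + 1 = ((1 + |n| : ℤ) : ℂ) by push_cast; ring,
      inv_mul_cancel₀ (one_add_abs_ne_zero n), one_mul]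
  · rw [mul_zero]

/-- Energy identity for elements of the kernel of `P(τ)`, when `τ` is not purely imaginary. -/
lemma integral_eq_of_P_eq_zero {χ : C(Circ, ℝ)} {τ : ℂ} (hτ : τ.re ≠ 0) {u : H1}
    (hu : P χ τ u = 0) :
    ∫ x, χ x * ‖(incl u : L2) x‖ ^ 2 ∂μ₀ = -(2 * τ.im) * ‖incl u‖ ^ 2 := by
  have h := congrArg (inner ℂ (incl u)) hu
  obtain ⟨q, -, hq⟩ := inner_incl_absD u
  rw [P_apply, inner_sub_right, inner_sub_right, inner_smul_right, inner_smul_right, hq,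
    inner_self_mulOp, inner_zero_right, inner_self_eq_norm_sq_to_K] at h
  set J := ∫ x, χ x * ‖(incl u : L2) x‖ ^ 2 ∂μ₀
  have h2 : (q : ℂ) - Complex.I * τ * J - τ ^ 2 * ((‖incl u‖ ^ 2 : ℝ) : ℂ) = 0 := by
    rw [Complex.ofReal_pow]
    exact h
  have h3 := congrArg Complex.im h2
  simp only [sq τ, Complex.sub_im, Complex.mul_im, Complex.mul_re, Complex.I_re, Complex.I_im,
    Complex.ofReal_re, Complex.ofReal_im, Complex.zero_im] at h3
  have h4 : τ.re * (J + 2 * τ.im * ‖incl u‖ ^ 2) = 0 := by linarith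
  rcases mul_eq_zero.mp h4 with h5 | h5
  · exact absurd h5 hτ
  · linarith

/-- The part of an element of the kernel of `P(τ)` at frequencies below `|Re τ|² / 2` is small. -/
lemma norm_low_le {χ : C(Circ, ℝ)} {τ : ℂ} (ha : 2 ≤ |τ.re|) (hb : |τ.im| ≤ 1) {u : H1}
    (hu : P χ τ u = 0) {m : ℕ} (hm : (2 * m : ℝ) ≤ |τ.re| ^ 2 / 2) :
    ‖proj {n | |n| < 2 * m} (incl u)‖ ≤ 8 / |τ.re| * ‖mulOp χ (incl u)‖ := by
  classical
  set a := |τ.re| with hadef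
  have ha0 : 0 < a := by linarith
  have hτ : ‖τ‖ ≤ 2 * a := (Complex.norm_le_abs_re_add_abs_im τ).trans (by linarith)
  refine norm_le_of_coeff (by positivity) fun n => ?_
  rw [coeff_proj]
  split_ifs with hn
  · have h1 := congrArg (fun v : L2 => coeff v n) hu
    simp only [coeff_P, coeff_zero] at h1
    have h2 : ‖((|n| : ℤ) : ℂ) - τ ^ 2‖ * ‖coeff (incl u) n‖
        = ‖τ‖ * ‖coeff (mulOp χ (incl u)) n‖ := by
      rw [← norm_mul, sub_eq_zero.mp h1, norm_mul, norm_mul, Complex.norm_I, one_mul]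
    have h3 : a ^ 2 / 4 ≤ ‖((|n| : ℤ) : ℂ) - τ ^ 2‖ := by
      have h4 := Complex.abs_re_le_norm (((|n| : ℤ) : ℂ) - τ ^ 2)
      rw [Complex.sub_re, sq τ, Complex.mul_re, Complex.intCast_re] at h4
      have h5 : ((|n| : ℤ) : ℝ) < 2 * m := by exact_mod_cast hn
      have h6 : τ.re * τ.re = a ^ 2 := by rw [hadef, sq_abs, sq]
      have h7 : τ.im * τ.im ≤ 1 := by nlinarith [abs_nonneg τ.im, abs_mul_abs_self τ.im]
      rw [← sq τ] at h4
      have h8 := neg_abs_le (((|n| : ℤ) : ℝ) - (τ.re * τ.re - τ.im * τ.im))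
      nlinarith
    have h9 : a ^ 2 / 4 * ‖coeff (incl u) n‖ ≤ 2 * a * ‖coeff (mulOp χ (incl u)) n‖ :=
      (mul_le_mul_of_nonneg_right h3 (norm_nonneg _)).trans
        (h2.trans_le (mul_le_mul_of_nonneg_right hτ (norm_nonneg _)))
    rw [div_mul_eq_mul_div, le_div_iff₀ ha0]
    nlinarith
  · rw [norm_zero]
    positivity

/-- A vector in the kernel of `P(τ)` splits into its parts of nonnegative and of negative
frequencies. Each of them solves `P(τ) v = r`, where `r` measures the coupling of the two. -/
lemma norm_le_of_coupling {χ : C(Circ, ℝ)} {τ : ℂ} {K X : ℝ}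
    (hK : |τ.re| * ∫ t in (0 : ℝ)..(2 * Real.pi), max (-(lift χ t + 2 * τ.im)) 0 ≤ K)
    (h1 : 1 ≤ |τ.re| * ∫ t in (0 : ℝ)..(2 * Real.pi), (lift χ t + 2 * τ.im))
    {u : H1} (hu : P χ τ u = 0)
    (hX1 : ‖proj {n | 0 ≤ n} (mulOp χ (proj {n | 0 ≤ n}ᶜ (incl u)))‖ ≤ X)
    (hX2 : ‖proj {n | 0 ≤ n}ᶜ (mulOp χ (proj {n | 0 ≤ n} (incl u)))‖ ≤ X) :
    ‖incl u‖ ≤ 16 * Real.pi * Real.exp K * ‖τ‖ * X := by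
  classical
  obtain ⟨v, hv⟩ := exists_proj_H1 {n | 0 ≤ n} u
  have hvi : incl v = proj {n | 0 ≤ n} (incl u) := ext_coeff fun n => by rw [hv, coeff_proj]
  have hwi : incl (u - v) = proj {n | 0 ≤ n}ᶜ (incl u) := by
    rw [map_sub, hvi, sub_eq_iff_eq_add, add_comm, proj_add_proj_compl]
  have hPv : P χ τ v = (Complex.I * τ) • proj {n | 0 ≤ n} (mulOp χ (incl (u - v)))
      - (Complex.I * τ) • proj {n | 0 ≤ n}ᶜ (mulOp χ (incl v)) := by
    refine ext_coeff fun n => ?_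
    have h2 := congrArg (fun w : L2 => coeff w n) hu
    simp only [coeff_P, coeff_zero] at h2
    rw [coeff_P, coeff_sub, coeff_smul, coeff_smul, coeff_proj, coeff_proj, map_sub, map_sub,
      coeff_sub, hv]
    by_cases hn : 0 ≤ n
    · simp only [Set.mem_ofPred_eq, hn, if_true, Set.mem_compl_iff, not_true_eq_false, if_false]
      linear_combination h2
    · simp only [Set.mem_ofPred_eq, hn, if_true, Set.mem_compl_iff, not_false_eq_true, if_false]
      ring
  have hnorm : ‖P χ τ v‖ ≤ ‖τ‖ * X + ‖τ‖ * X := by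
    rw [hPv]
    refine (norm_sub_le _ _).trans ?_
    rw [norm_smul, norm_smul, norm_mul, Complex.norm_I, one_mul, hwi, hvi]
    gcongr
  have hnorm2 : ‖P χ τ (u - v)‖ ≤ ‖τ‖ * X + ‖τ‖ * X := by
    rw [map_sub, hu, zero_sub, norm_neg]
    exact hnorm
  have b1 : ‖incl v‖ ≤ 4 * Real.pi * Real.exp K * ‖P χ τ v‖ :=
    norm_le_norm_P hK h1 (η := 1) (Or.inl rfl) fun n hn => by
      rw [hv] at hn
      have : 0 ≤ n := by
        by_contra h
        exact hn (if_neg h)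
      rw [abs_of_nonneg this, one_mul]
  have b2 : ‖incl (u - v)‖ ≤ 4 * Real.pi * Real.exp K * ‖P χ τ (u - v)‖ :=
    norm_le_norm_P hK h1 (η := -1) (Or.inr rfl) fun n hn => by
      rw [hwi, coeff_proj] at hn
      have : ¬ 0 ≤ n := by
        by_contra h
        exact hn (if_neg (not_not.mpr h))
      rw [abs_of_neg (not_le.mp this)]
      ring
  have h3 : ‖incl u‖ ≤ ‖incl v‖ + ‖incl (u - v)‖ := by
    refine le_trans (le_of_eq ?_) (norm_add_le _ _)
    rw [← map_add, add_sub_cancel]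
  have hpos : 0 ≤ 4 * Real.pi * Real.exp K := by positivity
  calc ‖incl u‖ ≤ 4 * Real.pi * Real.exp K * (‖τ‖ * X + ‖τ‖ * X)
        + 4 * Real.pi * Real.exp K * (‖τ‖ * X + ‖τ‖ * X) :=
        h3.trans (add_le_add (b1.trans (mul_le_mul_of_nonneg_left hnorm hpos))
          (b2.trans (mul_le_mul_of_nonneg_left hnorm2 hpos)))
    _ = _ := by ring

/-- The coupling between two disjoint frequency ranges `S` and `T`, when multiplication by `χ`
almost preserves frequencies at the scale `2 m`. -/
lemma norm_coupling_le {χ : C(Circ, ℝ)} {m : ℕ} {Q D : ℝ} (hQ0 : 0 ≤ Q)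
    (hQ : ∀ (S : Set ℤ) (w : L2), (∀ n ∈ S, ∀ j, coeff w j ≠ 0 → 2 * (m : ℤ) ≤ |n - j|) →
      ‖proj S (mulOp χ w)‖ ≤ Q * ‖w‖) {u : L2} (hD : ‖proj {n | |n| < 2 * m} u‖ ≤ D)
    {S T : Set ℤ} (hST : ∀ n ∈ S, ∀ j ∈ T, |j| ≤ |n - j|) :
    ‖proj S (mulOp χ (proj T u))‖ ≤ ‖χ‖ * D + Q * ‖u‖ := by
  classical
  have hdec : proj T u = proj T (proj {n | |n| < 2 * m} u)
      + proj {n | |n| < 2 * (m : ℤ)}ᶜ (proj T u) := by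
    refine ext_coeff fun n => ?_
    simp only [coeff_add, coeff_proj, Set.mem_compl_iff]
    by_cases hn : n ∈ {n : ℤ | |n| < 2 * m} <;> simp [hn]
  rw [hdec, map_add, map_add]
  refine (norm_add_le _ _).trans (add_le_add ?_ ?_)
  · refine (norm_proj_le _ _).trans ((norm_mulOp_apply_le _ _).trans ?_)
    exact mul_le_mul_of_nonneg_left ((norm_proj_le _ _).trans hD) (norm_nonneg _)
  · refine (hQ S _ fun n hn j hj => ?_).trans
      (mul_le_mul_of_nonneg_left ((norm_proj_le _ _).trans (norm_proj_le _ _)) hQ0)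
    rw [coeff_proj, coeff_proj] at hj
    have hj1 : ¬ |j| < 2 * (m : ℤ) := by
      intro h
      exact hj (if_neg (not_not.mpr h))
    rw [if_pos (show j ∈ {n : ℤ | |n| < 2 * (m : ℤ)}ᶜ from hj1)] at hj
    have hj2 : j ∈ T := by
      by_contra h
      exact hj (if_neg h)
    exact (not_lt.mp hj1).trans (hST n hn j hj2)

lemma rpow_neg_le_of_sq_div_le {a x β : ℝ} (ha : 0 < a) (hβ0 : 0 ≤ β) (hβ1 : β ≤ 1)
    (hx : a ^ 2 / 8 ≤ x) : x ^ (-β) ≤ 8 * a ^ (-(2 * β)) := by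
  calc x ^ (-β) ≤ (a ^ 2 / 8) ^ (-β) :=
        Real.rpow_le_rpow_of_nonpos (by positivity) hx (by linarith)
    _ = 8 ^ β * a ^ (-(2 * β)) := by
      rw [Real.div_rpow (by positivity) (by norm_num), ← Real.rpow_natCast, ← Real.rpow_mul ha.le,
        Real.rpow_neg (by norm_num : (0 : ℝ) ≤ 8), div_inv_eq_mul, mul_comm]
      congr 2
      push_cast
      ring
    _ ≤ 8 ^ (1 : ℝ) * a ^ (-(2 * β)) := by
      gcongr
      norm_num
    _ = _ := by rw [Real.rpow_one]

/-- A quantitative obstruction to resonances with small imaginary part: the low frequencies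
contribute the first term, the coupling of the high frequencies the second one. -/
lemma one_le_of_P_eq_zero {β : ℝ} (hβ0 : 0 ≤ β) (hβ1 : β ≤ 1) {χ : C(Circ, ℝ)}
    (hχ : ∀ x, 0 ≤ χ x) {Q : ℝ} (hQ0 : 0 ≤ Q)
    (hQ : ∀ m : ℕ, 0 < m → ∀ (S : Set ℤ) (w : L2),
      (∀ n ∈ S, ∀ j, coeff w j ≠ 0 → 2 * (m : ℤ) ≤ |n - j|) →
      ‖proj S (mulOp χ w)‖ ≤ Q * (m : ℝ) ^ (-β) * ‖w‖)
    {τ : ℂ} {K ε : ℝ} (ha : 4 < |τ.re|) (hb : -1 ≤ τ.im) (hε : -ε ≤ τ.im) (hε0 : 0 < ε)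
    (hK : |τ.re| * ∫ t in (0 : ℝ)..(2 * Real.pi), max (-(lift χ t + 2 * τ.im)) 0 ≤ K)
    (h1 : 1 ≤ |τ.re| * ∫ t in (0 : ℝ)..(2 * Real.pi), (lift χ t + 2 * τ.im))
    {u : H1} (hu0 : u ≠ 0) (hu : P χ τ u = 0) :
    1 ≤ 32 * Real.pi * Real.exp K * ‖χ‖ * 8 * √(‖χ‖ * (2 * ε))
      + 32 * Real.pi * Real.exp K * Q * 8 * |τ.re| ^ (-(2 * β - 1)) := by
  set a := |τ.re| with hadef
  have ha0 : 0 < a := by linarith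
  have hN : 0 < ‖incl u‖ := norm_pos_iff.mpr fun h => hu0 (incl_injective (by rw [h, map_zero]))
  have hJ := integral_eq_of_P_eq_zero (abs_pos.mp ha0) hu
  have him : τ.im ≤ 0 := by
    have h := integral_mul_norm_sq_nonneg hχ (incl u)
    rw [hJ] at h
    by_contra! h'
    nlinarith [mul_pos h' (pow_pos hN 2)]
  have hmul : ‖mulOp χ (incl u)‖ ≤ √(‖χ‖ * (2 * ε)) * ‖incl u‖ := by
    refine abs_le_of_sq_le_sq' ?_ (by positivity) |>.2
    rw [mul_pow, Real.sq_sqrt (by positivity)]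
    refine (norm_mulOp_sq_le hχ _).trans ?_
    rw [hJ, ← mul_assoc]
    gcongr
    linarith
  -- the frequency `2 m` separates low and high frequencies
  obtain ⟨m, hm1, hm2⟩ : ∃ m : ℕ, (2 * m : ℝ) ≤ a ^ 2 / 2 ∧ a ^ 2 / 8 ≤ m := by
    refine ⟨⌊a ^ 2 / 4⌋₊, ?_, ?_⟩
    · have := Nat.floor_le (show 0 ≤ a ^ 2 / 4 by positivity)
      linarith
    · have := Nat.lt_floor_add_one (a ^ 2 / 4)
      nlinarith
  have hm0 : 0 < m := by
    have : (0 : ℝ) < m := lt_of_lt_of_le (by positivity) hm2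
    exact_mod_cast this
  have hlow := norm_low_le (by linarith) (abs_le.mpr ⟨by linarith, by linarith⟩) hu hm1
  have hmβ : (m : ℝ) ^ (-β) ≤ 8 * a ^ (-(2 * β)) := rpow_neg_le_of_sq_div_le ha0 hβ0 hβ1 hm2
  have hcoup : ∀ S T : Set ℤ, (∀ n ∈ S, ∀ j ∈ T, |j| ≤ |n - j|) →
      ‖proj S (mulOp χ (proj T (incl u)))‖ ≤
        (‖χ‖ * (8 / a * √(‖χ‖ * (2 * ε))) + Q * (8 * a ^ (-(2 * β)))) * ‖incl u‖ := by
    intro S T hST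
    refine (norm_coupling_le (by positivity) (hQ m hm0)
      (hlow.trans (mul_le_mul_of_nonneg_left hmul (by positivity))) hST).trans ?_
    rw [add_mul, mul_assoc ‖χ‖, mul_assoc (8 / a)]
    gcongr
  have hfin := norm_le_of_coupling hK h1 hu
    (hcoup {n | 0 ≤ n} {n | 0 ≤ n}ᶜ fun n hn j hj => by
      simp only [Set.mem_ofPred_eq, Set.mem_compl_iff, not_le] at hn hj
      rw [abs_of_neg hj, abs_of_nonneg (by linarith)]
      linarith)
    (hcoup {n | 0 ≤ n}ᶜ {n | 0 ≤ n} fun n hn j hj => by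
      simp only [Set.mem_ofPred_eq, Set.mem_compl_iff, not_le] at hn hj
      rw [abs_of_nonneg hj, abs_of_neg (by linarith)]
      linarith)
  have hτa : ‖τ‖ ≤ 2 * a := by
    refine (Complex.norm_le_abs_re_add_abs_im τ).trans ?_
    rw [abs_of_nonpos him]
    linarith
  have h5 : a ^ (-(2 * β - 1)) = a * a ^ (-(2 * β)) := by
    rw [neg_sub, sub_eq_add_neg, Real.rpow_add ha0, Real.rpow_one]
  have h4 : ‖incl u‖ ≤ (32 * Real.pi * Real.exp K * ‖χ‖ * 8 * √(‖χ‖ * (2 * ε))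
      + 32 * Real.pi * Real.exp K * Q * 8 * a ^ (-(2 * β - 1))) * ‖incl u‖ := by
    refine hfin.trans ?_
    calc _ ≤ 16 * Real.pi * Real.exp K * (2 * a) * ((‖χ‖ * (8 / a * √(‖χ‖ * (2 * ε)))
          + Q * (8 * a ^ (-(2 * β)))) * ‖incl u‖) := by gcongr
      _ = _ := by
        rw [h5]
        field_simp
        ring
  exact le_of_mul_le_mul_right (by rwa [one_mul]) hN

/-- There is no resonance of large real part and small imaginary part for which the growth of the
solutions of the associated transport equation is bounded by a fixed constant. -/
theorem exists_no_resonance {β : ℝ≥0} (hβ : (1 / 2 : ℝ≥0) < β) (hβ1 : β ≤ 1)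
    {χ : C(Circ, ℝ)} (hχβ : MemHolder β χ) (hχ : ∀ x, 0 ≤ χ x) (hχ0 : χ ≠ 0) (K : ℝ) :
    ∃ A ε : ℝ, 0 < A ∧ 0 < ε ∧ ∀ τ ∈ resonances χ, A < |τ.re| → -ε ≤ τ.im →
      K < |τ.re| * ∫ t in (0 : ℝ)..(2 * Real.pi), max (-(lift χ t + 2 * τ.im)) 0 := by
  have hβ0 : 0 < β := lt_trans (by norm_num) hβ
  have hβ' : (1 / 2 : ℝ) < β := by exact_mod_cast hβ
  obtain ⟨Q, hQ0, hQ⟩ := exists_norm_proj_mulOp_le hβ0 hβ1 hχβ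
  have hI0 := integral_lift_pos hχ hχ0
  set I₀ := ∫ t in (0 : ℝ)..(2 * Real.pi), lift χ t with hI
  obtain ⟨ε₁, hε₁, hε⟩ : ∃ ε₁ : ℝ, 0 < ε₁ ∧
      32 * Real.pi * Real.exp K * ‖χ‖ * 8 * √(‖χ‖ * (2 * ε₁)) < 1 / 2 := by
    have h1 : Filter.Tendsto (fun ε : ℝ => 32 * Real.pi * Real.exp K * ‖χ‖ * 8 *
        √(‖χ‖ * (2 * ε))) (𝓝[>] 0) (𝓝 0) := by
      have : Continuous fun ε : ℝ => 32 * Real.pi * Real.exp K * ‖χ‖ * 8 * √(‖χ‖ * (2 * ε)) := by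
        fun_prop
      simpa using (this.tendsto 0).mono_left nhdsWithin_le_nhds
    obtain ⟨ε, h2, h3⟩ := ((h1.eventually_lt_const (by norm_num : (0 : ℝ) < 1 / 2)).and
      self_mem_nhdsWithin).exists
    exact ⟨ε, h3, h2⟩
  -- this is where `β > 1 / 2` is needed
  obtain ⟨A₁, hA₁⟩ : ∃ A₁ : ℝ, ∀ a > A₁,
      32 * Real.pi * Real.exp K * Q * 8 * a ^ (-(2 * (β : ℝ) - 1)) < 1 / 2 := by
    have h1 : Filter.Tendsto (fun a : ℝ => 32 * Real.pi * Real.exp K * Q * 8 *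
        a ^ (-(2 * (β : ℝ) - 1))) Filter.atTop (𝓝 0) := by
      have := (tendsto_rpow_neg_atTop (by linarith : 0 < 2 * (β : ℝ) - 1)).const_mul
        (32 * Real.pi * Real.exp K * Q * 8)
      rwa [mul_zero] at this
    obtain ⟨A, hA⟩ := Filter.eventually_atTop.mp
      (h1.eventually_lt_const (by norm_num : (0 : ℝ) < 1 / 2))
    exact ⟨A, fun a ha => hA a ha.le⟩
  refine ⟨max (max A₁ 4) (2 / I₀), min (min ε₁ 1) (I₀ / (8 * Real.pi)), by positivity,
    by positivity, fun τ hτ ha hb => ?_⟩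
  by_contra! hKle
  obtain ⟨u, hu0, hu⟩ := (mem_resonances_iff hχ τ).mp hτ
  obtain ⟨⟨ha1, ha4⟩, haI⟩ : (A₁ < |τ.re| ∧ 4 < |τ.re|) ∧ 2 / I₀ < |τ.re| := by
    simpa only [max_lt_iff] using ha
  obtain ⟨⟨hb1, hb2⟩, hb3⟩ : (-ε₁ ≤ τ.im ∧ -1 ≤ τ.im) ∧ -(I₀ / (8 * Real.pi)) ≤ τ.im := by
    simpa only [neg_le, le_min_iff] using hb
  have h1 : 1 ≤ |τ.re| * ∫ t in (0 : ℝ)..(2 * Real.pi), (lift χ t + 2 * τ.im) := by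
    rw [intervalIntegral.integral_add ((continuous_lift χ).intervalIntegrable _ _)
      (by simp), intervalIntegral.integral_const, ← hI, smul_eq_mul, sub_zero]
    have h2 : I₀ / 2 ≤ I₀ + 2 * Real.pi * (2 * τ.im) := by
      have : -(I₀ / (8 * Real.pi)) * (4 * Real.pi) ≤ τ.im * (4 * Real.pi) := by gcongr
      have h3 : -(I₀ / (8 * Real.pi)) * (4 * Real.pi) = -(I₀ / 2) := by
        field_simp
        ring
      linarith
    rw [div_lt_iff₀ hI0] at haI
    nlinarith
  have h2 := one_le_of_P_eq_zero hβ0.le (by exact_mod_cast hβ1) hχ hQ0 hQ ha4 hb2 hb1 hε₁ hKle h1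
    hu0 hu
  exact not_lt.mpr h2 ((add_lt_add hε (hA₁ _ ha1)).trans_eq (add_halves 1))

/-! ### Resonance-free regions -/

/-- The resonance-free region for general damping. -/
theorem exists_im_lt {β : ℝ≥0} (hβ : (1 / 2 : ℝ≥0) < β) (hβ1 : β ≤ 1)
    {χ : C(Circ, ℝ)} (hχβ : MemHolder β χ) (hχ : ∀ x, 0 ≤ χ x) (hχ0 : χ ≠ 0) :
    ∃ C : ℝ, 0 < C ∧ ∀ τ ∈ resonances χ, C < |τ.re| → τ.im < -(C⁻¹ * |τ.re|⁻¹) := by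
  obtain ⟨A, ε, hA, hε, h⟩ := exists_no_resonance hβ hβ1 hχβ hχ hχ0 (4 * Real.pi)
  refine ⟨max A (max 1 ε⁻¹), by positivity, fun τ hτ ha => ?_⟩
  by_contra! hb
  set C := max A (max 1 ε⁻¹)
  obtain ⟨ha1, ha2, ha3⟩ : A < |τ.re| ∧ 1 < |τ.re| ∧ ε⁻¹ < |τ.re| := by
    simpa only [C, max_lt_iff] using ha
  have ha0 : 0 < |τ.re| := by linarith
  have hC1 : C⁻¹ ≤ 1 := inv_le_one_of_one_le₀ ((le_max_left _ _).trans (le_max_right _ _))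
  have hb1 : -|τ.re|⁻¹ ≤ τ.im := by
    have : C⁻¹ * |τ.re|⁻¹ ≤ 1 * |τ.re|⁻¹ := by gcongr
    linarith
  have hb2 : -ε ≤ τ.im := by
    have : |τ.re|⁻¹ ≤ ε := (inv_le_comm₀ hε ha0).mp ha3.le
    linarith
  refine not_le.mpr (h τ hτ ha1 hb2) ?_
  have hI : ∫ t in (0 : ℝ)..(2 * Real.pi), max (-(lift χ t + 2 * τ.im)) 0
      ≤ ∫ t in (0 : ℝ)..(2 * Real.pi), 2 * |τ.re|⁻¹ := by
    refine intervalIntegral.integral_mono_on Real.two_pi_pos.le ?_ (by simp) fun t _ => ?_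
    · exact (Continuous.intervalIntegrable (by have := continuous_lift χ; fun_prop) _ _)
    · have := hχ (t : Circ)
      refine max_le ?_ (by positivity)
      rw [lift]
      linarith
  calc _ ≤ |τ.re| * ∫ t in (0 : ℝ)..(2 * Real.pi), 2 * |τ.re|⁻¹ := by gcongr
    _ = 4 * Real.pi := by
      rw [intervalIntegral.integral_const, smul_eq_mul]
      field_simp
      ring

/-- Near every point, a finitely degenerate damping is bounded from below by a multiple of
`|x - x₀| ^ (2 N)`. -/
lemma exists_pow_le_lift {χ : C(Circ, ℝ)} (hd : FiniteDegeneracy χ) {N : ℕ}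
    (hN : IsMaxDegeneracy χ N) (x₀ : ℝ) :
    ∃ c : ℝ, 0 < c ∧ ∀ᶠ x in 𝓝 x₀, c * |x - x₀| ^ (2 * N) ≤ lift χ x := by
  obtain ⟨hsm, hχ, -, hz⟩ := hd
  have hnear : ∀ᶠ x in 𝓝 x₀, |x - x₀| ≤ 1 := by
    filter_upwards [Metric.closedBall_mem_nhds x₀ one_pos] with x hx
    simpa [Real.dist_eq] using hx
  by_cases h0 : χ (x₀ : Circ) = 0
  · obtain ⟨M, hM⟩ := hz x₀ h0
    have hMN : M ≤ N := hN.1 ⟨x₀, hM⟩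
    obtain ⟨-, hM0, hM1⟩ := hM
    have ht := taylor_isLittleO_univ (f := lift χ) (x₀ := x₀) (n := 2 * M)
      (contDiff_infty.mp hsm (2 * M))
    set e : ℝ := ((2 * M).factorial : ℝ)⁻¹ * iteratedDeriv (2 * M) (lift χ) x₀ with he
    have he0 : 0 < e := by positivity
    have hT : ∀ x, taylorWithinEval (lift χ) (2 * M) Set.univ x₀ x = e * (x - x₀) ^ (2 * M) := by
      intro x
      rw [taylor_within_apply, Finset.sum_range_succ, Finset.sum_eq_zero, iteratedDerivWithin_univ,
        smul_eq_mul, he]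
      · ring
      · intro k hk
        rw [iteratedDerivWithin_univ, hM0 k (Finset.mem_range.mp hk), smul_zero]
    refine ⟨e / 2, by positivity, ?_⟩
    filter_upwards [ht.bound (half_pos he0), hnear] with x hx hx1
    rw [hT, Real.norm_eq_abs, Real.norm_eq_abs, abs_pow, ← (even_two_mul M).pow_abs] at hx
    have h1 := (abs_le.mp hx).1
    have h2 : |x - x₀| ^ (2 * N) ≤ |x - x₀| ^ (2 * M) :=
      pow_le_pow_of_le_one (abs_nonneg _) hx1 (by omega)
    nlinarith
  · have hpos : 0 < lift χ x₀ := (hχ _).lt_of_ne' h0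
    refine ⟨lift χ x₀ / 2, by positivity, ?_⟩
    filter_upwards [(continuous_lift χ).continuousAt.eventually_const_lt (half_lt_self hpos),
      hnear] with x hx hx1
    have : |x - x₀| ^ (2 * N) ≤ 1 := pow_le_one₀ (abs_nonneg _) hx1
    nlinarith

lemma exists_finset_pow_le_lift {χ : C(Circ, ℝ)} (hd : FiniteDegeneracy χ) {N : ℕ}
    (hN : IsMaxDegeneracy χ N) :
    ∃ (F : Finset ℝ) (c : ℝ), 0 < c ∧ ∀ x ∈ Set.Icc 0 (2 * Real.pi), ∃ i ∈ F,
      c * |x - i| ^ (2 * N) ≤ lift χ x := by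
  choose c hc0 hc using exists_pow_le_lift hd hN
  obtain ⟨F, -, hF⟩ := isCompact_Icc.elim_nhds_subcover _
    fun x (_ : x ∈ Set.Icc 0 (2 * Real.pi)) => hc x
  obtain ⟨d, hd1, hd0⟩ := (((Finset.eventually_all F).mpr fun i _ =>
    (nhdsWithin_le_nhds (eventually_le_nhds (hc0 i)) :
      ∀ᶠ d in 𝓝[>] (0 : ℝ), d ≤ c i)).and self_mem_nhdsWithin).exists
  refine ⟨F, d, hd0, fun x hx => ?_⟩
  obtain ⟨i, hi, hxi⟩ := Set.mem_iUnion₂.mp (hF hx)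
  exact ⟨i, hi, le_trans (mul_le_mul_of_nonneg_right (hd1 i hi) (by positivity)) hxi⟩

/-- The integral of `(s - f)₊`, when `f ≥ s` outside the `r`-neighbourhood of a finite set. -/
lemma integral_max_le {f : ℝ → ℝ} (hf : Continuous f) (hf0 : ∀ x, 0 ≤ f x) {F : Finset ℝ}
    {r s T : ℝ} (hT : 0 ≤ T) (hr : 0 ≤ r) (hs : 0 ≤ s)
    (h : ∀ x ∈ Set.Icc 0 T, (∀ i ∈ F, r < |x - i|) → s ≤ f x) :
    ∫ t in (0 : ℝ)..T, max (s - f t) 0 ≤ F.card * (2 * r * s) := by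
  have hint : ∀ i, Integrable (Set.indicator (Set.Icc (i - r) (i + r)) fun _ : ℝ => s) := fun i =>
    (integrable_indicator_iff measurableSet_Icc).mpr (integrableOn_const (by simp))
  have hval : ∀ i, ∫ x, Set.indicator (Set.Icc (i - r) (i + r)) (fun _ : ℝ => s) x
      = 2 * r * s := fun i => by
    rw [integral_indicator measurableSet_Icc, setIntegral_const, smul_eq_mul, measureReal_def,
      Real.volume_Icc, ENNReal.toReal_ofReal (by linarith)]
    ring
  have hnn : ∀ i x, 0 ≤ Set.indicator (Set.Icc (i - r) (i + r)) (fun _ : ℝ => s) x := fun i x =>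
    Set.indicator_nonneg (fun _ _ => hs) x
  calc ∫ t in (0 : ℝ)..T, max (s - f t) 0
      ≤ ∫ t in (0 : ℝ)..T, ∑ i ∈ F, Set.indicator (Set.Icc (i - r) (i + r)) (fun _ => s) t := by
        refine intervalIntegral.integral_mono_on hT
          (Continuous.intervalIntegrable (by fun_prop) _ _)
          (integrable_finsetSum _ fun i _ => hint i).intervalIntegrable fun x hx => ?_
        by_cases hx1 : ∀ i ∈ F, r < |x - i|
        · rw [max_eq_right (by have := h x hx hx1; linarith)]
          exact Finset.sum_nonneg fun i _ => hnn i x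
        · push Not at hx1
          obtain ⟨i, hi, hxi⟩ := hx1
          refine le_trans ?_ (Finset.single_le_sum (fun j _ => hnn j x) hi)
          rw [Set.indicator_of_mem]
          · exact max_le (by have := hf0 x; linarith) hs
          · rw [abs_le] at hxi
            constructor <;> linarith
    _ ≤ ∫ t, ∑ i ∈ F, Set.indicator (Set.Icc (i - r) (i + r)) (fun _ => s) t := by
        rw [intervalIntegral.integral_of_le hT]
        exact setIntegral_le_integral (integrable_finsetSum _ fun i _ => hint i)
          (Filter.Eventually.of_forall fun x => Finset.sum_nonneg fun i _ => hnn i x)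
    _ = F.card * (2 * r * s) := by
        rw [integral_finsetSum _ fun i _ => hint i, Finset.sum_congr rfl fun i _ => hval i,
          Finset.sum_const, nsmul_eq_mul]

/-- The resonance-free region for finitely degenerate damping. -/
theorem exists_im_lt_of_finiteDegeneracy {β : ℝ≥0} (hβ : (1 / 2 : ℝ≥0) < β) (hβ1 : β ≤ 1)
    {χ : C(Circ, ℝ)} (hχβ : MemHolder β χ) (hχ0 : χ ≠ 0) (hd : FiniteDegeneracy χ) {N : ℕ}
    (hN : IsMaxDegeneracy χ N) {γ : ℝ} (hγ : 0 < γ) :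
    ∃ C : ℝ, 0 < C ∧ ∀ τ ∈ resonances χ, C < |τ.re| →
      τ.im < -(C⁻¹ * |τ.re| ^ (-(2 * N / (2 * N + 1) : ℝ) - γ)) := by
  obtain ⟨F, c, hc, hF⟩ := exists_finset_pow_le_lift hd hN
  obtain ⟨A, ε, hA, hε, h⟩ := exists_no_resonance hβ hβ1 hχβ hd.2.1 hχ0 (4 * F.card)
  obtain ⟨A₂, hA₂⟩ := Filter.eventually_atTop.mp ((tendsto_rpow_neg_atTop hγ).eventually_lt_const
    (lt_min hε (half_pos hc)))
  refine ⟨max A (max 1 A₂), by positivity, fun τ hτ ha => ?_⟩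
  by_contra! hb
  set C := max A (max 1 A₂)
  obtain ⟨ha1, ha2, ha3⟩ : A < |τ.re| ∧ 1 < |τ.re| ∧ A₂ < |τ.re| := by
    simpa only [C, max_lt_iff] using ha
  set a := |τ.re|
  have ha0 : 0 < a := by linarith
  obtain ⟨hγε, hγc⟩ := lt_min_iff.mp (hA₂ a ha3.le)
  have hC1 : C⁻¹ ≤ 1 := inv_le_one_of_one_le₀ ((le_max_left _ _).trans (le_max_right _ _))
  set q : ℝ := 2 * N / (2 * N + 1) with hq
  have hq0 : 0 ≤ q := by positivity
  have hb1 : -a ^ (-q - γ) ≤ τ.im := by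
    have : C⁻¹ * a ^ (-q - γ) ≤ 1 * a ^ (-q - γ) := by gcongr
    linarith
  have hqγ : a ^ (-q - γ) ≤ a ^ (-γ) := Real.rpow_le_rpow_of_exponent_le ha2.le (by linarith)
  refine not_le.mpr (h τ hτ ha1 (by linarith)) ?_
  -- outside the `r`-neighbourhood of `F` the damping exceeds `2 |Im τ|`
  set s := 2 * a ^ (-q - γ) with hs
  set r := a ^ (-(1 / (2 * N + 1)) : ℝ) with hr
  have hr2 : r ^ (2 * N) = a ^ (-q) := by
    rw [hr, ← Real.rpow_natCast, ← Real.rpow_mul ha0.le, hq]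
    congr 1
    push_cast
    ring
  have hsr : s ≤ c * r ^ (2 * N) := by
    rw [hr2, hs, sub_eq_add_neg, Real.rpow_add ha0]
    have : a ^ (-q) * a ^ (-γ) ≤ a ^ (-q) * (c / 2) := by gcongr
    linarith
  have hI : ∫ t in (0 : ℝ)..(2 * Real.pi), max (-(lift χ t + 2 * τ.im)) 0
      ≤ ∫ t in (0 : ℝ)..(2 * Real.pi), max (s - lift χ t) 0 := by
    have := continuous_lift χ
    refine intervalIntegral.integral_mono_on Real.two_pi_pos.le
      (Continuous.intervalIntegrable (by fun_prop) _ _)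
      (Continuous.intervalIntegrable (by fun_prop) _ _) fun t _ => ?_
    refine max_le_max ?_ le_rfl
    linarith
  have hI2 := integral_max_le (F := F) (r := r) (s := s) (continuous_lift χ) (fun x => hd.2.1 _)
    Real.two_pi_pos.le (by positivity) (by positivity) fun x hx hxF => by
      obtain ⟨i, hi, hxi⟩ := hF x hx
      refine hsr.trans (le_trans ?_ hxi)
      have := (hxF i hi).le
      gcongr
  calc _ ≤ a * (F.card * (2 * r * s)) := by
        gcongr
        exact hI.trans hI2
    _ = 4 * F.card * a ^ (-γ) := by
      have : a ^ (-γ) = a ^ (1 : ℝ) * a ^ (-(1 / (2 * N + 1)) : ℝ) * a ^ (-q - γ) := by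
        rw [← Real.rpow_add ha0, ← Real.rpow_add ha0]
        congr 1
        rw [hq]
        field_simp
        ring
      rw [this, hr, hs, Real.rpow_one]
      ring
    _ ≤ 4 * F.card * 1 := by
      gcongr
      exact Real.rpow_le_one_of_one_le_of_nonpos ha2.le (by linarith)
    _ = _ := mul_one _

/-! ### Reduction of a quadratic eigenvalue problem to a finite dimensional one -/

/-- Analytic dependence on `z` of the small solution of `f + A(f) = z Y(f)`, when `A` vanishes to
second order at `0`. -/
lemma exists_analyticAt_solution {W : Type*} [NormedAddCommGroup W] [NormedSpace ℂ W]
    [CompleteSpace W] {A Y : W → W} (hA : ContDiffAt ℂ ω A 0) (hY : ContDiffAt ℂ ω Y 0)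
    (hA0 : A 0 = 0) (hA1 : HasFDerivAt A (0 : W →L[ℂ] W) 0) :
    ∃ f : ℂ → W, AnalyticAt ℂ f 0 ∧ f 0 = 0 ∧ HasDerivAt f (Y 0) 0 ∧
      ∀ᶠ z in 𝓝 0, f z + A (f z) - z • Y (f z) = 0 := by
  let Φ : ℂ × W → W := fun v => v.2 + A v.2 - v.1 • Y v.2
  have h2 : ContDiffAt ℂ ω (fun v : ℂ × W => v.2) ((0, 0) : ℂ × W) := contDiffAt_snd
  have hcd : ContDiffAt ℂ ω Φ ((0, 0) : ℂ × W) :=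
    (h2.add (ContDiffAt.comp _ (show ContDiffAt ℂ ω A ((0, 0) : ℂ × W).2 from hA) h2)).sub
      (contDiffAt_fst.smul
        (ContDiffAt.comp _ (show ContDiffAt ℂ ω Y ((0, 0) : ℂ × W).2 from hY) h2))
  have hfd : HasFDerivAt Φ (ContinuousLinearMap.snd ℂ ℂ W
      - (ContinuousLinearMap.fst ℂ ℂ W).smulRight (Y 0)) ((0, 0) : ℂ × W) := by
    have hs : HasFDerivAt (fun v : ℂ × W => v.2) (ContinuousLinearMap.snd ℂ ℂ W) (0, 0) :=
      hasFDerivAt_snd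
    have hf : HasFDerivAt (fun v : ℂ × W => v.1) (ContinuousLinearMap.fst ℂ ℂ W) (0, 0) :=
      hasFDerivAt_fst
    have hA2 := HasFDerivAt.comp ((0, 0) : ℂ × W)
      (show HasFDerivAt A _ ((0, 0) : ℂ × W).2 from hA1) hs
    have hYd : HasFDerivAt Y (fderiv ℂ Y 0) 0 := (hY.differentiableAt (by simp)).hasFDerivAt
    have hY2 := HasFDerivAt.comp ((0, 0) : ℂ × W)
      (show HasFDerivAt Y _ ((0, 0) : ℂ × W).2 from hYd) hs
    refine ((hs.add hA2).sub (hf.smul hY2)).congr_fderiv ?_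
    ext v <;> simp
  have hinr : fderiv ℂ Φ (0, 0) ∘L ContinuousLinearMap.inr ℂ ℂ W = ContinuousLinearMap.id ℂ W := by
    rw [hfd.fderiv]
    ext v
    simp
  have hinl : fderiv ℂ Φ (0, 0) ∘L ContinuousLinearMap.inl ℂ ℂ W
      = -(ContinuousLinearMap.id ℂ ℂ).smulRight (Y 0) := by
    rw [hfd.fderiv]
    ext
    simp
  have hinv : (fderiv ℂ Φ (0, 0) ∘L ContinuousLinearMap.inr ℂ ℂ W).IsInvertible := by
    rw [hinr]
    exact ⟨ContinuousLinearEquiv.refl ℂ W, rfl⟩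
  have hω : (ω : WithTop ℕ∞) ≠ 0 := by simp
  refine ⟨hcd.implicitFunction hω hinv, ?_, ?_, ?_, ?_⟩
  · exact (hcd.contDiffAt_implicitFunction hω hinv).analyticAt
  · exact hcd.implicitFunction_apply_self hω hinv
  · have h := (hcd.hasStrictFDerivAt_implicitFunction hω hinv).hasFDerivAt.hasDerivAt
    rw [hinl, hinr] at h
    simpa using h
  · filter_upwards [hcd.eventually_apply_implicitFunction hω hinv] with z hz
    refine Eq.trans hz ?_
    simp [Φ, hA0]

/-- Data that isolate the eigenvalue `κ²` of an operator `D`, relative to the embedding `J`: the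
space `V` parametrizes the eigenvectors through `ι`, the map `p` is the corresponding spectral
projection, and `G` is the reduced resolvent. -/
structure IsSpectralReduction {H L V : Type*} [NormedAddCommGroup H] [NormedSpace ℂ H]
    [NormedAddCommGroup L] [NormedSpace ℂ L] [NormedAddCommGroup V] [NormedSpace ℂ V]
    (κ : ℂ) (J D : H →L[ℂ] L) (ι : V →L[ℂ] H) (p : L →L[ℂ] V) (G : L →L[ℂ] H) : Prop where
  D_ι : ∀ c, D (ι c) = κ ^ 2 • J (ι c)
  p_ι : ∀ c, p (J (ι c)) = c
  D_G : ∀ g, D (G g) - κ ^ 2 • J (G g) = g - J (ι (p g))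
  p_G : ∀ g, p (J (G g)) = 0
  G_D : ∀ w, G (D w - κ ^ 2 • J w) = w - ι (p (J w))
  G_ι : ∀ c, G (J (ι c)) = 0

section Reduction

variable {H L V : Type*} [NormedAddCommGroup H] [NormedSpace ℂ H]
  [NormedAddCommGroup L] [NormedSpace ℂ L]
  [NormedAddCommGroup V] [NormedSpace ℂ V]
  {κ : ℂ} {J D : H →L[ℂ] L} {ι : V →L[ℂ] H} {p : L →L[ℂ] V} {G : L →L[ℂ] H}

/-- If the operators `X` and `T` satisfy `D X - i z M X T - X T² = 0` and are close enough to `ι`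
and `κ`, then the quadratic eigenvalue problem `D u - i z τ M u - τ² u = 0` for `τ` near `κ` is
equivalent to the eigenvalue problem of `T`. The reason is the factorization
`(D - i z τ M - τ²) X = Z (T - τ)` and the fact that the operator in `hN`, which inverts the
remaining part of the problem, is close to the identity. -/
lemma IsSpectralReduction.eigenvalue_iff (h : IsSpectralReduction κ J D ι p G) (hκ : κ ≠ 0)
    {M : L →L[ℂ] L} {z τ : ℂ} {f : V →L[ℂ] L} {X : V →L[ℂ] H} {T : V →L[ℂ] V}
    (hX : ∀ c, X c = ι c + G (f c))
    (heq : ∀ c, D (X c) - (Complex.I * z) • M (J (X (T c))) - J (X (T (T c))) = 0)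
    {Q : L →L[ℂ] L}
    (hQ : ∀ g, Q g = (2 * κ)⁻¹ • ((Complex.I * z) • M (J (X (p g)))
        + (J (X (T (p g))) + τ • J (X (p g))))
      + (D (G g) - (Complex.I * z * τ) • M (J (G g)) - τ ^ 2 • J (G g)))
    (hN : ‖Q - 1‖ < 1) :
    (∃ u, u ≠ 0 ∧ D u - (Complex.I * z * τ) • M (J u) - τ ^ 2 • J u = 0) ↔
      ∃ c, c ≠ 0 ∧ T c = τ • c := by
  have hpX : ∀ c, p (J (X c)) = c := fun c => by
    rw [hX, map_add, map_add, h.p_ι, h.p_G, add_zero]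
  have hQinj : ∀ g, Q g = 0 → g = 0 := by
    intro g hg
    have h1 : ‖g‖ ≤ ‖Q - 1‖ * ‖g‖ := by
      refine le_trans (le_of_eq ?_) ((Q - 1).le_opNorm g)
      rw [sub_apply, hg, one_apply_eq_self, zero_sub, norm_neg]
    by_contra hg0
    have := norm_pos_iff.mpr hg0
    nlinarith
  -- the factorization of the operator pencil on the range of `X`
  have hfac : ∀ c, D (X c) - (Complex.I * z * τ) • M (J (X c)) - τ ^ 2 • J (X c)
      = (Complex.I * z) • M (J (X (T c - τ • c)))
        + (J (X (T (T c - τ • c))) + τ • J (X (T c - τ • c))) := by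
    intro c
    have h1 := heq c
    rw [sub_sub, sub_eq_zero] at h1
    rw [h1]
    simp only [map_sub, map_smul, smul_sub, smul_smul]
    match_scalars <;> ring
  constructor
  · rintro ⟨u, hu0, hu⟩
    -- split `u` into `X c` and the part `w = G g` without component along `V`; then
    -- `2κ ι (T - τ) c + g` lies in the kernel of `Q`
    set c := p (J u) with hc
    set w := u - X c with hw
    set g := D w - κ ^ 2 • J w with hg
    have hpw : p (J w) = 0 := by rw [hw, map_sub, map_sub, hpX, sub_self]
    have hGg : G g = w := by rw [hg, h.G_D, hpw, map_zero, sub_zero]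
    have hpg : p g = 0 := by
      have h1 := h.D_G g
      rw [hGg, ← hg] at h1
      have h2 : J (ι (p g)) = 0 := sub_eq_self.mp h1.symm
      rw [← h.p_ι (p g), h2, map_zero]
    have h3 := hQ ((2 * κ) • J (ι (T c - τ • c)) + g)
    have h4 : p ((2 * κ) • J (ι (T c - τ • c)) + g) = (2 * κ) • (T c - τ • c) := by
      rw [map_add, map_smul, h.p_ι, hpg, add_zero]
    have h5 : G ((2 * κ) • J (ι (T c - τ • c)) + g) = w := by
      rw [map_add, map_smul, h.G_ι, smul_zero, zero_add, hGg]
    rw [h4, h5] at h3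
    have h6 : Q ((2 * κ) • J (ι (T c - τ • c)) + g) = 0 := by
      rw [h3, ← hu, show u = X c + w by rw [hw]; abel]
      have h7 := hfac c
      simp only [map_add, map_smul, smul_add] at h7 ⊢
      rw [add_sub_add_comm, add_sub_add_comm, h7]
      congr 1
      match_scalars <;> field_simp
    have h8 := hQinj _ h6
    rw [h8, map_zero] at h4 h5
    have h9 : T c - τ • c = 0 := by
      have := h4.symm
      rwa [smul_eq_zero_iff_right (by simpa using hκ)] at this
    refine ⟨c, fun hc0 => hu0 ?_, sub_eq_zero.mp h9⟩
    rw [← sub_add_cancel u (X c), ← hw, ← h5, hc0, map_zero, add_zero]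
  · rintro ⟨c, hc0, hc⟩
    refine ⟨X c, fun h0 => hc0 (by rw [← hpX c, h0, map_zero, map_zero]), ?_⟩
    rw [hfac, hc, sub_self]
    simp

/-- Reduction of the quadratic eigenvalue problem `D u - i z τ M u - τ² u = 0`, for small `z` and
for `τ` near `κ`, to the eigenvalue problem of an operator `T(z)` on `V` that is analytic in `z`. -/
theorem IsSpectralReduction.exists_reduction [CompleteSpace L]
    (h : IsSpectralReduction κ J D ι p G) (hκ : κ ≠ 0) (M : L →L[ℂ] L) :
    ∃ T : ℂ → (V →L[ℂ] V), AnalyticAt ℂ T 0 ∧ T 0 = κ • 1 ∧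
      HasDerivAt T (-(Complex.I / 2) • p.comp (M.comp (J.comp ι))) 0 ∧
      ∀ᶠ v : ℂ × ℂ in 𝓝 (0, κ),
        ((∃ u, u ≠ 0 ∧ D u - (Complex.I * v.1 * v.2) • M (J u) - v.2 ^ 2 • J u = 0) ↔
          ∃ c, c ≠ 0 ∧ T v.1 c = v.2 • c) := by
  -- For `X = ι + G f` and `T = κ - (2κ)⁻¹ p f` the equation `D X - i z M X T - X T² = 0` becomes
  -- `f + A(f) = z Y(f)`, since the linear part `f - ι p f + ι p f` of `D X - X T²` is `f`.
  let X : (V →L[ℂ] L) → (V →L[ℂ] H) := fun f => ι + G.comp f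
  let S : (V →L[ℂ] L) → (V →L[ℂ] V) := fun f => (2 * κ)⁻¹ • p.comp f
  let T : (V →L[ℂ] L) → (V →L[ℂ] V) := fun f => κ • 1 - S f
  let R : (V →L[ℂ] L) → (V →L[ℂ] L) := fun f =>
    (2 * κ) • J.comp (G.comp f) - (J.comp (X f)).comp (S f)
  let A : (V →L[ℂ] L) → (V →L[ℂ] L) := fun f => (R f).comp (S f)
  let Y : (V →L[ℂ] L) → (V →L[ℂ] L) := fun f => Complex.I • (M.comp (J.comp (X f))).comp (T f)
  have hXc : ContDiff ℂ ω X := contDiff_const.add (contDiff_const.clm_comp contDiff_id)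
  have hSc : ContDiff ℂ ω S := (contDiff_const.clm_comp contDiff_id).const_smul _
  have hTc : ContDiff ℂ ω T := contDiff_const.sub hSc
  have hRc : ContDiff ℂ ω R :=
    ((contDiff_const.clm_comp (contDiff_const.clm_comp contDiff_id)).const_smul _).sub
      ((contDiff_const.clm_comp hXc).clm_comp hSc)
  have hAc : ContDiff ℂ ω A := hRc.clm_comp hSc
  have hYc : ContDiff ℂ ω Y :=
    ((contDiff_const.clm_comp (contDiff_const.clm_comp hXc)).clm_comp hTc).const_smul _
  have hS0 : S 0 = 0 := by simp [S]
  have hX0 : X 0 = ι := by simp [X]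
  have hT0 : T 0 = κ • 1 := by simp [T, hS0]
  have hR0 : R 0 = 0 := by simp [R, hS0]
  have hA0 : A 0 = 0 := by simp [A, hS0]
  have hA1 : HasFDerivAt A (0 : (V →L[ℂ] L) →L[ℂ] (V →L[ℂ] L)) 0 := by
    have h1 := (hRc.differentiable (by simp) 0).hasFDerivAt.clm_comp
      (hSc.differentiable (by simp) 0).hasFDerivAt
    refine h1.congr_fderiv ?_
    rw [hR0, hS0]
    ext
    simp
  obtain ⟨f, hf, hf0, hf1, hf2⟩ := exists_analyticAt_solution hAc.contDiffAt hYc.contDiffAt hA0 hA1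
  refine ⟨fun z => T (f z), ?_, ?_, ?_, ?_⟩
  · exact (hTc.contDiffAt.analyticAt).comp hf
  · change T (f 0) = _
    rw [hf0, hT0]
  · have h1 := (((ContinuousLinearMap.compL ℂ V L V p).hasFDerivAt.comp_hasDerivAt (0 : ℂ)
      hf1).const_smul (2 * κ)⁻¹).const_sub (κ • (1 : V →L[ℂ] V))
    refine h1.congr_deriv ?_
    ext c
    have hY0 : Y 0 c = Complex.I • M (J (ι (κ • c))) := by simp [Y, hX0, hT0]
    change -((2 * κ)⁻¹ • p (Y 0 c)) = -(Complex.I / 2) • p (M (J (ι c)))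
    rw [hY0]
    simp only [map_smul, smul_smul, ← neg_smul]
    congr 1
    field_simp
  · let Q : ℂ × ℂ → (L →L[ℂ] L) := fun v =>
      (2 * κ)⁻¹ • ((Complex.I * v.1) • (M.comp (J.comp (X (f v.1)))).comp p
        + ((J.comp ((X (f v.1)).comp ((T (f v.1)).comp p))) + v.2 • (J.comp (X (f v.1))).comp p))
      + (D.comp G - (Complex.I * v.1 * v.2) • M.comp (J.comp G) - v.2 ^ 2 • J.comp G)
    have hfc : ContinuousAt (fun v : ℂ × ℂ => f v.1) (0, κ) :=
      ContinuousAt.comp (f := Prod.fst) (g := f) (x := ((0, κ) : ℂ × ℂ)) hf.continuousAt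
        continuousAt_fst
    have hXf : ContinuousAt (fun v : ℂ × ℂ => X (f v.1)) (0, κ) :=
      hXc.continuous.continuousAt.comp hfc
    have hTf : ContinuousAt (fun v : ℂ × ℂ => T (f v.1)) (0, κ) :=
      hTc.continuous.continuousAt.comp hfc
    have hQc : ContinuousAt Q (0, κ) := by
      have h1 : ContinuousAt (fun v : ℂ × ℂ => v.1) (0, κ) := continuousAt_fst
      have h2 : ContinuousAt (fun v : ℂ × ℂ => v.2) (0, κ) := continuousAt_snd
      fun_prop
    have hQ0 : Q (0, κ) = 1 := by
      ext g
      have h1 := h.D_G g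
      simp only [Q, hf0, hX0, hT0]
      simp only [add_apply, sub_apply, smul_apply, ContinuousLinearMap.comp_apply, mul_zero,
        zero_mul, zero_smul, one_apply_eq_self, map_smul, zero_add, sub_zero, h1]
      match_scalars
      · field_simp
        ring
      · ring
    have hQ1 : ∀ᶠ v in 𝓝 ((0, κ) : ℂ × ℂ), ‖Q v - 1‖ < 1 := by
      have h1 : ContinuousAt (fun v => ‖Q v - 1‖) (0, κ) := (hQc.sub continuousAt_const).norm
      refine h1.eventually_lt_const ?_
      simp [hQ0]
    have hf3 : ∀ᶠ v : ℂ × ℂ in 𝓝 (0, κ), f v.1 + A (f v.1) - v.1 • Y (f v.1) = 0 :=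
      (continuousAt_fst (p := ((0, κ) : ℂ × ℂ))).eventually hf2
    filter_upwards [hQ1, hf3] with v hv1 hv2
    refine h.eigenvalue_iff hκ (f := f v.1) (X := X (f v.1)) (fun c => rfl) (fun c => ?_)
      (fun g => rfl) hv1
    have h1 : (f v.1 + A (f v.1) - v.1 • Y (f v.1)) c = 0 := by rw [hv2, zero_apply]
    rw [← h1]
    have h2 := h.D_G (f v.1 c)
    rw [sub_eq_iff_eq_add] at h2
    simp only [A, R, Y, T, X, S, add_apply, sub_apply, smul_apply, ContinuousLinearMap.comp_apply,
      map_add, map_sub, map_smul, one_apply_eq_self, h.D_ι, h2]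
    match_scalars <;> field_simp <;> ring

end Reduction

/-! ### Eigenvalues of analytic families of `2 × 2` matrices -/

lemma eventually_contDiffAt_ofReal {h : ℂ → ℂ} (hh : AnalyticAt ℂ h 0) :
    ∀ᶠ t : ℝ in 𝓝[>] 0, ContDiffAt ℝ ∞ (fun t : ℝ => h t) t := by
  have h1 : ∀ᶠ t : ℝ in 𝓝 0, AnalyticAt ℂ h (t : ℂ) :=
    (Complex.continuous_ofReal.tendsto' 0 0 Complex.ofReal_zero).eventually
      hh.eventually_analyticAt
  filter_upwards [nhdsWithin_le_nhds h1] with t ht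
  exact (ht.contDiffAt (n := ∞)).restrict_scalars ℝ |>.comp t Complex.ofRealCLM.contDiff.contDiffAt

/-- An analytic function that does not vanish at `0` has an analytic square root near `0`, with
prescribed value at `0`. -/
lemma exists_analyticAt_sq_eq {g : ℂ → ℂ} (hg : AnalyticAt ℂ g 0) {c : ℂ} (hc : c ≠ 0)
    (hc2 : c ^ 2 = g 0) : ∃ h : ℂ → ℂ, AnalyticAt ℂ h 0 ∧ h 0 = c ∧ ∀ᶠ z in 𝓝 0, h z ^ 2 = g z := by
  have hg0 : g 0 ≠ 0 := by rw [← hc2]; exact pow_ne_zero 2 hc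
  have hq : AnalyticAt ℂ (fun z => g z / g 0) 0 := hg.div analyticAt_const hg0
  have hq0 : g 0 / g 0 = 1 := div_self hg0
  have hl : AnalyticAt ℂ (fun z => Complex.log (g z / g 0)) 0 :=
    hq.clog (by rw [hq0]; exact Complex.one_mem_slitPlane)
  refine ⟨fun z => c * Complex.exp (Complex.log (g z / g 0) / 2), ?_, ?_, ?_⟩
  · exact analyticAt_const.mul (hl.div analyticAt_const two_ne_zero).cexp
  · simp [hq0]
  · filter_upwards [hg.continuousAt.eventually_ne hg0] with z hz
    rw [mul_pow, ← Complex.exp_nat_mul, hc2, Nat.cast_two, mul_div_cancel₀ _ two_ne_zero,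
      Complex.exp_log (div_ne_zero hz hg0), mul_div_cancel₀ _ hg0]

/-- On a right neighbourhood of `0` in `ℝ`, an analytic function `d` has a smooth square root with
prescribed limit at `0`. When `d` has a zero of odd order `m`, the factor `√t ^ m` has no smooth
extension to `t = 0`. -/
lemma exists_contDiffAt_sq_eq {d : ℂ → ℂ} (hd : AnalyticAt ℂ d 0) {c : ℂ} (hc : c ^ 2 = d 0) :
    ∃ δ : ℝ → ℂ, (∀ᶠ t in 𝓝[>] 0, ContDiffAt ℝ ∞ δ t) ∧ (∀ᶠ t : ℝ in 𝓝[>] 0, δ t ^ 2 = d t) ∧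
      Filter.Tendsto δ (𝓝[>] 0) (𝓝 c) := by
  have hof : Filter.Tendsto (fun t : ℝ => (t : ℂ)) (𝓝[>] 0) (𝓝 0) :=
    (Complex.continuous_ofReal.tendsto' 0 0 Complex.ofReal_zero).mono_left nhdsWithin_le_nhds
  by_cases h0 : ∀ᶠ z in 𝓝 0, d z = 0
  · refine ⟨fun _ => 0, Filter.Eventually.of_forall fun t => contDiffAt_const, ?_, ?_⟩
    · filter_upwards [hof.eventually h0] with t ht
      rw [ht, zero_pow two_ne_zero]
    · rw [h0.self_of_nhds, sq_eq_zero_iff] at hc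
      rw [hc]
      exact tendsto_const_nhds
  obtain ⟨m, g, hg, hg0, hdg⟩ := hd.exists_eventuallyEq_pow_smul_nonzero_iff.mpr h0
  simp only [sub_zero, smul_eq_mul] at hdg
  obtain ⟨b, hb, hbc⟩ : ∃ b : ℂ, b ^ 2 = g 0 ∧ (m = 0 → b = c) := by
    rcases Nat.eq_zero_or_pos m with rfl | hm
    · refine ⟨c, ?_, fun _ => rfl⟩
      rw [hc, hdg.self_of_nhds]
      simp
    · obtain ⟨b, hb⟩ := IsAlgClosed.exists_pow_nat_eq (g 0) two_pos
      exact ⟨b, hb, fun h => by omega⟩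
  have hb0 : b ≠ 0 := by
    rintro rfl
    exact hg0 (by rw [← hb, zero_pow two_ne_zero])
  obtain ⟨h, hh, hh0, hhg⟩ := exists_analyticAt_sq_eq hg hb0 hb
  refine ⟨fun t => ((√t ^ m : ℝ) : ℂ) * h t, ?_, ?_, ?_⟩
  · filter_upwards [eventually_contDiffAt_ofReal hh, self_mem_nhdsWithin] with t ht ht0
    refine ContDiffAt.mul ?_ ht
    exact Complex.ofRealCLM.contDiff.contDiffAt.comp t
      ((Real.contDiffAt_sqrt (Set.mem_Ioi.mp ht0).ne').pow m)
  · filter_upwards [hof.eventually hhg, hof.eventually hdg, self_mem_nhdsWithin] with t h1 h2 h3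
    rw [mul_pow, h1, h2, ← Complex.ofReal_pow, ← pow_mul, mul_comm m 2, pow_mul,
      Real.sq_sqrt (Set.mem_Ioi.mp h3).le, Complex.ofReal_pow]
  · have h1 : Filter.Tendsto (fun t : ℝ => ((√t ^ m : ℝ) : ℂ)) (𝓝[>] 0) (𝓝 ((0 ^ m : ℝ) : ℂ)) := by
      refine (Continuous.tendsto' (by fun_prop) 0 _ (by simp)).mono_left nhdsWithin_le_nhds
    have h2 : Filter.Tendsto (fun t : ℝ => h t) (𝓝[>] 0) (𝓝 b) := by
      have := hh.continuousAt.tendsto.comp hof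
      rwa [hh0] at this
    convert h1.mul h2 using 2
    rcases Nat.eq_zero_or_pos m with rfl | hm
    · simp [hbc rfl]
    · rw [hdg.self_of_nhds, zero_pow hm.ne', zero_mul, sq_eq_zero_iff] at hc
      rw [hc, zero_pow hm.ne', Complex.ofReal_zero, zero_mul]

/-- The eigenvalues of an analytic family of `2 × 2` matrices with entries `a, b, c, d`, which is
scalar at `0`: to first order they are given by the eigenvalues of the derivative at `0`. -/
lemma exists_roots {a b c d : ℂ → ℂ} {κ a' b' c' d' r : ℂ}
    (ha : AnalyticAt ℂ a 0) (hb : AnalyticAt ℂ b 0) (hc : AnalyticAt ℂ c 0)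
    (hd : AnalyticAt ℂ d 0) (ha0 : a 0 = κ) (hb0 : b 0 = 0) (hc0 : c 0 = 0) (hd0 : d 0 = κ)
    (ha' : HasDerivAt a a' 0) (hb' : HasDerivAt b b' 0) (hc' : HasDerivAt c c' 0)
    (hd' : HasDerivAt d d' 0) (hr : r ^ 2 = (a' - d') ^ 2 + 4 * (b' * c')) :
    ∃ τp τm : ℝ → ℂ, (∀ᶠ t in 𝓝[>] 0, ContDiffAt ℝ ∞ τp t) ∧
      (∀ᶠ t in 𝓝[>] 0, ContDiffAt ℝ ∞ τm t) ∧
      (∀ᶠ t : ℝ in 𝓝[>] 0, ∀ z, (z - a t) * (z - d t) - b t * c t = 0 ↔ z = τp t ∨ z = τm t) ∧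
      (fun t : ℝ => τp t - (κ + (a' + d' + r) / 2 * t)) =o[𝓝[>] 0] (fun t : ℝ => t) ∧
      (fun t : ℝ => τm t - (κ + (a' + d' - r) / 2 * t)) =o[𝓝[>] 0] (fun t : ℝ => t) := by
  -- the discriminant divided by `z ^ 2`
  let E : ℂ → ℂ := fun z => (dslope a 0 z - dslope d 0 z) ^ 2 + 4 * (dslope b 0 z * dslope c 0 z)
  have hE : AnalyticAt ℂ E 0 :=
    (((analyticAt_dslope ha).sub (analyticAt_dslope hd)).pow 2).add
      (analyticAt_const.mul ((analyticAt_dslope hb).mul (analyticAt_dslope hc)))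
  have hE0 : r ^ 2 = E 0 := by
    simp only [E, dslope_same, ha'.deriv, hb'.deriv, hc'.deriv, hd'.deriv, hr]
  obtain ⟨δ, hδ1, hδ2, hδ3⟩ := exists_contDiffAt_sq_eq hE hE0
  have hds : ∀ {f : ℂ → ℂ} {w : ℂ}, f 0 = w → ∀ z, f z = w + z * dslope f 0 z := by
    intro f w hf z
    have := sub_smul_dslope f 0 z
    rw [sub_zero, smul_eq_mul, hf] at this
    rw [this]
    ring
  have hsmooth : ∀ s : ℂ, ∀ᶠ t in 𝓝[>] 0,
      ContDiffAt ℝ ∞ (fun t : ℝ => (a t + d t) / 2 + s * (t * δ t)) t := by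
    intro s
    filter_upwards [eventually_contDiffAt_ofReal ha, eventually_contDiffAt_ofReal hd, hδ1]
      with t h1 h2 h3
    have h4 : ContDiffAt ℝ ∞ (fun t : ℝ => (t : ℂ)) t := Complex.ofRealCLM.contDiff.contDiffAt
    exact ((h1.add h2).div_const 2).add (contDiffAt_const.mul (h4.mul h3))
  have hasymp : ∀ s : ℂ, (fun t : ℝ => (a t + d t) / 2 + s * (t * δ t)
      - (κ + ((a' + d') / 2 + s * r) * t)) =o[𝓝[>] 0] (fun t : ℝ => t) := by
    intro s
    have h1 : (fun z : ℂ => (a z + d z) / 2 - κ - z * ((a' + d') / 2)) =o[𝓝 0] (fun z => z) := by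
      have := ((ha'.add hd').div_const 2).isLittleO
      simpa [ha0, hd0, add_self_div_two, mul_comm] using this
    have hof : Filter.Tendsto (fun t : ℝ => (t : ℂ)) (𝓝[>] 0) (𝓝 0) :=
      (Complex.continuous_ofReal.tendsto' 0 0 Complex.ofReal_zero).mono_left nhdsWithin_le_nhds
    have h2 : (fun t : ℝ => s * (δ t - r) * t) =o[𝓝[>] 0] (fun t : ℝ => (t : ℂ)) := by
      have h3 : Filter.Tendsto (fun t : ℝ => s * (δ t - r)) (𝓝[>] 0) (𝓝 0) := by
        have := (hδ3.sub_const r).const_mul s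
        simpa using this
      have h4 := ((isLittleO_one_iff ℂ).mpr h3).mul_isBigO
        (isBigO_refl (fun t : ℝ => (t : ℂ)) (𝓝[>] 0))
      simpa using h4
    have h5 := ((h1.comp_tendsto hof).add h2).norm_right
    simp only [Function.comp_def, Complex.norm_real] at h5
    refine (h5.of_norm_right).congr_left fun t => ?_
    ring
  refine ⟨fun t => (a t + d t) / 2 + 1 / 2 * (t * δ t),
    fun t => (a t + d t) / 2 + -1 / 2 * (t * δ t),
    hsmooth _, hsmooth _, ?_, ?_, ?_⟩
  · filter_upwards [hδ2] with t ht z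
    have hprod : (z - a t) * (z - d t) - b t * c t =
        (z - ((a t + d t) / 2 + 1 / 2 * (t * δ t)))
          * (z - ((a t + d t) / 2 + -1 / 2 * (t * δ t))) := by
      have h1 : (t : ℂ) ^ 2 * δ t ^ 2 = (a t - d t) ^ 2 + 4 * (b t * c t) := by
        rw [ht, hds ha0 t, hds hb0 t, hds hc0 t, hds hd0 t]
        ring
      linear_combination (1 / 4 : ℂ) * h1
    rw [hprod, mul_eq_zero, sub_eq_zero, sub_eq_zero]
  · refine (hasymp (1 / 2)).congr_left fun t => ?_
    ring
  · refine (hasymp (-1 / 2)).congr_left fun t => ?_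
    ring

/-! ### Resonances near `√k` -/

lemma exists_eigenvector_iff (T : ℂ × ℂ →L[ℂ] ℂ × ℂ) (z : ℂ) :
    (∃ v, v ≠ 0 ∧ T v = z • v) ↔
      (z - (T (1, 0)).1) * (z - (T (0, 1)).2) - (T (0, 1)).1 * (T (1, 0)).2 = 0 := by
  set a := (T (1, 0)).1 with ha
  set b := (T (0, 1)).1 with hb
  set c := (T (1, 0)).2 with hc
  set d := (T (0, 1)).2 with hd
  have hT : ∀ x y : ℂ, T (x, y) = (x * a + y * b, x * c + y * d) := by
    intro x y
    have h1 : ((x, y) : ℂ × ℂ) = x • (1, 0) + y • (0, 1) := by simp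
    rw [h1, map_add, map_smul, map_smul]
    rfl
  constructor
  · rintro ⟨⟨x, y⟩, hv, h⟩
    rw [hT] at h
    simp only [Prod.smul_mk, smul_eq_mul, Prod.mk.injEq] at h
    obtain ⟨h1, h2⟩ := h
    by_contra hne
    refine hv (Prod.ext ?_ ?_)
    · refine (mul_eq_zero.mp ?_).resolve_left hne
      linear_combination (d - z) * h1 - b * h2
    · refine (mul_eq_zero.mp ?_).resolve_left hne
      linear_combination (a - z) * h2 - c * h1
  · intro h
    by_cases h1 : ((b, z - a) : ℂ × ℂ) = 0
    · obtain ⟨hb0, haz⟩ := Prod.mk.inj h1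
      by_cases h2 : ((z - d, c) : ℂ × ℂ) = 0
      · obtain ⟨hdz, hc0⟩ := Prod.mk.inj h2
        refine ⟨(1, 0), by simp, ?_⟩
        rw [hT, hb0, hc0]
        ext
        · simp [sub_eq_zero.mp haz]
        · simp
      · refine ⟨_, h2, ?_⟩
        rw [hT]
        ext
        · simp only [Prod.smul_mk, smul_eq_mul]
          linear_combination (d - z) * haz + c * hb0
        · simp only [Prod.smul_mk, smul_eq_mul]
          ring
    · refine ⟨_, h1, ?_⟩
      rw [hT]
      ext
      · simp only [Prod.smul_mk, smul_eq_mul]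
        ring
      · simp only [Prod.smul_mk, smul_eq_mul]
        linear_combination -h

lemma coeff_neg_eq_conj (χ : C(Circ, ℝ)) (n : ℤ) :
    coeff (fun x => (χ x : ℂ)) (-n) = (starRingEnd ℂ) (coeff (fun x => (χ x : ℂ)) n) := by
  rw [coeff, coeff, fourierCoeff, fourierCoeff, ← integral_conj]
  refine integral_congr_ae (Filter.Eventually.of_forall fun x => ?_)
  simp only [smul_eq_mul, map_mul, Complex.conj_ofReal, fourier_neg, Complex.conj_conj]

/-- The eigenvectors of `|D|` for the eigenvalue `k > 0`, spanned by `e^{ikx}` and `e^{-ikx}`. -/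
def modes (k : ℤ) : ℂ × ℂ →L[ℂ] H1 :=
  (ContinuousLinearMap.fst ℂ ℂ ℂ).smulRight (expH k)
    + (ContinuousLinearMap.snd ℂ ℂ ℂ).smulRight (expH (-k))

/-- The Fourier coefficients at `k` and `-k`. -/
def modeCoeff (k : ℤ) : L2 →L[ℂ] ℂ × ℂ := (coeffL k).prod (coeffL (-k))

/-- The reduced resolvent of `|D|` at the eigenvalue `k`: the multiplier `(|n| - k)⁻¹`, with the
value `0` at `n = ± k`, where the inverse has the value `0⁻¹ = 0`. -/
def reducedResolvent (k : ℤ) (hk : 0 < k) : L2 →L[ℂ] H1 :=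
  have hinv : ∀ n : ℤ, ‖(((|n| - k : ℤ) : ℂ))⁻¹‖ ≤ 1 := fun n => by
    rw [norm_inv, Complex.norm_intCast]
    rcases eq_or_ne (|n| - k) 0 with h | h
    · simp [h]
    · exact inv_le_one_of_one_le₀ (by exact_mod_cast Int.one_le_abs h)
  multH (fun n => (((|n| - k : ℤ) : ℂ))⁻¹) (1 + k)
    (fun n => (hinv n).trans (by
      have : (0 : ℝ) < k := by exact_mod_cast hk
      linarith))
    (fun n => by
      have hk' : (0 : ℝ) < k := by exact_mod_cast hk
      rcases eq_or_ne (|n| - k) 0 with h | h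
      · rw [h]
        simp only [Int.cast_zero, inv_zero, mul_zero, norm_zero]
        positivity
      · have h1 : ((|n| : ℤ) : ℂ) * (((|n| - k : ℤ) : ℂ))⁻¹ = 1 + k * (((|n| - k : ℤ) : ℂ))⁻¹ := by
          have : ((|n| - k : ℤ) : ℂ) ≠ 0 := by exact_mod_cast h
          field_simp
          push_cast
          ring
        rw [h1]
        refine (norm_add_le _ _).trans ?_
        rw [norm_one, norm_mul, Complex.norm_intCast, abs_of_pos hk']
        have := mul_le_mul_of_nonneg_left (hinv n) hk'.le
        linarith)

lemma coeff_reducedResolvent (k : ℤ) (hk : 0 < k) (g : L2) (n : ℤ) :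
    coeff (incl (reducedResolvent k hk g)) n = (((|n| - k : ℤ) : ℂ))⁻¹ * coeff g n := by
  rw [reducedResolvent, incl_multH, coeff_mult]

lemma coeff_modes (k : ℤ) (c : ℂ × ℂ) (n : ℤ) : coeff (incl (modes k c)) n
    = c.1 * (if n = k then 1 else 0) + c.2 * (if n = -k then 1 else 0) := by
  have h : incl (modes k c) = c.1 • expL k + c.2 • expL (-k) := rfl
  rw [h, coeff_add, coeff_smul, coeff_smul, coeff_expL, coeff_expL]

lemma modeCoeff_apply (k : ℤ) (g : L2) : modeCoeff k g = (coeff g k, coeff g (-k)) := by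
  rw [← coeffL_apply, ← coeffL_apply]
  rfl

lemma isSpectralReduction {k : ℤ} (hk : 0 < k) {κ : ℂ} (hκ : κ ^ 2 = k) :
    IsSpectralReduction κ incl absD (modes k) (modeCoeff k) (reducedResolvent k hk) := by
  have hkk : |k| = k := abs_of_pos hk
  have hne : k ≠ -k := by omega
  have hcase : ∀ n : ℤ, n = k ∨ n = -k ∨ ((|n| - k : ℤ) : ℂ) ≠ 0 ∧ n ≠ k ∧ n ≠ -k := by
    intro n
    by_cases h1 : n = k
    · exact Or.inl h1
    by_cases h2 : n = -k
    · exact Or.inr (Or.inl h2)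
    refine Or.inr (Or.inr ⟨?_, h1, h2⟩)
    rw [Int.cast_ne_zero, sub_ne_zero]
    intro h
    rcases abs_choice n with h3 | h3 <;> omega
  have hsub : ∀ (w : H1) (n : ℤ), coeff (absD w - κ ^ 2 • incl w : L2) n
      = ((|n| - k : ℤ) : ℂ) * coeff (incl w) n := by
    intro w n
    rw [coeff_sub, coeff_smul, coeff_absD, hκ]
    push_cast
    ring
  refine ⟨fun c => ?_, fun c => ?_, fun g => ?_, fun g => ?_, fun w => ?_, fun c => ?_⟩
  · refine sub_eq_zero.mp (ext_coeff fun n => ?_)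
    rw [hsub, coeff_modes, coeff_zero]
    rcases hcase n with rfl | rfl | ⟨-, h1, h2⟩
    · simp [hkk]
    · simp [hkk]
    · simp [h1, h2]
  · rw [modeCoeff_apply, coeff_modes, coeff_modes]
    simp [hne, hne.symm]
  · refine ext_coeff fun n => ?_
    rw [hsub, coeff_reducedResolvent, coeff_sub, coeff_modes, modeCoeff_apply]
    rcases hcase n with rfl | rfl | ⟨h0, h1, h2⟩
    · simp [hkk, hne]
    · simp [hkk, hne.symm]
    · rw [mul_inv_cancel_left₀ h0]
      simp [h1, h2]
  · rw [modeCoeff_apply, coeff_reducedResolvent, coeff_reducedResolvent]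
    simp [hkk]
  · refine ext_coeffH fun n => ?_
    rw [coeff_reducedResolvent, hsub, map_sub, coeff_sub, coeff_modes, modeCoeff_apply]
    rcases hcase n with rfl | rfl | ⟨h0, h1, h2⟩
    · simp [hkk, hne]
    · simp [hkk, hne.symm]
    · rw [inv_mul_cancel_left₀ h0]
      simp [h1, h2]
  · refine ext_coeffH fun n => ?_
    rw [coeff_reducedResolvent, coeff_modes, map_zero, coeff_zero]
    rcases hcase n with rfl | rfl | ⟨-, h1, h2⟩
    · simp [hkk]
    · simp [hkk]
    · simp [h1, h2]

lemma tendsto_of_isLittleO {τ : ℝ → ℂ} {κ e : ℂ}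
    (h : (fun t : ℝ => τ t - (κ + e * t)) =o[𝓝[>] 0] (fun t : ℝ => t)) :
    Filter.Tendsto τ (𝓝[>] 0) (𝓝 κ) := by
  have h1 := h.trans_tendsto (tendsto_nhdsWithin_of_tendsto_nhds Filter.tendsto_id)
  have h2 : Filter.Tendsto (fun t : ℝ => κ + e * t) (𝓝[>] 0) (𝓝 κ) :=
    (Continuous.tendsto' (by fun_prop) 0 _ (by simp)).mono_left nhdsWithin_le_nhds
  simpa using h1.add h2

/-- The resonances near `√k` for the damping `ν χ`, where `ν > 0` is small. -/
theorem exists_resonances_near_sqrt {χ : C(Circ, ℝ)} (hχ : ∀ x, 0 ≤ χ x) {k : ℤ} (hk : 0 < k) :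
    ∃ νk : ℝ, 0 < νk ∧ ∃ U : Set ℂ, IsOpen U ∧ ((√(k : ℝ) : ℝ) : ℂ) ∈ U ∧
      ∃ τp τm : ℝ → ℂ,
        ContDiffOn ℝ ∞ τp (Set.Ioo 0 νk) ∧ ContDiffOn ℝ ∞ τm (Set.Ioo 0 νk) ∧
        (∀ ν ∈ Set.Ioo 0 νk, τp ν ∈ U ∧ τm ν ∈ U) ∧
        (∀ ν ∈ Set.Ioo 0 νk, resonances (ν • χ) ∩ U = {τp ν, τm ν}) ∧
        (fun ν : ℝ => τp ν - (((√(k : ℝ) : ℝ) : ℂ) -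
            (coeff (fun x => (χ x : ℂ)) 0 + ‖coeff (fun x => (χ x : ℂ)) (2 * k)‖) / 2
              * Complex.I * ν)) =o[𝓝[>] 0] (fun ν : ℝ => ν) ∧
        (fun ν : ℝ => τm ν - (((√(k : ℝ) : ℝ) : ℂ) -
            (coeff (fun x => (χ x : ℂ)) 0 - ‖coeff (fun x => (χ x : ℂ)) (2 * k)‖) / 2
              * Complex.I * ν)) =o[𝓝[>] 0] (fun ν : ℝ => ν) := by
  have hk' : (0 : ℝ) < k := by exact_mod_cast hk
  set κ : ℂ := ((√(k : ℝ) : ℝ) : ℂ) with hκdef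
  have hκ2 : κ ^ 2 = k := by
    rw [hκdef, ← Complex.ofReal_pow, Real.sq_sqrt hk'.le, Complex.ofReal_intCast]
  have hκ0 : κ ≠ 0 := by
    rw [hκdef, Complex.ofReal_ne_zero]
    exact (Real.sqrt_pos.mpr hk').ne'
  set X := fun n : ℤ => coeff (fun x => (χ x : ℂ)) n with hX
  obtain ⟨T, hT, hT0, hT1, hev⟩ :=
    (isSpectralReduction hk hκ2).exists_reduction hκ0 (mulOp χ)
  let en (q : ℂ × ℂ →L[ℂ] ℂ) (v : ℂ × ℂ) : (ℂ × ℂ →L[ℂ] ℂ × ℂ) →L[ℂ] ℂ :=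
    q.comp (ContinuousLinearMap.apply ℂ (ℂ × ℂ) v)
  have hen : ∀ q v, AnalyticAt ℂ (fun z => en q v (T z)) 0 := fun q v =>
    ((en q v).analyticAt _).comp hT
  have hen1 : ∀ q v, HasDerivAt (fun z => en q v (T z)) (en q v (-(Complex.I / 2) •
      (modeCoeff k).comp ((mulOp χ).comp (incl.comp (modes k))))) 0 := fun q v =>
    (en q v).hasFDerivAt.comp_hasDerivAt (0 : ℂ) hT1
  have hm1 : incl (modes k (1, 0)) = expL k := by
    change (1 : ℂ) • expL k + (0 : ℂ) • expL (-k) = _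
    rw [one_smul, zero_smul, add_zero]
  have hm2 : incl (modes k (0, 1)) = expL (-k) := by
    change (0 : ℂ) • expL k + (1 : ℂ) • expL (-k) = _
    rw [one_smul, zero_smul, zero_add]
  have hd1 : (-(Complex.I / 2) • (modeCoeff k).comp ((mulOp χ).comp (incl.comp (modes k)))) (1, 0)
      = (-(Complex.I / 2) * X 0, -(Complex.I / 2) * X (-(2 * k))) := by
    rw [smul_apply, ContinuousLinearMap.comp_apply, ContinuousLinearMap.comp_apply,
      ContinuousLinearMap.comp_apply, hm1, modeCoeff_apply, coeff_mulOp_expL, coeff_mulOp_expL,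
      sub_self, show -k - k = -(2 * k) by ring]
    rfl
  have hd2 : (-(Complex.I / 2) • (modeCoeff k).comp ((mulOp χ).comp (incl.comp (modes k)))) (0, 1)
      = (-(Complex.I / 2) * X (2 * k), -(Complex.I / 2) * X 0) := by
    rw [smul_apply, ContinuousLinearMap.comp_apply, ContinuousLinearMap.comp_apply,
      ContinuousLinearMap.comp_apply, hm2, modeCoeff_apply, coeff_mulOp_expL, coeff_mulOp_expL,
      sub_self, show k - -k = 2 * k by ring]
    rfl
  have hr : (-(Complex.I * ‖X (2 * k)‖)) ^ 2
      = (-(Complex.I / 2) * X 0 - -(Complex.I / 2) * X 0) ^ 2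
        + 4 * (-(Complex.I / 2) * X (2 * k) * (-(Complex.I / 2) * X (-(2 * k)))) := by
    have h1 : X (2 * k) * X (-(2 * k)) = (‖X (2 * k)‖ : ℂ) ^ 2 := by
      simp only [hX]
      rw [coeff_neg_eq_conj, Complex.mul_conj, Complex.normSq_eq_norm_sq, Complex.ofReal_pow]
    linear_combination -Complex.I ^ 2 * h1
  have e11 := hen1 (ContinuousLinearMap.fst ℂ ℂ ℂ) (1, 0)
  have e12 := hen1 (ContinuousLinearMap.fst ℂ ℂ ℂ) (0, 1)
  have e21 := hen1 (ContinuousLinearMap.snd ℂ ℂ ℂ) (1, 0)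
  have e22 := hen1 (ContinuousLinearMap.snd ℂ ℂ ℂ) (0, 1)
  simp only [en, ContinuousLinearMap.comp_apply, ContinuousLinearMap.apply_apply, hd1, hd2,
    ContinuousLinearMap.coe_fst', ContinuousLinearMap.coe_snd'] at e11 e12 e21 e22
  obtain ⟨τp, τm, hp, hm, hroots, hpo, hmo⟩ := exists_roots (κ := κ)
    (hen (ContinuousLinearMap.fst ℂ ℂ ℂ) (1, 0)) (hen (ContinuousLinearMap.fst ℂ ℂ ℂ) (0, 1))
    (hen (ContinuousLinearMap.snd ℂ ℂ ℂ) (1, 0)) (hen (ContinuousLinearMap.snd ℂ ℂ ℂ) (0, 1))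
    (by simp [en, hT0]) (by simp [en, hT0]) (by simp [en, hT0]) (by simp [en, hT0])
    e11 e12 e21 e22 hr
  obtain ⟨W, U, hW, h0W, hU, hκU, hWU⟩ := mem_nhds_prod_iff'.mp hev
  have hW' : ∀ᶠ t : ℝ in 𝓝[>] 0, (t : ℂ) ∈ W :=
    ((Complex.continuous_ofReal.tendsto' 0 0 Complex.ofReal_zero).mono_left
      nhdsWithin_le_nhds).eventually (hW.mem_nhds h0W)
  have hpU := (tendsto_of_isLittleO hpo).eventually (hU.mem_nhds hκU)
  have hmU := (tendsto_of_isLittleO hmo).eventually (hU.mem_nhds hκU)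
  obtain ⟨νk, hνk, hsub⟩ := mem_nhdsGT_iff_exists_Ioo_subset.mp
    (hp.and (hm.and (hroots.and (hW'.and (hpU.and hmU)))))
  refine ⟨νk, hνk, U, hU, hκU, τp, τm, fun ν hν => (hsub hν).1.contDiffWithinAt,
    fun ν hν => (hsub hν).2.1.contDiffWithinAt, fun ν hν => (hsub hν).2.2.2.2, fun ν hν => ?_,
    ?_, ?_⟩
  · obtain ⟨-, -, hν1, hνW, hνp, hνm⟩ := hsub hν
    have hiff : ∀ τ ∈ U, τ ∈ resonances (ν • χ) ↔ τ = τp ν ∨ τ = τm ν := by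
      intro τ hτ
      rw [mem_resonances_iff (fun x => mul_nonneg hν.1.le (hχ x)), ← hν1 τ]
      have h1 := hWU (Set.mk_mem_prod hνW hτ)
      refine Iff.trans ?_ (Iff.trans h1 (exists_eigenvector_iff _ _))
      simp only [P_apply, mulOp_smul, smul_apply, smul_smul, mul_right_comm _ _ τ]
    ext τ
    rw [Set.mem_inter_iff, Set.mem_insert_iff, Set.mem_singleton_iff]
    constructor
    · rintro ⟨h1, h2⟩
      exact (hiff τ h2).mp h1
    · intro h
      have hτU : τ ∈ U := by rcases h with rfl | rfl <;> assumption
      exact ⟨(hiff τ hτU).mpr h, hτU⟩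
  · refine hpo.congr_left fun t => ?_
    simp only [hX]
    ring
  · refine hmo.congr_left fun t => ?_
    simp only [hX]
    ring

end DampedWave

end

theorem theorem3 (β : ℝ≥0) (hβ : (1 / 2 : ℝ≥0) < β) (hβ1 : β ≤ 1)
    (χ : C(DampedWave.Circ, ℝ)) (hχβ : MemHolder β χ) (hχ : ∀ x, 0 ≤ χ x) (hχ0 : χ ≠ 0) :
    -- the resolvent is a meromorphic family on `ℂ` with poles of finite rank
    (∀ τ₀ : ℂ, (∀ᶠ τ in 𝓝[≠] τ₀, (DampedWave.P χ τ).IsInvertible) ∧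
      DampedWave.FiniteRankMeromorphicAt (DampedWave.resolvent χ) τ₀) ∧
    -- resonance-free region
    (∃ C : ℝ, 0 < C ∧ ∀ τ ∈ DampedWave.resonances χ, C < |τ.re| →
      τ.im < -(C⁻¹ * |τ.re|⁻¹)) ∧
    -- larger resonance-free region for finitely degenerate damping
    (DampedWave.FiniteDegeneracy χ → ∀ N : ℕ, DampedWave.IsMaxDegeneracy χ N →
      ∀ γ : ℝ, 0 < γ → ∃ C : ℝ, 0 < C ∧ ∀ τ ∈ DampedWave.resonances χ, C < |τ.re| →
        τ.im < -(C⁻¹ * |τ.re| ^ (-(2 * N / (2 * N + 1) : ℝ) - γ))) ∧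
    -- resonances near `√k` for small damping
    (∀ k : ℤ, 0 < k → ∃ νk : ℝ, 0 < νk ∧ ∃ U : Set ℂ, IsOpen U ∧ ((√(k : ℝ) : ℝ) : ℂ) ∈ U ∧
      ∃ τp τm : ℝ → ℂ,
        ContDiffOn ℝ ∞ τp (Set.Ioo 0 νk) ∧ ContDiffOn ℝ ∞ τm (Set.Ioo 0 νk) ∧
        (∀ ν ∈ Set.Ioo 0 νk, τp ν ∈ U ∧ τm ν ∈ U) ∧
        (∀ ν ∈ Set.Ioo 0 νk, DampedWave.resonances (ν • χ) ∩ U = {τp ν, τm ν}) ∧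
        (fun ν : ℝ => τp ν - (((√(k : ℝ) : ℝ) : ℂ) -
            (DampedWave.coeff (fun x => (χ x : ℂ)) 0
              + ‖DampedWave.coeff (fun x => (χ x : ℂ)) (2 * k)‖) / 2 * Complex.I * ν))
          =o[𝓝[>] 0] (fun ν : ℝ => ν) ∧
        (fun ν : ℝ => τm ν - (((√(k : ℝ) : ℝ) : ℂ) -
            (DampedWave.coeff (fun x => (χ x : ℂ)) 0
              - ‖DampedWave.coeff (fun x => (χ x : ℂ)) (2 * k)‖) / 2 * Complex.I * ν))
          =o[𝓝[>] 0] (fun ν : ℝ => ν)) := by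
  open DampedWave in
  exact ⟨fun τ₀ => ⟨(fredholm hχ τ₀).1, (fredholm hχ τ₀).2.1⟩,
    exists_im_lt hβ hβ1 hχβ hχ hχ0,
    fun hd N hN γ hγ => exists_im_lt_of_finiteDegeneracy hβ hβ1 hχβ hχ0 hd hN hγ,
    fun k hk => exists_resonances_near_sqrt hχ hk⟩
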